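/- Let $g\ge 0$ and $n\ge 1$ be integers, and let $\mathbf H_g$ be the Siegel upper half space of symmetric complex $g\times g$ matrices with positive definite imaginary part. For real vectors $\varepsilon,\varepsilon'\in\mathbb R^g$, $z\in\mathbb C^g$ and $\tau\in\mathbf H_g$ put $$\Theta\begin{bmatrix}\varepsilon\\ \varepsilon'\end{bmatrix}(z,\tau)=\sum_{l\in\mathbb Z^g}\exp 2\pi i\Big\{\tfrac12\big(l+\tfrac{\varepsilon}{2}\big)^t\tau\big(l+\tfrac{\varepsilon}{2}\big)+\big(l+\tfrac{\varepsilon}{2}\big)^t\big(z+\tfrac{\varepsilon'}{2}\big)\Big\}.$$ Let $D_n$ be the finite set of characteristics $(\varepsilon,\varepsilon')$ with $\varepsilon_i\in\{0,1\}$ and $\varepsilon'_i=l_i/2^{n-1}$, $l_i\in\mathbb Z$, $0\le l_i<2^n$, for $i=1,\dots,g$; so $D_1\subseteq D_n$ is the set of the integral characteristics in $D_n$. For $\tau\in\mathbf H_g$ let $\alpha_n(\tau)=\big(\Theta\begin{bmatrix}\varepsilon\\ \varepsilon'\end{bmatrix}(0,\tau)\big)_{(\varepsilon,\varepsilon')\in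 D_n}$. Then $\alpha_n(\tau)\ne 0$ for every $\tau\in\mathbf H_g$, so that $\psi_n(\tau)=[\alpha_n(\tau)]$ defines a map from $\mathbf H_g$ to the complex projective space with homogeneous coordinates indexed by $D_n$. Let $X_n=\psi_n(\mathbf H_g)$, with the topology induced from the classical topology of the projective space. Omitting the coordinates that belong to the non-integral characteristics gives a well-defined map $\varphi_n:X_n\to X_1$, and $\varphi_n$ is a finite map: it is continuous and closed, and all its fibres are finite (equivalently, it is proper with finite fibres). -/

import Mathlib

open scoped LinearAlgebra.Projectivization Matrix

namespace ThetaConst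

noncomputable section

/-- The Siegel upper half space `H_g`: symmetric complex `g × g` matrices whose imaginary part is
positive definite. -/
def SiegelUpperHalfSpace (g : ℕ) : Type :=
  {τ : Matrix (Fin g) (Fin g) ℂ // τ.IsSymm ∧ (τ.map Complex.im).PosDef}

/-- The theta function `Θ[ε; ε'](z, τ)` with real characteristic `(ε, ε')`, that is
`∑_{l ∈ ℤ^g} exp 2πi {½ (l + ε/2)ᵗ τ (l + ε/2) + (l + ε/2)ᵗ (z + ε'/2)}`. -/
def theta {g : ℕ} (ε ε' : Fin g → ℝ) (z : Fin g → ℂ) (τ : SiegelUpperHalfSpace g) : ℂ :=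
  ∑' l : Fin g → ℤ,
    let v : Fin g → ℂ := fun i => (l i : ℂ) + (ε i : ℂ) / 2
    let w : Fin g → ℂ := fun i => z i + (ε' i : ℂ) / 2
    Complex.exp (2 * Real.pi * Complex.I * ((1 / 2) * (v ⬝ᵥ (τ.1 *ᵥ v)) + v ⬝ᵥ w))

/-- The characteristics `(ε, ε')` with `εᵢ ∈ {0, 1}` and `ε'ᵢ = l / 2^(n-1)`, `0 ≤ l < 2^n`
(used for `n ≥ 1`). -/
def D (g n : ℕ) : Set ((Fin g → ℚ) × (Fin g → ℚ)) :=
  {c | (∀ i, c.1 i = 0 ∨ c.1 i = 1) ∧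
    ∀ i, ∃ l : ℕ, l < 2 ^ n ∧ c.2 i = (l : ℚ) / 2 ^ (n - 1)}

/-- `D_1` consists exactly of the integral characteristics in `D_n`. -/
theorem mem_D_one_iff {g n : ℕ} (hn : 1 ≤ n) (c : (Fin g → ℚ) × (Fin g → ℚ)) :
    c ∈ D g 1 ↔ c ∈ D g n ∧ ∀ i, ∃ k : ℤ, c.2 i = (k : ℚ) := by
  obtain ⟨m, rfl⟩ : ∃ m, n = m + 1 := ⟨n - 1, by omega⟩
  have hp : (0 : ℚ) < 2 ^ m := by positivity
  constructor
  · rintro ⟨h1, h2⟩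
    refine ⟨⟨h1, fun i => ?_⟩, fun i => ?_⟩
    · obtain ⟨l, hl, h⟩ := h2 i
      refine ⟨l * 2 ^ m, ?_, ?_⟩
      · rw [pow_succ, mul_comm]
        exact Nat.mul_lt_mul_of_pos_left (by simpa using hl) (by positivity)
      · rw [h]
        simp
    · obtain ⟨l, -, h⟩ := h2 i
      exact ⟨l, by simp [h]⟩
  · rintro ⟨⟨h1, h2⟩, h3⟩
    refine ⟨h1, fun i => ?_⟩
    obtain ⟨l, hl, h⟩ := h2 i
    obtain ⟨k, hk⟩ := h3 i
    have hl' : (l : ℚ) < 2 ^ (m + 1) := by exact_mod_cast hl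
    simp only [Nat.add_sub_cancel] at h
    have h0 : (0 : ℚ) ≤ k := by rw [← hk, h]; positivity
    have h4 : (k : ℚ) < 2 := by
      rw [← hk, h, div_lt_iff₀ hp]
      rw [pow_succ] at hl'
      linarith
    have h0' : 0 ≤ k := by exact_mod_cast h0
    have h4' : k < 2 := by exact_mod_cast h4
    refine ⟨k.toNat, by omega, ?_⟩
    have h5 : ((k.toNat : ℤ) : ℚ) = (k : ℚ) := by rw [Int.toNat_of_nonneg h0']
    rw [hk, ← h5, Int.cast_natCast, Nat.sub_self, pow_zero, div_one]

/-- The vector `α_n(τ)` of theta constants `Θ[ε; ε'](0, τ)`, `(ε, ε') ∈ D_n`. -/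
def alpha (g n : ℕ) (τ : SiegelUpperHalfSpace g) : D g n → ℂ :=
  fun c => theta (fun i => (c.1.1 i : ℝ)) (fun i => (c.1.2 i : ℝ)) 0 τ

/-- The image `X_n` of `H_g` under `ψ_n : τ ↦ [α_n(τ)]` in the complex projective space with one
homogeneous coordinate for each element of `D_n`. -/
def X (g n : ℕ) : Set (ℙ ℂ (D g n → ℂ)) :=
  {P | ∃ (τ : SiegelUpperHalfSpace g) (h : alpha g n τ ≠ 0),
    P = Projectivization.mk ℂ (alpha g n τ) h}

/-- Omit the coordinates that belong to non-integral characteristics. -/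
def forget {g n : ℕ} (hn : 1 ≤ n) (v : D g n → ℂ) : D g 1 → ℂ :=
  fun c => v ⟨c.1, ((mem_D_one_iff hn c.1).1 c.2).1⟩

/-- Complex projective space carries its classical topology, the quotient topology from the
nonzero vectors; subsets of it carry the subspace topology. -/
instance instTopologicalSpaceProj (ι : Type*) : TopologicalSpace (ℙ ℂ (ι → ℂ)) :=
  TopologicalSpace.coinduced (Projectivization.mk' ℂ) inferInstance

/-- A finite map in the sense of complex analytic geometry: continuous and closed, with finite
fibres (equivalently, proper with finite fibres). -/
def IsFiniteMap {S T : Type*} [TopologicalSpace S] [TopologicalSpace T] (f : S → T) : Prop :=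
  Continuous f ∧ IsClosedMap f ∧ ∀ t : T, (f ⁻¹' {t}).Finite

end

end ThetaConst

open scoped LinearAlgebra.Projectivization Matrix

namespace ThetaConst

noncomputable section

/-! Everything rests on Riemann's quartic relation `riemann_quartic`: θ[a](b)^4 equals 2^(-g) times
a sum, over binary vectors s and t, of a phase times θ[2a+s/2](2b+t/2) · θ[s/2](t/2)^3. Let M be the
supremum of |θ[a](b)| over all real characteristics and m the maximum over the half-integral ones.
The relation gives M^4 ≤ 2^g M m^3, hence M ≤ 2^g m (`thetaSup_le`). Since M > 0, the half-integral
constants never vanish simultaneously, so the vectors `alpha` are nonzero and omitting coordinates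
is well defined on the images.

Finite fibres: once the half-integral constants are fixed, the relation determines the fourth power
of a constant with denominator 2^(k+2) from constants with denominator 2^(k+1). By induction each
normalized coordinate takes finitely many values (`finite_normalizedValues`).

Closedness is a compactness argument. Near the image of τ₀ in X_1, the half-integral constants that
do not vanish at τ₀ dominate all the others. Suppose τ is such a point and the norm form
`siegelForm` is tiny at an integral vector (p, q) with an odd entry. A theta series that changes
sign along τp + q is then small compared with M, by a Cauchy estimate
(`norm_thetaSeries_le_of_short`). One half-integral constant of this kind is nonzero at τ₀
(`exists_half_char_ne_zero`): otherwise the quartic relation would make θ^4 agree, up to an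
exponential factor, with its translate by (τp + q)/2, and this contradicts the quasi-periodicity of
θ. That constant would be both small and comparable to M at τ. So the norm form is bounded below on
nonzero integral vectors (`exists_siegelQuad_lower_bound`).

Minkowski's theorem now yields linearly independent integral vectors of bounded length. Their
alternating Gram matrices and residues form a finite set, so a symplectic matrix congruent to 1
modulo 2^(2n+2) carries τ into a fixed compact set (`exists_bounded_representative`,
`exists_mem_compactRegion`). By `exists_thetaSeries_proportional`, proved through the uniqueness of
θ as a quasi-periodic entire function (`eq_const_mul_thetaSeries`), this does not move the point of
X_n. Locally, the image of a closed set is thus contained in the image of a compact part of it. -/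

/-! ### Real and integral vectors as complex vectors -/

/-- A real vector as a complex vector. -/
def cv {g : ℕ} (x : Fin g → ℝ) : Fin g → ℂ := fun i => (x i : ℂ)

/-- An integral vector as a real vector. -/
def iv {g : ℕ} (l : Fin g → ℤ) : Fin g → ℝ := fun i => (l i : ℝ)

theorem cv_add {g : ℕ} (x y : Fin g → ℝ) : cv (x + y) = cv x + cv y := by
  ext i; simp [cv]

theorem cv_smul {g : ℕ} (r : ℝ) (x : Fin g → ℝ) : cv (r • x) = (r : ℂ) • cv x := by
  ext i; simp [cv]

theorem cv_sub {g : ℕ} (x y : Fin g → ℝ) : cv (x - y) = cv x - cv y := by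
  ext i; simp [cv]

@[simp] theorem cv_zero {g : ℕ} : cv (0 : Fin g → ℝ) = 0 := by
  ext i; simp [cv]

theorem cv_dotProduct_cv {g : ℕ} (x y : Fin g → ℝ) : cv x ⬝ᵥ cv y = ((x ⬝ᵥ y : ℝ) : ℂ) := by
  simp [cv, dotProduct]

theorem mulVec_cv {g : ℕ} (M : Matrix (Fin g) (Fin g) ℝ) (x : Fin g → ℝ) :
    M.map Complex.ofReal *ᵥ cv x = cv (M *ᵥ x) := by
  ext i; simp [cv, Matrix.mulVec, dotProduct]

theorem iv_add {g : ℕ} (l m : Fin g → ℤ) : iv (l + m) = iv l + iv m := by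
  ext i; simp [iv]

theorem iv_neg {g : ℕ} (l : Fin g → ℤ) : iv (-l) = -iv l := by
  ext i; simp [iv]

theorem iv_smul {g : ℕ} (k : ℤ) (l : Fin g → ℤ) : iv (k • l) = (k : ℝ) • iv l := by
  ext i; simp [iv]

@[simp] theorem iv_zero {g : ℕ} : iv (0 : Fin g → ℤ) = 0 := by
  ext i; simp [iv]

theorem iv_dotProduct_iv {g : ℕ} (l m : Fin g → ℤ) : iv l ⬝ᵥ iv m = ((l ⬝ᵥ m : ℤ) : ℝ) := by
  simp [iv, dotProduct]

theorem im_cv_dotProduct {g : ℕ} (x : Fin g → ℝ) (z : Fin g → ℂ) :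
    (cv x ⬝ᵥ z).im = x ⬝ᵥ fun i => (z i).im := by
  simp [cv, dotProduct]

theorem im_mulVec_cv {g : ℕ} (τ : Matrix (Fin g) (Fin g) ℂ) (x : Fin g → ℝ) (i : Fin g) :
    ((τ *ᵥ cv x) i).im = (τ.map Complex.im *ᵥ x) i := by
  simp [cv, dotProduct, Matrix.mulVec]

theorem re_mulVec_cv {g : ℕ} (τ : Matrix (Fin g) (Fin g) ℂ) (x : Fin g → ℝ) (i : Fin g) :
    ((τ *ᵥ cv x) i).re = (τ.map Complex.re *ᵥ x) i := by
  simp [cv, dotProduct, Matrix.mulVec]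

theorem im_quadratic {g : ℕ} (τ : Matrix (Fin g) (Fin g) ℂ) (x : Fin g → ℝ) :
    (cv x ⬝ᵥ τ *ᵥ cv x).im = x ⬝ᵥ τ.map Complex.im *ᵥ x := by
  rw [im_cv_dotProduct]
  congr 1
  ext i
  exact im_mulVec_cv τ x i

theorem dotProduct_mulVec_symm {g : ℕ} {R : Type*} [CommRing R] {τ : Matrix (Fin g) (Fin g) R}
    (hτ : τ.IsSymm) (x y : Fin g → R) : x ⬝ᵥ τ *ᵥ y = y ⬝ᵥ τ *ᵥ x := by
  rw [Matrix.dotProduct_mulVec, ← Matrix.mulVec_transpose, hτ.eq, dotProduct_comm]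

/-! ### The theta series with real characteristic -/

/-- The general term of the theta series. -/
def expTerm {g : ℕ} (τ : Matrix (Fin g) (Fin g) ℂ) (v z : Fin g → ℂ) : ℂ :=
  Complex.exp (Real.pi * Complex.I * (v ⬝ᵥ τ *ᵥ v + 2 * (v ⬝ᵥ z)))

/-- The theta series with real characteristic `a` and complex argument `z`. -/
def thetaSeries {g : ℕ} (τ : Matrix (Fin g) (Fin g) ℂ) (a : Fin g → ℝ) (z : Fin g → ℂ) : ℂ :=
  ∑' l : Fin g → ℤ, expTerm τ (cv (iv l + a)) z

theorem theta_eq_thetaSeries {g : ℕ} (ε ε' : Fin g → ℝ) (z : Fin g → ℂ)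
    (τ : SiegelUpperHalfSpace g) :
    theta ε ε' z τ = thetaSeries τ.1 ((2⁻¹ : ℝ) • ε) (z + cv ((2⁻¹ : ℝ) • ε')) := by
  unfold theta thetaSeries
  refine tsum_congr fun l => ?_
  have h1 : (fun i => (l i : ℂ) + (ε i : ℂ) / 2) = cv (iv l + (2⁻¹ : ℝ) • ε) := by
    ext i; simp [cv, iv]; ring
  have h2 : (fun i => z i + (ε' i : ℂ) / 2) = z + cv ((2⁻¹ : ℝ) • ε') := by
    ext i; simp [cv]; ring
  simp only [h1, h2, expTerm]
  congr 1
  ring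

theorem norm_expTerm {g : ℕ} (τ : Matrix (Fin g) (Fin g) ℂ) (x : Fin g → ℝ) (z : Fin g → ℂ) :
    ‖expTerm τ (cv x) z‖ =
      Real.exp (-Real.pi * (x ⬝ᵥ τ.map Complex.im *ᵥ x + 2 * (x ⬝ᵥ fun i => (z i).im))) := by
  rw [expTerm, Complex.norm_exp]
  congr 1
  rw [← im_quadratic, ← im_cv_dotProduct]
  simp [Complex.mul_re, Complex.mul_im, Complex.add_im]

/-- A summable majorant of the theta series, uniform in the data. -/
def majorant {g : ℕ} (δ A B : ℝ) (l : Fin g → ℤ) : ℝ :=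
  ∏ i, (Real.exp (Real.pi * (δ * A ^ 2 + 2 * B * A)) *
    Real.exp (-Real.pi * (δ / 2 * (l i : ℝ) ^ 2 - 2 * B * |(l i : ℝ)|)))

/-- Any finite set of lattice points lies in a product of finite sets, over which the sum factors
into one-variable sums. -/
theorem summable_pi_prod {g : ℕ} {u : ℤ → ℝ} (h0 : ∀ k, 0 ≤ u k) (hu : Summable u) :
    Summable fun l : Fin g → ℤ => ∏ i, u (l i) := by
  classical
  refine summable_of_sum_le (c := (∑' k, u k) ^ g) (fun l => Finset.prod_nonneg fun i _ => h0 _) ?_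
  intro s
  calc ∑ l ∈ s, ∏ i, u (l i)
      ≤ ∑ l ∈ Fintype.piFinset fun i => s.image fun l => l i, ∏ i, u (l i) := by
        refine Finset.sum_le_sum_of_subset_of_nonneg ?_ fun l _ _ =>
          Finset.prod_nonneg fun i _ => h0 _
        intro l hl
        rw [Fintype.mem_piFinset]
        exact fun i => Finset.mem_image_of_mem _ hl
    _ = ∏ i : Fin g, ∑ k ∈ s.image fun l => l i, u k := by
        rw [Finset.prod_univ_sum]
    _ ≤ ∏ _i : Fin g, ∑' k, u k := by
        refine Finset.prod_le_prod (fun i _ => Finset.sum_nonneg fun k _ => h0 k) fun i _ => ?_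
        exact hu.sum_le_tsum _ fun k _ => h0 k
    _ = (∑' k, u k) ^ g := by simp

theorem summable_majorant {g : ℕ} {δ : ℝ} (hδ : 0 < δ) (A B : ℝ) :
    Summable (majorant (g := g) δ A B) := by
  have h := (summable_pow_mul_jacobiTheta₂_term_bound B (half_pos hδ) 0).mul_left
    (Real.exp (Real.pi * (δ * A ^ 2 + 2 * B * A)))
  simp only [pow_zero, one_mul] at h
  exact summable_pi_prod (u := fun k : ℤ => Real.exp (Real.pi * (δ * A ^ 2 + 2 * B * A)) *
    Real.exp (-Real.pi * (δ / 2 * (k : ℝ) ^ 2 - 2 * B * |(k : ℝ)|))) (fun k => by positivity)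
    (by simpa only [Int.cast_abs] using h)

theorem norm_expTerm_le_majorant {g : ℕ} {δ A B : ℝ} (hδ : 0 < δ)
    {τ : Matrix (Fin g) (Fin g) ℂ} (hτ : ∀ x : Fin g → ℝ, δ * (x ⬝ᵥ x) ≤ x ⬝ᵥ τ.map Complex.im *ᵥ x)
    {a : Fin g → ℝ} (ha : ∀ i, |a i| ≤ A) {z : Fin g → ℂ} (hz : ∀ i, |(z i).im| ≤ B)
    (l : Fin g → ℤ) : ‖expTerm τ (cv (iv l + a)) z‖ ≤ majorant δ A B l := by
  rw [norm_expTerm, majorant]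
  simp only [← Real.exp_add]
  rw [← Real.exp_sum, Real.exp_le_exp]
  have hx := hτ (iv l + a)
  have key : ∀ i, δ / 2 * (l i : ℝ) ^ 2 - 2 * B * |(l i : ℝ)| - (δ * A ^ 2 + 2 * B * A) ≤
      δ * ((iv l + a) i * (iv l + a) i) + 2 * ((iv l + a) i * (z i).im) := by
    intro i
    have h1 := ha i
    have h2 := hz i
    have hB : 0 ≤ B := (abs_nonneg _).trans h2
    have hA : a i ^ 2 ≤ A ^ 2 := by
      rw [← sq_abs]; gcongr
    have h3 : |(iv l + a) i * (z i).im| ≤ (|(l i : ℝ)| + A) * B := by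
      rw [abs_mul]
      have : |(iv l + a) i| ≤ |(l i : ℝ)| + A := (abs_add_le _ _).trans (by simpa [iv] using h1)
      exact mul_le_mul this h2 (abs_nonneg _) ((abs_nonneg _).trans this)
    have h4 := (abs_le.1 h3).1
    have h5 : (iv l + a) i = l i + a i := rfl
    rw [h5] at h4 ⊢
    -- The quadratic part uses δ(l+a)² + δa² − (δ/2)l² = (δ/2)(l+2a)² ≥ 0.
    nlinarith [mul_nonneg hδ.le (sq_nonneg ((l i : ℝ) + 2 * a i))]
  have hsum := Finset.sum_le_sum fun i (_ : i ∈ Finset.univ) => key i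
  rw [Finset.sum_add_distrib, ← Finset.mul_sum, ← Finset.mul_sum] at hsum
  have hsum' : ∑ i, (δ / 2 * (l i : ℝ) ^ 2 - 2 * B * |(l i : ℝ)| - (δ * A ^ 2 + 2 * B * A)) ≤
      (iv l + a) ⬝ᵥ τ.map Complex.im *ᵥ (iv l + a) + 2 * ((iv l + a) ⬝ᵥ fun i => (z i).im) :=
    hsum.trans (by simpa [dotProduct] using hx)
  calc _ ≤ -Real.pi * ∑ i, (δ / 2 * (l i : ℝ) ^ 2 - 2 * B * |(l i : ℝ)| -
        (δ * A ^ 2 + 2 * B * A)) := by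
        have := Real.pi_pos
        nlinarith
    _ = _ := by
        rw [Finset.mul_sum]
        exact Finset.sum_congr rfl fun i _ => by ring

theorem dotProduct_self_pos {g : ℕ} {x : Fin g → ℝ} (hx : x ≠ 0) : 0 < x ⬝ᵥ x := by
  obtain ⟨i, hi⟩ := Function.ne_iff.1 hx
  exact Finset.sum_pos' (fun j _ => mul_self_nonneg _) ⟨i, Finset.mem_univ _, by
    simpa using mul_self_pos.2 hi⟩

/-- The quotient of the two quadratic forms is homogeneous of degree 0 and attains a positive
minimum on the compact unit sphere of the sup norm. -/
theorem exists_posDef_lower_bound {g : ℕ} {Y : Matrix (Fin g) (Fin g) ℝ} (hY : Y.PosDef) :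
    ∃ δ > 0, ∀ x : Fin g → ℝ, δ * (x ⬝ᵥ x) ≤ x ⬝ᵥ Y *ᵥ x := by
  rcases isEmpty_or_nonempty (Fin g) with h | h
  · exact ⟨1, one_pos, fun x => by simp [dotProduct]⟩
  have hn : (Metric.sphere (0 : Fin g → ℝ) 1).Nonempty := NormedSpace.sphere_nonempty.2 zero_le_one
  have hne : ∀ x ∈ Metric.sphere (0 : Fin g → ℝ) 1, x ≠ 0 := by
    rintro x hx rfl
    simp at hx
  have hc : IsCompact (Metric.sphere (0 : Fin g → ℝ) 1) := isCompact_sphere _ _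
  have hpos : ∀ x : Fin g → ℝ, x ≠ 0 → 0 < x ⬝ᵥ x := fun x hx => dotProduct_self_pos hx
  have hcont : ContinuousOn (fun x : Fin g → ℝ => (x ⬝ᵥ Y *ᵥ x) / (x ⬝ᵥ x))
      (Metric.sphere 0 1) := by
    refine ContinuousOn.div ?_ ?_ fun x hx => (hpos x (hne x hx)).ne'
    · simp only [dotProduct, Matrix.mulVec]; fun_prop
    · simp only [dotProduct]; fun_prop
  obtain ⟨x₀, hx₀, hmin⟩ := hc.exists_isMinOn hn hcont
  refine ⟨(x₀ ⬝ᵥ Y *ᵥ x₀) / (x₀ ⬝ᵥ x₀), div_pos ?_ (hpos _ (hne _ hx₀)), fun x => ?_⟩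
  · simpa using hY.dotProduct_mulVec_pos (hne _ hx₀)
  · rcases eq_or_ne x 0 with rfl | hx
    · simp
    have hnx : ‖x‖ ≠ 0 := norm_ne_zero_iff.2 hx
    have h1 : ‖x‖⁻¹ • x ∈ Metric.sphere (0 : Fin g → ℝ) 1 := by
      simp [norm_smul, hnx]
    have h2 := hmin h1
    simp only [Set.mem_ofPred_eq, Matrix.mulVec_smul, smul_dotProduct, dotProduct_smul,
      smul_eq_mul] at h2
    rw [mul_div_mul_left _ _ (inv_ne_zero hnx), mul_div_mul_left _ _ (inv_ne_zero hnx)] at h2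
    rwa [← le_div_iff₀ (hpos x hx)]

namespace SiegelUpperHalfSpace

variable {g : ℕ} (τ : SiegelUpperHalfSpace g)

theorem exists_lower_bound : ∃ δ > 0, ∀ x : Fin g → ℝ,
    δ * (x ⬝ᵥ x) ≤ x ⬝ᵥ τ.1.map Complex.im *ᵥ x :=
  exists_posDef_lower_bound τ.2.2

end SiegelUpperHalfSpace

theorem exists_abs_bound {g : ℕ} (x : Fin g → ℝ) : ∃ A, ∀ i, |x i| ≤ A :=
  ⟨‖x‖, fun i => norm_le_pi_norm x i⟩

theorem summable_norm_expTerm {g : ℕ} (τ : SiegelUpperHalfSpace g) (a : Fin g → ℝ)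
    (z : Fin g → ℂ) : Summable fun l : Fin g → ℤ => ‖expTerm τ.1 (cv (iv l + a)) z‖ := by
  obtain ⟨δ, hδ, h⟩ := τ.exists_lower_bound
  obtain ⟨A, hA⟩ := exists_abs_bound a
  obtain ⟨B, hB⟩ := exists_abs_bound fun i => (z i).im
  exact Summable.of_nonneg_of_le (fun _ => norm_nonneg _)
    (fun l => norm_expTerm_le_majorant hδ h hA hB l) (summable_majorant hδ A B)

theorem summable_expTerm {g : ℕ} (τ : SiegelUpperHalfSpace g) (a : Fin g → ℝ)
    (z : Fin g → ℂ) : Summable fun l : Fin g → ℤ => expTerm τ.1 (cv (iv l + a)) z :=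
  (summable_norm_expTerm τ a z).of_norm

/-- The theta series is entire along every complex line. -/
theorem differentiable_thetaSeries_line {g : ℕ} (τ : SiegelUpperHalfSpace g) (a : Fin g → ℝ)
    (z w : Fin g → ℂ) : Differentiable ℂ fun ζ : ℂ => thetaSeries τ.1 a (z + ζ • w) := by
  obtain ⟨δ, hδ, h⟩ := τ.exists_lower_bound
  obtain ⟨A, hA⟩ := exists_abs_bound a
  intro ζ₀
  have hd : DifferentiableOn ℂ (fun ζ : ℂ => thetaSeries τ.1 a (z + ζ • w))
      (Metric.ball 0 (‖ζ₀‖ + 1)) := by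
    refine Complex.differentiableOn_tsum_of_summable_norm
      (summable_majorant (g := g) hδ A (‖z‖ + (‖ζ₀‖ + 1) * ‖w‖)) ?_ Metric.isOpen_ball ?_
    · intro l
      simp only [expTerm, dotProduct]
      fun_prop
    · intro l ζ hζ
      refine norm_expTerm_le_majorant hδ h hA (fun i => ?_) l
      refine (Complex.abs_im_le_norm _).trans ((norm_le_pi_norm (z + ζ • w) i).trans ?_)
      refine (norm_add_le _ _).trans ?_
      rw [norm_smul]
      have : ‖ζ‖ ≤ ‖ζ₀‖ + 1 := by simpa using (Metric.mem_ball.1 hζ).le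
      gcongr
  exact (hd ζ₀ (by simp)).differentiableAt (Metric.isOpen_ball.mem_nhds (by simp))

theorem continuous_thetaSeries {g : ℕ} (τ : SiegelUpperHalfSpace g) (a : Fin g → ℝ) :
    Continuous fun z : Fin g → ℂ => thetaSeries τ.1 a z := by
  obtain ⟨δ, hδ, h⟩ := τ.exists_lower_bound
  obtain ⟨A, hA⟩ := exists_abs_bound a
  rw [continuous_iff_continuousAt]
  intro z₀
  have hc : ContinuousOn (fun z : Fin g → ℂ => thetaSeries τ.1 a z) (Metric.ball z₀ 1) := by
    refine continuousOn_tsum (u := majorant δ A (‖z₀‖ + 1))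
      (f := fun l z => expTerm τ.1 (cv (iv l + a)) z) (fun l => ?_)
      (summable_majorant hδ A _) ?_
    · simp only [expTerm, dotProduct]
      fun_prop
    · intro l z hz
      refine norm_expTerm_le_majorant hδ h hA (fun i => ?_) l
      refine (Complex.abs_im_le_norm _).trans ((norm_le_pi_norm z i).trans ?_)
      have h1 : ‖z - z₀‖ ≤ 1 := by simpa [dist_eq_norm] using (Metric.mem_ball.1 hz).le
      calc ‖z‖ = ‖z₀ + (z - z₀)‖ := by simp
        _ ≤ _ := (norm_add_le _ _).trans (by gcongr)
  exact hc.continuousAt (Metric.isOpen_ball.mem_nhds (by simp))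

/-- Matrices in the Siegel space with imaginary part bounded below by `δ`. -/
theorem continuousOn_thetaSeries_matrix {g : ℕ} {δ : ℝ} (hδ : 0 < δ) (a : Fin g → ℝ)
    (z : Fin g → ℂ) :
    ContinuousOn (fun τ : Matrix (Fin g) (Fin g) ℂ => thetaSeries τ a z)
      {τ | ∀ x : Fin g → ℝ, δ * (x ⬝ᵥ x) ≤ x ⬝ᵥ τ.map Complex.im *ᵥ x} := by
  obtain ⟨A, hA⟩ := exists_abs_bound a
  obtain ⟨B, hB⟩ := exists_abs_bound fun i => (z i).im
  refine continuousOn_tsum (u := majorant δ A B) (fun l => ?_) (summable_majorant hδ A B)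
    fun l τ hτ => norm_expTerm_le_majorant hδ hτ hA hB l
  simp only [expTerm, dotProduct, Matrix.mulVec]
  fun_prop

/-! ### Quasi-periodicity -/

theorem thetaSeries_add_left {g : ℕ} (τ : Matrix (Fin g) (Fin g) ℂ) (a : Fin g → ℝ)
    (m : Fin g → ℤ) (z : Fin g → ℂ) : thetaSeries τ (a + iv m) z = thetaSeries τ a z := by
  unfold thetaSeries
  rw [← (Equiv.addRight m).tsum_eq fun l : Fin g → ℤ => expTerm τ (cv (iv l + a)) z]
  refine tsum_congr fun l => ?_
  rw [Equiv.coe_addRight, iv_add, add_right_comm, add_assoc]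

theorem exp_int_mul_two_pi (k : ℤ) : Complex.exp (2 * Real.pi * Complex.I * k) = 1 :=
  Complex.exp_eq_one_iff.2 ⟨k, by ring⟩

theorem thetaSeries_add_right {g : ℕ} (τ : Matrix (Fin g) (Fin g) ℂ) (a : Fin g → ℝ)
    (z : Fin g → ℂ) (m : Fin g → ℤ) : thetaSeries τ a (z + cv (iv m)) =
      Complex.exp (2 * Real.pi * Complex.I * (a ⬝ᵥ iv m : ℝ)) * thetaSeries τ a z := by
  unfold thetaSeries
  rw [← tsum_mul_left]
  refine tsum_congr fun l => ?_
  rw [expTerm, expTerm, ← Complex.exp_add]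
  rw [← mul_one (Complex.exp (_ + _)), ← exp_int_mul_two_pi (l ⬝ᵥ m), ← Complex.exp_add]
  congr 1
  have : cv (iv l + a) ⬝ᵥ cv (iv m) = ((l ⬝ᵥ m : ℤ) : ℂ) + ((a ⬝ᵥ iv m : ℝ) : ℂ) := by
    rw [cv_dotProduct_cv, add_dotProduct, iv_dotProduct_iv]
    push_cast
    ring
  rw [dotProduct_add, this]
  ring

/-- Expanding the square (v + p)ᵗτ(v + p) turns a real shift of the characteristic into a
translation of the argument by τp. Both the quasi-periods and the growth estimate come from this. -/
theorem thetaSeries_shift {g : ℕ} {τ : Matrix (Fin g) (Fin g) ℂ} (hτ : τ.IsSymm)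
    (a p : Fin g → ℝ) (z : Fin g → ℂ) :
    thetaSeries τ (a + p) z =
      Complex.exp (Real.pi * Complex.I * (cv p ⬝ᵥ τ *ᵥ cv p + 2 * (cv p ⬝ᵥ z))) *
        thetaSeries τ a (z + τ *ᵥ cv p) := by
  unfold thetaSeries
  rw [← tsum_mul_left]
  refine tsum_congr fun l => ?_
  rw [expTerm, expTerm, ← Complex.exp_add, ← add_assoc, cv_add _ p]
  congr 1
  simp only [Matrix.mulVec_add, dotProduct_add, add_dotProduct]
  rw [dotProduct_mulVec_symm hτ (cv p) (cv (iv l + a))]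
  ring

theorem thetaSeries_zero_add_int {g : ℕ} (τ : Matrix (Fin g) (Fin g) ℂ)
    (z : Fin g → ℂ) (m : Fin g → ℤ) :
    thetaSeries τ 0 (z + cv (iv m)) = thetaSeries τ 0 z := by
  rw [thetaSeries_add_right]; simp

theorem thetaSeries_zero_add_period {g : ℕ} {τ : Matrix (Fin g) (Fin g) ℂ} (hτ : τ.IsSymm)
    (z : Fin g → ℂ) (p : Fin g → ℤ) :
    thetaSeries τ 0 (z + τ *ᵥ cv (iv p)) =
      Complex.exp (-(Real.pi * Complex.I *
        (cv (iv p) ⬝ᵥ τ *ᵥ cv (iv p) + 2 * (cv (iv p) ⬝ᵥ z)))) * thetaSeries τ 0 z := by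
  have h := thetaSeries_shift hτ 0 (iv p) z
  rw [thetaSeries_add_left] at h
  rw [h, ← mul_assoc, ← Complex.exp_add]
  simp

theorem thetaSeries_eq_zero_char {g : ℕ} {τ : Matrix (Fin g) (Fin g) ℂ} (hτ : τ.IsSymm)
    (a : Fin g → ℝ) (z : Fin g → ℂ) :
    thetaSeries τ a z =
      Complex.exp (Real.pi * Complex.I * (cv a ⬝ᵥ τ *ᵥ cv a + 2 * (cv a ⬝ᵥ z))) *
        thetaSeries τ 0 (z + τ *ᵥ cv a) := by
  simpa using thetaSeries_shift hτ 0 a z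

/-! ### Riemann's quartic relation -/

/-- A binary vector as an integral vector. -/
def bit {g : ℕ} (s : Fin g → Fin 2) : Fin g → ℤ := fun i => ((s i : ℕ) : ℤ)

/-- The half-integral vector attached to a binary vector. -/
def hv {g : ℕ} (s : Fin g → Fin 2) : Fin g → ℝ := (2⁻¹ : ℝ) • iv (bit s)

/-- Orthogonality of the characters of (ℤ/2)^g; it detects even vectors in the quartic relation. -/
theorem sum_exp_pi_bit {g : ℕ} (κ : Fin g → ℤ) :
    ∑ t : Fin g → Fin 2, Complex.exp (Real.pi * Complex.I * ((bit t ⬝ᵥ κ : ℤ) : ℂ)) =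
      if ∀ i, Even (κ i) then (2 : ℂ) ^ g else 0 := by
  have h1 : ∀ t : Fin g → Fin 2, Complex.exp (Real.pi * Complex.I * ((bit t ⬝ᵥ κ : ℤ) : ℂ)) =
      ∏ i, Complex.exp (Real.pi * Complex.I * (((t i : ℕ) : ℂ) * (κ i : ℂ))) := by
    intro t
    rw [← Complex.exp_sum]
    simp only [dotProduct, bit, Int.cast_sum, Finset.mul_sum]
    push_cast
    rfl
  simp_rw [h1]
  have h2 := Finset.prod_univ_sum (fun _ : Fin g => (Finset.univ : Finset (Fin 2)))
    (fun i j => Complex.exp (Real.pi * Complex.I * (((j : ℕ) : ℂ) * (κ i : ℂ))))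
  rw [Fintype.piFinset_univ] at h2
  rw [← h2]
  have h3 : ∀ i, ∑ j : Fin 2, Complex.exp (Real.pi * Complex.I * (((j : ℕ) : ℂ) * (κ i : ℂ))) =
      if Even (κ i) then 2 else 0 := by
    intro i
    have h4 : Complex.exp (Real.pi * Complex.I * (κ i : ℂ)) = (-1) ^ κ i := by
      rw [mul_comm, Complex.exp_int_mul, Complex.exp_pi_mul_I]
    rw [Fin.sum_univ_two]
    simp only [Fin.val_zero, Fin.val_one, Nat.cast_zero, Nat.cast_one, zero_mul, mul_zero,
      Complex.exp_zero, one_mul]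
    rw [h4]
    split_ifs with h
    · rw [h.neg_one_zpow]; norm_num
    · rw [(Int.not_even_iff_odd.1 h).neg_one_zpow]; norm_num
  simp_rw [h3]
  split_ifs with h
  · simp [h]
  · push Not at h
    obtain ⟨i, hi⟩ := h
    exact Finset.prod_eq_zero (Finset.mem_univ i) (by simp [hi])

/-- Four integral vectors. -/
abbrev Quad (g : ℕ) := ((Fin g → ℤ) × (Fin g → ℤ)) × ((Fin g → ℤ) × (Fin g → ℤ))

/-- The 4 × 4 matrix with entries ±1/2 relating the lᵢ to the nᵢ is orthogonal, so it preserves sums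
of four values of a quadratic form. It sends (2a, 0, 0, 0) to (a, a, a, a), and likewise for b; this
is why only the first factor on the right keeps a and b. -/
theorem quartic_exponent {g : ℕ} (τ : Matrix (Fin g) (Fin g) ℂ)
    {l₁ l₂ l₃ l₄ n₁ n₂ n₃ n₄ : Fin g → ℂ} (a b : Fin g → ℂ)
    (h₁ : l₁ = (2⁻¹ : ℂ) • (n₁ + n₂ + n₃ + n₄)) (h₂ : l₂ = (2⁻¹ : ℂ) • (n₁ + n₂ - n₃ - n₄))
    (h₃ : l₃ = (2⁻¹ : ℂ) • (n₁ - n₂ + n₃ - n₄)) (h₄ : l₄ = (2⁻¹ : ℂ) • (n₁ - n₂ - n₃ + n₄)) :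
    (expTerm τ (l₁ + a) b * expTerm τ (l₂ + a) b) * (expTerm τ (l₃ + a) b * expTerm τ (l₄ + a) b) =
    (expTerm τ (n₁ + (2 : ℂ) • a) ((2 : ℂ) • b) * expTerm τ n₂ 0) *
      (expTerm τ n₃ 0 * expTerm τ n₄ 0) := by
  subst h₁ h₂ h₃ h₄
  simp only [expTerm, ← Complex.exp_add]
  congr 1
  simp only [Matrix.mulVec_add, Matrix.mulVec_sub, Matrix.mulVec_smul, dotProduct_add,
    add_dotProduct, sub_dotProduct, dotProduct_sub, smul_dotProduct, dotProduct_smul, smul_eq_mul,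
    dotProduct_zero]
  ring

theorem tsum_pow_four {ι : Type*} {f f' : ι → ℂ} (hf : Summable fun i => ‖f i‖)
    (hf' : Summable fun i => ‖f' i‖) :
    (∑' i, f i) * (∑' i, f' i) ^ 3 =
      ∑' k : (ι × ι) × (ι × ι), (f k.1.1 * f' k.1.2) * (f' k.2.1 * f' k.2.2) ∧
    Summable fun k : (ι × ι) × (ι × ι) => (f k.1.1 * f' k.1.2) * (f' k.2.1 * f' k.2.2) := by
  have h1 := hf.mul_norm hf'
  have h2 := hf'.mul_norm hf'
  refine ⟨?_, (h1.mul_norm h2).of_norm⟩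
  rw [← tsum_mul_tsum_of_summable_norm h1 h2, ← tsum_mul_tsum_of_summable_norm hf hf',
    ← tsum_mul_tsum_of_summable_norm hf' hf']
  ring

theorem expTerm_add_hv {g : ℕ} (τ : Matrix (Fin g) (Fin g) ℂ) (v : Fin g → ℝ) (z : Fin g → ℂ)
    (t : Fin g → Fin 2) : expTerm τ (cv v) (z + cv (hv t)) =
      expTerm τ (cv v) z * Complex.exp (Real.pi * Complex.I * ((v ⬝ᵥ iv (bit t) : ℝ) : ℂ)) := by
  rw [expTerm, expTerm, ← Complex.exp_add]
  congr 1
  rw [dotProduct_add, hv, cv_smul, dotProduct_smul, cv_dotProduct_cv, smul_eq_mul]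
  push_cast
  ring

/-- The sum `k₁ + k₂ + k₃ + k₄`. -/
def Quad.total {g : ℕ} (k : Quad g) : Fin g → ℤ := k.1.1 + k.1.2 + k.2.1 + k.2.2

/-- The general term of a product of four theta series. -/
def quarticTerm {g : ℕ} (τ : Matrix (Fin g) (Fin g) ℂ) (a : Fin g → ℝ) (b : Fin g → ℂ)
    (k : Quad g) : ℂ :=
  (expTerm τ (cv (iv k.1.1 + a)) b * expTerm τ (cv (iv k.1.2 + a)) b) *
    (expTerm τ (cv (iv k.2.1 + a)) b * expTerm τ (cv (iv k.2.2 + a)) b)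

/-- The general term of the product on the other side of the quartic relation, without the
contribution of the second half characteristic. -/
def quarticDualTerm {g : ℕ} (τ : Matrix (Fin g) (Fin g) ℂ) (a : Fin g → ℝ) (b : Fin g → ℂ)
    (s : Fin g → Fin 2) (k : Quad g) : ℂ :=
  (expTerm τ (cv (iv k.1.1 + ((2 : ℝ) • a + hv s))) ((2 : ℂ) • b) *
    expTerm τ (cv (iv k.1.2 + hv s)) 0) *
    (expTerm τ (cv (iv k.2.1 + hv s)) 0 * expTerm τ (cv (iv k.2.2 + hv s)) 0)

/-- The orthogonal substitution of `quartic_exponent`, applied to k + s/2 in each slot, is a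
bijection from integral quadruples with even total to those whose total is congruent to s modulo 2.
-/
theorem tsum_quarticTerm_parity {g : ℕ} (τ : Matrix (Fin g) (Fin g) ℂ) (a : Fin g → ℝ)
    (b : Fin g → ℂ) (s : Fin g → Fin 2) :
    ∑' l : Quad g, (if ∀ i, Even (l.total i - bit s i) then quarticTerm τ a b l else 0) =
      ∑' k : Quad g, (if ∀ i, Even (k.total i) then quarticDualTerm τ a b s k else 0) := by
  set F : Quad g → ℂ := fun l =>
    if ∀ i, Even (l.total i - bit s i) then quarticTerm τ a b l else 0 with hF
  set G : Quad g → ℂ := fun k =>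
    if ∀ i, Even (k.total i) then quarticDualTerm τ a b s k else 0 with hG
  have hsupp : ∀ k : Function.support G, ∀ i, Even (k.1.total i) := by
    intro k
    by_contra h
    exact k.2 (if_neg h)
  let e : Function.support G → Quad g := fun k =>
    ((fun i => k.1.total i / 2 + bit s i,
      fun i => (k.1.1.1 i + k.1.1.2 i - k.1.2.1 i - k.1.2.2 i) / 2),
     (fun i => (k.1.1.1 i - k.1.1.2 i + k.1.2.1 i - k.1.2.2 i) / 2,
      fun i => (k.1.1.1 i - k.1.1.2 i - k.1.2.1 i + k.1.2.2 i) / 2))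
  have hGF : ∀ k : Function.support G, F (e k) = G k := by
    intro k
    have hk := hsupp k
    have hev : ∀ i, Even ((e k).total i - bit s i) := by
      intro i
      have := hk i
      simp only [e, Quad.total, Pi.add_apply] at this ⊢
      rw [Int.even_iff] at this ⊢
      omega
    have hFe : F (e k) = quarticTerm τ a b (e k) := if_pos hev
    have hGe : G k = quarticDualTerm τ a b s k := if_pos hk
    rw [hFe, hGe]
    rw [quarticTerm, quarticDualTerm]
    simp only [cv_add _ a]
    rw [quartic_exponent τ (cv a) b (n₁ := cv (iv k.1.1.1 + hv s)) (n₂ := cv (iv k.1.1.2 + hv s))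
      (n₃ := cv (iv k.1.2.1 + hv s)) (n₄ := cv (iv k.1.2.2 + hv s))]
    · congr 3
      rw [← add_assoc, add_right_comm, cv_add _ ((2 : ℝ) • a), cv_smul]
      norm_num
    all_goals
      ext i
      obtain ⟨c, hc⟩ := hk i
      simp only [Quad.total, Pi.add_apply] at hc
      have hc' : (k.1.1.1 i : ℂ) + k.1.1.2 i + k.1.2.1 i + k.1.2.2 i = c + c := by
        exact_mod_cast congrArg (Int.cast : ℤ → ℂ) hc
      simp only [e, cv, iv, hv, Quad.total, Pi.add_apply, Pi.smul_apply, Pi.sub_apply, smul_eq_mul]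
      push_cast
    · rw [show (k.1.1.1 i + k.1.1.2 i + k.1.2.1 i + k.1.2.2 i) / 2 = c by omega]
      linear_combination (-1 / 2 : ℂ) * hc'
    · rw [show (k.1.1.1 i + k.1.1.2 i - k.1.2.1 i - k.1.2.2 i) / 2 =
        c - k.1.2.1 i - k.1.2.2 i by omega]
      push_cast
      linear_combination (-1 / 2 : ℂ) * hc'
    · rw [show (k.1.1.1 i - k.1.1.2 i + k.1.2.1 i - k.1.2.2 i) / 2 =
        c - k.1.1.2 i - k.1.2.2 i by omega]
      push_cast
      linear_combination (-1 / 2 : ℂ) * hc'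
    · rw [show (k.1.1.1 i - k.1.1.2 i - k.1.2.1 i + k.1.2.2 i) / 2 =
        c - k.1.1.2 i - k.1.2.1 i by omega]
      push_cast
      linear_combination (-1 / 2 : ℂ) * hc'
  refine tsum_eq_tsum_of_ne_zero_bij e ?_ ?_ hGF
  · intro k k' h
    have hk := hsupp k
    have hk' := hsupp k'
    simp only [e, Prod.mk.injEq, funext_iff] at h
    obtain ⟨⟨h1, h2⟩, h3, h4⟩ := h
    have key : ∀ i, k.1.1.1 i = k'.1.1.1 i ∧ k.1.1.2 i = k'.1.1.2 i ∧
        k.1.2.1 i = k'.1.2.1 i ∧ k.1.2.2 i = k'.1.2.2 i := by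
      intro i
      have a0 := hk i
      have a0' := hk' i
      have a1 := h1 i
      have a2 := h2 i
      have a3 := h3 i
      have a4 := h4 i
      simp only [Quad.total, Pi.add_apply, Int.even_iff] at a0 a0' a1
      omega
    refine Subtype.ext (Prod.ext (Prod.ext ?_ ?_) (Prod.ext ?_ ?_)) <;> funext i
    exacts [(key i).1, (key i).2.1, (key i).2.2.1, (key i).2.2.2]
  · intro l hl
    have hl' : ∀ i, Even (l.total i - bit s i) := by
      by_contra h
      exact hl (if_neg h)
    -- The substitution is an involution: apply it to l and subtract s/2 in each slot.
    let k : Quad g :=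
      ((fun i => (l.total i - bit s i) / 2,
        fun i => (l.1.1 i + l.1.2 i - l.2.1 i - l.2.2 i - bit s i) / 2),
       (fun i => (l.1.1 i - l.1.2 i + l.2.1 i - l.2.2 i - bit s i) / 2,
        fun i => (l.1.1 i - l.1.2 i - l.2.1 i + l.2.2 i - bit s i) / 2))
    have hke : ∀ i, Even (k.total i) := by
      intro i
      have := hl' i
      simp only [k, Quad.total, Pi.add_apply] at this ⊢
      rw [Int.even_iff] at this ⊢
      omega
    have hk : k ∈ Function.support G := by
      simp only [Function.mem_support, hG, if_pos hke]
      simp [quarticDualTerm, expTerm]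
    refine ⟨⟨k, hk⟩, ?_⟩
    refine Prod.ext (Prod.ext ?_ ?_) (Prod.ext ?_ ?_) <;> funext i <;>
    · have := hl' i
      simp only [e, k, Quad.total, Pi.add_apply, Int.even_iff] at this ⊢
      omega

/-- Riemann's quartic theta relation. -/
theorem riemann_quartic {g : ℕ} (τ : SiegelUpperHalfSpace g) (a b : Fin g → ℝ) :
    thetaSeries τ.1 a (cv b) ^ 4 = ((2 : ℂ) ^ g)⁻¹ * ∑ s : Fin g → Fin 2, ∑ t : Fin g → Fin 2,
      Complex.exp (-(2 * Real.pi * Complex.I * ((a ⬝ᵥ iv (bit t) : ℝ) : ℂ))) *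
        (thetaSeries τ.1 ((2 : ℝ) • a + hv s) (cv ((2 : ℝ) • b + hv t)) *
          thetaSeries τ.1 (hv s) (cv (hv t)) ^ 3) := by
  have hL := tsum_pow_four (summable_norm_expTerm τ a (cv b)) (summable_norm_expTerm τ a (cv b))
  have hLs : Summable fun k : Quad g => quarticTerm τ.1 a (cv b) k := hL.2
  have hLt : thetaSeries τ.1 a (cv b) ^ 4 = ∑' k : Quad g, quarticTerm τ.1 a (cv b) k := by
    rw [show (4 : ℕ) = 1 + 3 from rfl, pow_add, pow_one]
    exact hL.1
  have hD : ∀ s, Summable fun k : Quad g => quarticDualTerm τ.1 a (cv b) s k := fun s =>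
    (tsum_pow_four (summable_norm_expTerm τ ((2 : ℝ) • a + hv s) ((2 : ℂ) • cv b))
      (summable_norm_expTerm τ (hv s) 0)).2
  -- In the multiplied-out series, t enters only through the sign (−1)^(t · total k).
  have hst : ∀ s t : Fin g → Fin 2,
      Complex.exp (-(2 * Real.pi * Complex.I * ((a ⬝ᵥ iv (bit t) : ℝ) : ℂ))) *
        (thetaSeries τ.1 ((2 : ℝ) • a + hv s) (cv ((2 : ℝ) • b + hv t)) *
          thetaSeries τ.1 (hv s) (cv (hv t)) ^ 3) =
      ∑' k : Quad g, quarticDualTerm τ.1 a (cv b) s k *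
        Complex.exp (Real.pi * Complex.I * ((bit t ⬝ᵥ k.total : ℤ) : ℂ)) := by
    intro s t
    unfold thetaSeries
    rw [(tsum_pow_four (summable_norm_expTerm τ ((2 : ℝ) • a + hv s) (cv ((2 : ℝ) • b + hv t)))
      (summable_norm_expTerm τ (hv s) (cv (hv t)))).1, ← tsum_mul_left]
    refine tsum_congr fun k : Quad g => ?_
    have h0 : cv (hv t) = 0 + cv (hv t) := (zero_add _).symm
    rw [cv_add ((2 : ℝ) • b), cv_smul, expTerm_add_hv, h0, expTerm_add_hv, expTerm_add_hv,
      expTerm_add_hv, quarticDualTerm]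
    simp only [Complex.ofReal_ofNat]
    -- The prefactor cancels the contribution of 2a, and the four copies of s/2 contribute exp(2πi
    -- s·t) = 1.
    have key : Complex.exp (-(2 * Real.pi * Complex.I * ((a ⬝ᵥ iv (bit t) : ℝ) : ℂ))) *
        Complex.exp (Real.pi * Complex.I *
          (((iv k.1.1 + ((2 : ℝ) • a + hv s)) ⬝ᵥ iv (bit t) : ℝ) : ℂ)) *
        Complex.exp (Real.pi * Complex.I * (((iv k.1.2 + hv s) ⬝ᵥ iv (bit t) : ℝ) : ℂ)) *
        Complex.exp (Real.pi * Complex.I * (((iv k.2.1 + hv s) ⬝ᵥ iv (bit t) : ℝ) : ℂ)) *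
        Complex.exp (Real.pi * Complex.I * (((iv k.2.2 + hv s) ⬝ᵥ iv (bit t) : ℝ) : ℂ)) =
        Complex.exp (Real.pi * Complex.I * ((bit t ⬝ᵥ k.total : ℤ) : ℂ)) := by
      rw [← mul_one (Complex.exp (Real.pi * Complex.I * ((bit t ⬝ᵥ k.total : ℤ) : ℂ))),
        ← exp_int_mul_two_pi (bit s ⬝ᵥ bit t)]
      simp only [← Complex.exp_add]
      congr 1
      simp only [add_dotProduct, smul_dotProduct, hv, iv_dotProduct_iv, Quad.total,
        dotProduct_add, smul_eq_mul]
      rw [dotProduct_comm (bit t), dotProduct_comm (bit t), dotProduct_comm (bit t),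
        dotProduct_comm (bit t)]
      push_cast
      ring
    rw [← key]
    ring
  simp_rw [hst]
  have hexp : ∀ s t, Summable fun k : Quad g => quarticDualTerm τ.1 a (cv b) s k *
        Complex.exp (Real.pi * Complex.I * ((bit t ⬝ᵥ k.total : ℤ) : ℂ)) := by
    intro s t
    refine Summable.of_norm_bounded (hD s).norm fun k => ?_
    rw [norm_mul, Complex.norm_exp]
    simp
  -- Summing over t keeps only the quadruples with even total, which the substitution turns into
  -- terms of the left side.
  have hR : ∀ s, ∑ t, ∑' k : Quad g, quarticDualTerm τ.1 a (cv b) s k *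
        Complex.exp (Real.pi * Complex.I * ((bit t ⬝ᵥ k.total : ℤ) : ℂ)) =
      2 ^ g * ∑' l : Quad g,
        (if ∀ i, Even (l.total i - bit s i) then quarticTerm τ.1 a (cv b) l else 0) := by
    intro s
    rw [← Summable.tsum_finsetSum fun t _ => hexp s t, tsum_quarticTerm_parity, ← tsum_mul_left]
    refine tsum_congr fun k => ?_
    rw [← Finset.mul_sum, sum_exp_pi_bit]
    split_ifs <;> ring
  simp_rw [hR]
  rw [← Finset.mul_sum, inv_mul_cancel_left₀ (pow_ne_zero g two_ne_zero), hLt]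
  rw [← Summable.tsum_finsetSum]
  · refine tsum_congr fun l => ?_
    -- Each quadruple belongs to exactly one parity class, so the sum over s recovers every term
    -- once.
    let s₀ : Fin g → Fin 2 := fun i => ⟨(l.total i % 2).toNat, by omega⟩
    have hs₀ : ∀ s : Fin g → Fin 2, (∀ i, Even (l.total i - bit s i)) ↔ s = s₀ := by
      intro s
      rw [funext_iff]
      refine forall_congr' fun i => ?_
      rw [Fin.ext_iff, Int.even_iff]
      simp only [bit, s₀]
      have := (s i).2
      omega
    simp only [hs₀]
    simp
  · intro s _
    refine Summable.of_norm_bounded hLs.norm fun l => ?_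
    split_ifs
    · exact le_rfl
    · simp

/-! ### The supremum of the theta series over real characteristics -/

/-- Integral shifts of a change nothing, so a may be taken in the unit cube; b is real and does not
affect the absolute values of the terms. One majorant with A = 1, B = 0 serves for all
characteristics. -/
theorem bddAbove_norm_thetaSeries {g : ℕ} (τ : SiegelUpperHalfSpace g) :
    BddAbove (Set.range fun u : (Fin g → ℝ) × (Fin g → ℝ) => ‖thetaSeries τ.1 u.1 (cv u.2)‖) := by
  obtain ⟨δ, hδ, h⟩ := τ.exists_lower_bound
  refine ⟨∑' l : Fin g → ℤ, majorant δ 1 0 l, ?_⟩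
  rintro _ ⟨⟨a, b⟩, rfl⟩
  have ha : a = (fun i => Int.fract (a i)) + iv fun i => ⌊a i⌋ := by
    ext i; simp [iv]
  simp only
  rw [ha, thetaSeries_add_left]
  refine tsum_of_norm_bounded (summable_majorant hδ 1 0).hasSum fun l =>
    norm_expTerm_le_majorant hδ h (fun i => ?_) (fun i => ?_) l
  · rw [abs_of_nonneg (Int.fract_nonneg _)]
    exact (Int.fract_lt_one _).le
  · simp [cv]

/-- The supremum of the absolute values of the theta series at real characteristics. -/
def thetaSup {g : ℕ} (τ : SiegelUpperHalfSpace g) : ℝ :=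
  ⨆ u : (Fin g → ℝ) × (Fin g → ℝ), ‖thetaSeries τ.1 u.1 (cv u.2)‖

theorem norm_thetaSeries_le_thetaSup {g : ℕ} (τ : SiegelUpperHalfSpace g) (a b : Fin g → ℝ) :
    ‖thetaSeries τ.1 a (cv b)‖ ≤ thetaSup τ :=
  le_ciSup (bddAbove_norm_thetaSeries τ) (a, b)

/-- The supremum is bounded by the half-integral values, uniformly in `τ`. -/
theorem thetaSup_le {g : ℕ} (τ : SiegelUpperHalfSpace g) {m : ℝ}
    (hm : ∀ s t : Fin g → Fin 2, ‖thetaSeries τ.1 (hv s) (cv (hv t))‖ ≤ m) :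
    thetaSup τ ≤ 2 ^ g * m := by
  set M := thetaSup τ with hM
  have hm0 : 0 ≤ m := (norm_nonneg _).trans (hm 0 0)
  have hM0 : 0 ≤ M := (norm_nonneg _).trans (norm_thetaSeries_le_thetaSup τ 0 0)
  -- The quartic relation has 4^g terms of size at most M m³, with the factor 2^(-g) in front.
  have h1 : ∀ a b, ‖thetaSeries τ.1 a (cv b)‖ ^ 4 ≤ 2 ^ g * M * m ^ 3 := by
    intro a b
    rw [← norm_pow, riemann_quartic, norm_mul, norm_inv, norm_pow, Complex.norm_ofNat,
      inv_mul_le_iff₀ (by positivity)]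
    have h2 : ∀ s t : Fin g → Fin 2,
        ‖Complex.exp (-(2 * Real.pi * Complex.I * ((a ⬝ᵥ iv (bit t) : ℝ) : ℂ))) *
        (thetaSeries τ.1 ((2 : ℝ) • a + hv s) (cv ((2 : ℝ) • b + hv t)) *
          thetaSeries τ.1 (hv s) (cv (hv t)) ^ 3)‖ ≤ M * m ^ 3 := by
      intro s t
      rw [norm_mul, norm_mul, norm_pow, Complex.norm_exp]
      have h3 := norm_thetaSeries_le_thetaSup τ ((2 : ℝ) • a + hv s) ((2 : ℝ) • b + hv t)
      have h4 : (-(2 * Real.pi * Complex.I * ((a ⬝ᵥ iv (bit t) : ℝ) : ℂ))).re = 0 := by simp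
      rw [h4, Real.exp_zero, one_mul]
      gcongr
      exact hm s t
    calc _ ≤ ∑ _s : Fin g → Fin 2, ∑ _t : Fin g → Fin 2, M * m ^ 3 := by
          refine (norm_sum_le _ _).trans (Finset.sum_le_sum fun s _ => ?_)
          exact (norm_sum_le _ _).trans (Finset.sum_le_sum fun t _ => h2 s t)
      _ = 2 ^ g * (2 ^ g * M * m ^ 3) := by
          simp; ring
  set K := 2 ^ g * M * m ^ 3 with hK
  have hK0 : 0 ≤ K := by positivity
  -- The fourth root puts the pointwise bound in the form needed for passing to the supremum.
  have h5 : M ≤ √(√K) := by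
    refine ciSup_le fun u => ?_
    rw [Real.le_sqrt (norm_nonneg _) (Real.sqrt_nonneg _), Real.le_sqrt (sq_nonneg _) hK0, ← pow_mul]
    exact h1 u.1 u.2
  have h6 : M ^ 4 ≤ K := by
    rw [Real.le_sqrt hM0 (Real.sqrt_nonneg _), Real.le_sqrt (sq_nonneg _) hK0, ← pow_mul] at h5
    exact h5
  rcases hM0.eq_or_lt with h0 | h0
  · rw [← h0]; positivity
  have h7 : M ^ 3 ≤ (2 ^ g * m) ^ 3 := by
    have h8 : M ^ 3 ≤ 2 ^ g * m ^ 3 := by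
      refine le_of_mul_le_mul_left ?_ h0
      calc M * M ^ 3 = M ^ 4 := by ring
        _ ≤ K := h6
        _ = M * (2 ^ g * m ^ 3) := by rw [hK]; ring
    refine h8.trans ?_
    rw [mul_pow]
    gcongr
    exact le_self_pow₀ (one_le_pow₀ one_le_two) (by norm_num)
  exact le_of_pow_le_pow_left₀ (by norm_num) (by positivity) h7

/-! ### Fourier series on the unit cube and uniqueness of the theta function -/

/-- The half-open unit cube based at `a`. -/
def cube {g : ℕ} (a : Fin g → ℝ) : Set (Fin g → ℝ) := {x | ∀ i, x i ∈ Set.Ioc (a i) (a i + 1)}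

theorem measurableSet_cube {g : ℕ} (a : Fin g → ℝ) : MeasurableSet (cube a) :=
  MeasurableSet.univ_pi' fun _ => measurableSet_Ioc

theorem cube_subset_Icc {g : ℕ} (a : Fin g → ℝ) : cube a ⊆ Set.Icc a (a + 1) :=
  fun _ hx => ⟨fun i => (hx i).1.le, fun i => (hx i).2⟩

theorem volume_cube {g : ℕ} (a : Fin g → ℝ) : MeasureTheory.volume (cube a) = 1 := by
  have : cube a = Set.univ.pi fun i => Set.Ioc (a i) (a i + 1) := by
    ext x; simp [cube]
  rw [this, Real.volume_pi_Ioc]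
  simp

theorem integrableOn_cube {g : ℕ} {h : (Fin g → ℝ) → ℂ} (hh : Continuous h) (a : Fin g → ℝ) :
    MeasureTheory.IntegrableOn h (cube a) :=
  (hh.continuousOn.integrableOn_compact isCompact_Icc).mono_set (cube_subset_Icc a)

theorem exists_torus_lift {g : ℕ} {h : (Fin g → ℝ) → ℂ} (hc : Continuous h)
    (hp : ∀ x m, h (x + iv m) = h x) :
    ∃ T : C(UnitAddTorus (Fin g), ℂ), ∀ x : Fin g → ℝ, T (fun i => (x i : UnitAddCircle)) = h x := by
  have hq : IsOpenQuotientMap (Pi.map fun (_ : Fin g) (x : ℝ) => (x : UnitAddCircle)) :=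
    IsOpenQuotientMap.piMap fun _ => QuotientAddGroup.isOpenQuotientMap_mk
  let q : C(Fin g → ℝ, UnitAddTorus (Fin g)) :=
    ⟨Pi.map fun (_ : Fin g) (x : ℝ) => (x : UnitAddCircle), hq.continuous⟩
  have hq' : Topology.IsQuotientMap q := hq.isQuotientMap
  have hfac : Function.FactorsThrough (⟨h, hc⟩ : C(Fin g → ℝ, ℂ)) q := by
    intro x y hxy
    have h1 : ∀ i, ∃ m : ℤ, y i = x i + m := by
      intro i
      have h2 : (x i : UnitAddCircle) = (y i : UnitAddCircle) := congrFun hxy i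
      obtain ⟨m, hm⟩ := AddSubgroup.mem_zmultiples_iff.1 (QuotientAddGroup.eq.1 h2)
      refine ⟨m, ?_⟩
      rw [zsmul_one] at hm
      linarith
    choose m hm using h1
    have : y = x + iv m := by ext i; simp [hm, iv]
    simp [this, hp]
  refine ⟨hq'.lift ⟨h, hc⟩ hfac, fun x => ?_⟩
  exact congrArg (fun F : C(Fin g → ℝ, ℂ) => F x) (hq'.lift_comp ⟨h, hc⟩ hfac)

theorem mFourier_coe {g : ℕ} (n : Fin g → ℤ) (x : Fin g → ℝ) :
    UnitAddTorus.mFourier n (fun i => (x i : UnitAddCircle)) =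
      Complex.exp (2 * Real.pi * Complex.I * ((iv n ⬝ᵥ x : ℝ) : ℂ)) := by
  simp only [UnitAddTorus.mFourier, ContinuousMap.coe_mk, fourier_coe_apply, dotProduct, iv]
  rw [← Complex.exp_sum]
  push_cast
  rw [Finset.mul_sum]
  congr 1
  refine Finset.sum_congr rfl fun i _ => ?_
  ring

theorem exp_int_dotProduct_periodic {g : ℕ} (n m : Fin g → ℤ) (x : Fin g → ℝ) :
    Complex.exp (2 * Real.pi * Complex.I * ((iv n ⬝ᵥ (x + iv m) : ℝ) : ℂ)) =
      Complex.exp (2 * Real.pi * Complex.I * ((iv n ⬝ᵥ x : ℝ) : ℂ)) := by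
  rw [dotProduct_add, iv_dotProduct_iv]
  push_cast
  rw [mul_add, Complex.exp_add, exp_int_mul_two_pi, mul_one]

/-- Both integrals compute the zeroth Fourier coefficient of the induced function on the torus. -/
theorem integral_cube_eq {g : ℕ} {h : (Fin g → ℝ) → ℂ} (hc : Continuous h)
    (hp : ∀ x m, h (x + iv m) = h x) (a : Fin g → ℝ) :
    ∫ x in cube a, h x = ∫ x in cube 0, h x := by
  obtain ⟨T, hT⟩ := exists_torus_lift hc hp
  have key : ∀ a, UnitAddTorus.mFourierCoeff T 0 = ∫ x in cube a, h x := by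
    intro a
    rw [UnitAddTorus.mFourierCoeff_eq_integral T 0 a]
    simp only [neg_zero, UnitAddTorus.mFourier_zero, hT]
    simp [cube]
  rw [← key, ← key]

theorem integral_cube_translate {g : ℕ} {h : (Fin g → ℝ) → ℂ} (hc : Continuous h)
    (hp : ∀ x m, h (x + iv m) = h x) (r : Fin g → ℝ) :
    ∫ x in cube 0, h (x + r) = ∫ x in cube 0, h x := by
  rw [← integral_cube_eq hc hp r]
  have h1 := (MeasureTheory.measurePreserving_add_right
    (MeasureTheory.volume : MeasureTheory.Measure (Fin g → ℝ)) r).setIntegral_preimage_emb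
    (measurableEmbedding_addRight r) h (cube r)
  rw [← h1]
  congr 2
  ext x
  simp only [cube, Set.mem_preimage, Set.mem_ofPred_eq, Pi.zero_apply, Pi.add_apply, Set.mem_Ioc]
  refine forall_congr' fun i => ?_
  constructor <;> rintro ⟨h1, h2⟩ <;> constructor <;> linarith

/-- A continuous periodic function with summable Fourier coefficients is the sum of its Fourier
series. -/
theorem eq_tsum_fourier {g : ℕ} {h : (Fin g → ℝ) → ℂ} (hc : Continuous h)
    (hp : ∀ x m, h (x + iv m) = h x) {c : (Fin g → ℤ) → ℂ}
    (hcoef : ∀ n, ∫ x in cube 0,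
      Complex.exp (-(2 * Real.pi * Complex.I * ((iv n ⬝ᵥ x : ℝ) : ℂ))) * h x = c n)
    (hs : Summable c) (x : Fin g → ℝ) :
    h x = ∑' n, c n * Complex.exp (2 * Real.pi * Complex.I * ((iv n ⬝ᵥ x : ℝ) : ℂ)) := by
  obtain ⟨T, hT⟩ := exists_torus_lift hc hp
  have hcT : UnitAddTorus.mFourierCoeff T = c := by
    funext n
    rw [UnitAddTorus.mFourierCoeff_eq_integral T n 0, ← hcoef]
    simp only [hT, mFourier_coe, iv_neg, neg_dotProduct, smul_eq_mul]
    push_cast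
    simp [cube]
  have := UnitAddTorus.hasSum_mFourier_series_apply_of_summable (f := T) (by rwa [hcT])
    (fun i => (x i : UnitAddCircle))
  rw [hT, hcT] at this
  rw [← this.tsum_eq]
  simp only [mFourier_coe, smul_eq_mul]

/-- Differentiation under the integral: k is bounded on a compact neighbourhood, and Cauchy's
estimate on circles of radius 1 turns this into a uniform bound for the ζ-derivative. -/
theorem differentiable_integral_cube {g : ℕ} {k : ℂ → (Fin g → ℝ) → ℂ}
    (hc : Continuous (Function.uncurry k)) (hd : ∀ x, Differentiable ℂ fun ζ => k ζ x) :
    Differentiable ℂ fun ζ => ∫ x in cube 0, k ζ x := by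
  intro ζ₀
  have hK : IsCompact (Metric.closedBall ζ₀ 2 ×ˢ Set.Icc (0 : Fin g → ℝ) (0 + 1)) :=
    (isCompact_closedBall _ _).prod isCompact_Icc
  obtain ⟨C, hC⟩ := hK.exists_bound_of_continuousOn hc.continuousOn
  have hck : ∀ ζ, Continuous (k ζ) := fun ζ =>
    hc.comp (Continuous.prodMk_right ζ)
  have hcs : Continuous (Function.uncurry fun (x : Fin g → ℝ) (ζ : ℂ) => k ζ x) :=
    hc.comp continuous_swap
  have hmeas := measurable_deriv_with_param (𝕜 := ℂ) hcs
  have h := hasDerivAt_integral_of_dominated_loc_of_deriv_le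
    (μ := MeasureTheory.volume.restrict (cube (0 : Fin g → ℝ))) (F := k)
    (F' := fun ζ x => deriv (fun ζ => k ζ x) ζ) (x₀ := ζ₀) (s := Metric.ball ζ₀ 1)
    (bound := fun _ => C / 1) (Metric.ball_mem_nhds _ one_pos)
    (Filter.Eventually.of_forall fun ζ => (hck ζ).aestronglyMeasurable)
    (integrableOn_cube (hck ζ₀) 0)
    (hmeas.comp (measurable_id.prodMk measurable_const)).aestronglyMeasurable ?_ ?_ ?_
  · exact h.2.differentiableAt
  · refine (MeasureTheory.ae_restrict_iff' (measurableSet_cube 0)).2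
      (Filter.Eventually.of_forall fun x hx ζ hζ => ?_)
    refine Complex.norm_deriv_le_of_forall_mem_sphere_norm_le one_pos
      (hd x).diffContOnCl fun w hw => ?_
    refine hC (w, x) ⟨?_, cube_subset_Icc 0 hx⟩
    rw [Metric.mem_closedBall]
    have h1 : dist w ζ = 1 := hw
    have h2 : dist ζ ζ₀ < 1 := hζ
    linarith [dist_triangle w ζ ζ₀]
  · exact MeasureTheory.integrable_const_iff.2 (Or.inr ⟨by simp [volume_cube]⟩)
  · exact Filter.Eventually.of_forall fun x ζ _ => (hd x ζ).hasDerivAt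

/-- If nᵢ ≠ 0, translating the i-th coordinate by 1/(2nᵢ) changes the sign of the integrand but not
the integral. -/
theorem integral_cube_exp {g : ℕ} (n : Fin g → ℤ) :
    ∫ x in cube 0, Complex.exp (2 * Real.pi * Complex.I * ((iv n ⬝ᵥ x : ℝ) : ℂ)) =
      if n = 0 then 1 else 0 := by
  split_ifs with hn
  · subst hn
    simp [MeasureTheory.Measure.real, volume_cube]
  · obtain ⟨i, hi⟩ := Function.ne_iff.1 hn
    have hi' : (n i : ℝ) ≠ 0 := by simpa using hi
    have h := integral_cube_translate
      (h := fun x : Fin g → ℝ => Complex.exp (2 * Real.pi * Complex.I * ((iv n ⬝ᵥ x : ℝ) : ℂ)))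
      (by simp only [dotProduct]; fun_prop) (fun x m => exp_int_dotProduct_periodic n m x)
      (Pi.single i (2 * (n i : ℝ))⁻¹)
    have h2 : ∀ x : Fin g → ℝ, Complex.exp (2 * Real.pi * Complex.I *
        ((iv n ⬝ᵥ (x + Pi.single i (2 * (n i : ℝ))⁻¹) : ℝ) : ℂ)) =
        -Complex.exp (2 * Real.pi * Complex.I * ((iv n ⬝ᵥ x : ℝ) : ℂ)) := by
      intro x
      rw [dotProduct_add, dotProduct_single]
      have : iv n i * (2 * (n i : ℝ))⁻¹ = 2⁻¹ := by
        simp only [iv]; field_simp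
      rw [this]
      push_cast
      rw [mul_add, Complex.exp_add, show 2 * (Real.pi : ℂ) * Complex.I * 2⁻¹ =
        Real.pi * Complex.I by ring, Complex.exp_pi_mul_I]
      ring
    simp only [h2, MeasureTheory.integral_neg] at h
    exact CharZero.neg_eq_self_iff.1 h

theorem thetaSeries_zero_eq {g : ℕ} (τ : Matrix (Fin g) (Fin g) ℂ) (z : Fin g → ℂ) :
    thetaSeries τ 0 z = ∑' n : Fin g → ℤ,
      Complex.exp (Real.pi * Complex.I * (cv (iv n) ⬝ᵥ τ *ᵥ cv (iv n))) *
        Complex.exp (2 * Real.pi * Complex.I * (cv (iv n) ⬝ᵥ z)) := by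
  unfold thetaSeries
  refine tsum_congr fun n => ?_
  rw [add_zero, expTerm, ← Complex.exp_add]
  congr 1
  ring

theorem summable_norm_exp_quadratic {g : ℕ} (τ : SiegelUpperHalfSpace g) :
    Summable fun n : Fin g → ℤ =>
      ‖Complex.exp (Real.pi * Complex.I * (cv (iv n) ⬝ᵥ τ.1 *ᵥ cv (iv n)))‖ := by
  simpa [expTerm] using summable_norm_expTerm τ 0 0

/-- The theta function does not vanish identically on real vectors. -/
theorem exists_thetaSeries_ne_zero {g : ℕ} (τ : SiegelUpperHalfSpace g) :
    ∃ b : Fin g → ℝ, thetaSeries τ.1 0 (cv b) ≠ 0 := by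
  by_contra! hcon
  have hs := summable_norm_exp_quadratic τ
  -- Integrate the series termwise: only n = 0 survives, with coefficient 1, while the sum is
  -- assumed to vanish on the cube.
  have h1 := MeasureTheory.hasSum_integral_of_summable_integral_norm
    (μ := MeasureTheory.volume.restrict (cube (0 : Fin g → ℝ)))
    (F := fun (n : Fin g → ℤ) (x : Fin g → ℝ) =>
      Complex.exp (Real.pi * Complex.I * (cv (iv n) ⬝ᵥ τ.1 *ᵥ cv (iv n))) *
        Complex.exp (2 * Real.pi * Complex.I * ((iv n ⬝ᵥ x : ℝ) : ℂ)))
    (fun n => integrableOn_cube (by simp only [dotProduct]; fun_prop) 0) ?_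
  · simp only [MeasureTheory.integral_const_mul, integral_cube_exp] at h1
    have h2 : ∀ x : Fin g → ℝ, ∑' n : Fin g → ℤ,
        Complex.exp (Real.pi * Complex.I * (cv (iv n) ⬝ᵥ τ.1 *ᵥ cv (iv n))) *
        Complex.exp (2 * Real.pi * Complex.I * ((iv n ⬝ᵥ x : ℝ) : ℂ)) = 0 := by
      intro x
      rw [← hcon x, thetaSeries_zero_eq]
      simp only [cv_dotProduct_cv]
    simp only [h2, MeasureTheory.integral_zero] at h1
    have h3 := h1.tsum_eq
    simp at h3
  · refine hs.congr fun n => ?_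
    have : ∀ x : Fin g → ℝ, ‖Complex.exp (2 * Real.pi * Complex.I * ((iv n ⬝ᵥ x : ℝ) : ℂ))‖ = 1 := by
      intro x
      rw [Complex.norm_exp]
      simp
    simp only [norm_mul, this, mul_one]
    simp [MeasureTheory.Measure.real, volume_cube]

/-- An entire function with the quasi-periods of the theta function is a multiple of it. -/
theorem eq_const_mul_thetaSeries {g : ℕ} (τ : SiegelUpperHalfSpace g) {f : (Fin g → ℂ) → ℂ}
    (hc : Continuous f) (hd : ∀ z w : Fin g → ℂ, Differentiable ℂ fun ζ : ℂ => f (z + ζ • w))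
    (hper : ∀ z m, f (z + cv (iv m)) = f z)
    (hquasi : ∀ z p, f (z + τ.1 *ᵥ cv (iv p)) = Complex.exp (-(Real.pi * Complex.I *
        (cv (iv p) ⬝ᵥ τ.1 *ᵥ cv (iv p) + 2 * (cv (iv p) ⬝ᵥ z)))) * f z) :
    ∃ c : ℂ, ∀ z, f z = c * thetaSeries τ.1 0 z := by
  -- The integral of `F n` over the cube translated by z is the n-th Fourier coefficient of x ↦ f(x
  -- + z), twisted by exp(−2πi n·z). The twist makes it independent of z: it is invariant under real
  -- translations and holomorphic along complex lines.
  let F : (Fin g → ℤ) → (Fin g → ℂ) → ℂ := fun n z =>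
    Complex.exp (-(2 * Real.pi * Complex.I * (cv (iv n) ⬝ᵥ z))) * f z
  have hFc : ∀ n, Continuous (F n) := fun n => by
    simp only [F, dotProduct]
    fun_prop
  have hFcv : ∀ n z, Continuous fun x : Fin g → ℝ => F n (cv x + z) := fun n z =>
    (hFc n).comp (by unfold cv; fun_prop)
  have hFp : ∀ n z m, F n (z + cv (iv m)) = F n z := by
    intro n z m
    simp only [F, hper]
    rw [dotProduct_add, cv_dotProduct_cv, iv_dotProduct_iv, mul_add, neg_add, Complex.exp_add]
    push_cast
    rw [Complex.exp_neg (2 * (Real.pi : ℂ) * Complex.I * ((n ⬝ᵥ m : ℤ) : ℂ)),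
      exp_int_mul_two_pi, inv_one, mul_one]
  let c : (Fin g → ℤ) → (Fin g → ℂ) → ℂ := fun n z => ∫ x in cube 0, F n (cv x + z)
  have hreal : ∀ n z r, c n (z + cv r) = c n z := by
    intro n z r
    have := integral_cube_translate (hFcv n z) (fun x m => by
      rw [cv_add, add_right_comm, hFp]) r
    simp only [c]
    rw [← this]
    congr 1
    funext x
    rw [cv_add]
    congr 1
    abel
  have hconst : ∀ n z, c n z = c n 0 := by
    intro n z
    let y : Fin g → ℝ := fun i => (z i).im
    let x : Fin g → ℝ := fun i => (z i).re
    have hz : z = Complex.I • cv y + cv x := by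
      ext i
      simp [cv, x, y, mul_comm Complex.I, add_comm]
    rw [hz, hreal]
    have hdiff : Differentiable ℂ fun ζ : ℂ => c n (ζ • cv y) := by
      refine differentiable_integral_cube (k := fun ζ x => F n (cv x + ζ • cv y)) ?_ fun x => ?_
      · exact (hFc n).comp (by unfold cv; fun_prop)
      · simp only [F]
        refine Differentiable.mul ?_ (hd _ _)
        simp only [dotProduct]
        fun_prop
    -- The function is constant on the real axis, so by the identity theorem it takes the same value
    -- at ζ = i.
    have hana : AnalyticOnNhd ℂ (fun ζ : ℂ => c n (ζ • cv y)) Set.univ := fun ζ _ =>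
      hdiff.analyticAt ζ
    have hEq := hana.eqOn_of_preconnected_of_frequently_eq (analyticOnNhd_const (v := c n 0))
      isPreconnected_univ (z₀ := 0) (Set.mem_univ _) ?_
    · exact hEq (Set.mem_univ Complex.I)
    · have hr : ∀ r : ℝ, c n ((r : ℂ) • cv y) = c n 0 := by
        intro r
        rw [← cv_smul, ← zero_add (cv (r • y)), hreal]
      have hlim : Filter.Tendsto (fun k : ℕ => ((1 / ((k : ℝ) + 1) : ℝ) : ℂ)) Filter.atTop
          (nhdsWithin 0 {0}ᶜ) := by
        refine tendsto_nhdsWithin_iff.2 ⟨?_, Filter.Eventually.of_forall fun k => ?_⟩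
        · have := (Complex.continuous_ofReal.tendsto 0).comp tendsto_one_div_add_atTop_nhds_zero_nat
          simpa [Function.comp_def] using this
        · simp only [Set.mem_compl_iff, Set.mem_singleton_iff, Complex.ofReal_eq_zero]
          positivity
      exact hlim.frequently (Filter.Frequently.of_forall fun k => hr _)
  -- Evaluating the zeroth coefficient at z = τp, the quasi-periodicity factor supplies the
  -- character of index p. All coefficients are thus those of θ times `c 0 0`.
  have hshift : ∀ p, c p 0 = Complex.exp (Real.pi * Complex.I * (cv (iv p) ⬝ᵥ τ.1 *ᵥ cv (iv p))) *
      c 0 0 := by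
    intro p
    rw [← hconst 0 (τ.1 *ᵥ cv (iv p))]
    simp only [c]
    rw [← MeasureTheory.integral_const_mul]
    congr 1
    funext x
    simp only [F]
    rw [hquasi, iv_zero, cv_zero, zero_dotProduct, mul_zero, neg_zero, Complex.exp_zero, one_mul,
      ← mul_assoc, ← Complex.exp_add, add_zero]
    congr 2
    ring
  refine ⟨c 0 0, fun z => ?_⟩
  have h1 := eq_tsum_fourier (h := fun x => f (cv x + z)) (hc.comp (by unfold cv; fun_prop))
    (fun x m => by rw [cv_add, add_right_comm, hper])
    (c := fun n => Complex.exp (2 * Real.pi * Complex.I * (cv (iv n) ⬝ᵥ z)) *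
      (Complex.exp (Real.pi * Complex.I * (cv (iv n) ⬝ᵥ τ.1 *ᵥ cv (iv n))) * c 0 0)) ?_ ?_ 0
  · simp only [cv_zero, zero_add, dotProduct_zero, Complex.ofReal_zero, mul_zero, Complex.exp_zero,
      mul_one] at h1
    rw [h1, thetaSeries_zero_eq, ← tsum_mul_left]
    refine tsum_congr fun n => ?_
    ring
  · intro n
    rw [← hshift, ← hconst n z]
    simp only [c]
    rw [← MeasureTheory.integral_const_mul]
    congr 1
    funext x
    simp only [F]
    rw [← mul_assoc, ← Complex.exp_add, dotProduct_add, cv_dotProduct_cv]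
    congr 2
    ring
  · have := (summable_expTerm τ 0 z).mul_right (c 0 0)
    refine this.congr fun n => ?_
    rw [add_zero, expTerm, ← mul_assoc, ← Complex.exp_add]
    congr 2
    ring

/-! ### The real quadratic form attached to a point of the Siegel space -/

/-- The norm form of the lattice `τ ℤ^g + ℤ^g` in the coordinates `(a, b) ↦ τ a + b`. -/
def siegelForm {g : ℕ} (τ : Matrix (Fin g) (Fin g) ℂ) (a b : Fin g → ℝ) : ℝ :=
  a ⬝ᵥ τ.map Complex.im *ᵥ a + (τ.map Complex.re *ᵥ a + b) ⬝ᵥ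
    (τ.map Complex.im)⁻¹ *ᵥ (τ.map Complex.re *ᵥ a + b)

namespace SiegelUpperHalfSpace

variable {g : ℕ} (τ : SiegelUpperHalfSpace g)

theorem isSymm_im : (τ.1.map Complex.im).IsSymm :=
  τ.2.1.map _

theorem isSymm_re : (τ.1.map Complex.re).IsSymm :=
  τ.2.1.map _

theorem isSymm_im_inv : ((τ.1.map Complex.im)⁻¹).IsSymm := by
  rw [Matrix.IsSymm, Matrix.transpose_nonsing_inv, τ.isSymm_im.eq]

theorem isUnit_det_im : IsUnit (τ.1.map Complex.im).det :=
  (Matrix.isUnit_iff_isUnit_det _).1 τ.2.2.isUnit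

theorem im_inv_mulVec_im (x : Fin g → ℝ) :
    (τ.1.map Complex.im)⁻¹ *ᵥ τ.1.map Complex.im *ᵥ x = x := by
  rw [Matrix.mulVec_mulVec, Matrix.nonsing_inv_mul _ τ.isUnit_det_im, Matrix.one_mulVec]

theorem im_mulVec_im_inv (x : Fin g → ℝ) :
    τ.1.map Complex.im *ᵥ (τ.1.map Complex.im)⁻¹ *ᵥ x = x := by
  rw [Matrix.mulVec_mulVec, Matrix.mul_nonsing_inv _ τ.isUnit_det_im, Matrix.one_mulVec]

theorem mulVec_cv_eq (a : Fin g → ℝ) : τ.1 *ᵥ cv a =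
    cv (τ.1.map Complex.re *ᵥ a) + Complex.I • cv (τ.1.map Complex.im *ᵥ a) := by
  ext i
  apply Complex.ext
  · simp [re_mulVec_cv, cv]
  · simp [im_mulVec_cv, cv]

theorem im_quadratic_nonneg (x : Fin g → ℝ) : 0 ≤ x ⬝ᵥ τ.1.map Complex.im *ᵥ x := by
  simpa using τ.2.2.posSemidef.dotProduct_mulVec_nonneg x

theorem im_inv_quadratic_nonneg (x : Fin g → ℝ) : 0 ≤ x ⬝ᵥ (τ.1.map Complex.im)⁻¹ *ᵥ x := by
  simpa using τ.2.2.inv.posSemidef.dotProduct_mulVec_nonneg x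

theorem siegelForm_nonneg (a b : Fin g → ℝ) : 0 ≤ siegelForm τ.1 a b :=
  add_nonneg (τ.im_quadratic_nonneg _) (τ.im_inv_quadratic_nonneg _)

/-- Every complex vector is of the form `b + τ a` with real `a`, `b`. -/
theorem exists_real_coordinates (z : Fin g → ℂ) :
    ∃ a b : Fin g → ℝ, z = cv b + τ.1 *ᵥ cv a ∧
      a = (τ.1.map Complex.im)⁻¹ *ᵥ fun i => (z i).im := by
  refine ⟨_, (fun i => (z i).re) - τ.1.map Complex.re *ᵥ ((τ.1.map Complex.im)⁻¹ *ᵥ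
    fun i => (z i).im), ?_, rfl⟩
  rw [mulVec_cv_eq, im_mulVec_im_inv, cv_sub, ← add_assoc, sub_add_cancel]
  ext i
  simp [cv, mul_comm Complex.I]

end SiegelUpperHalfSpace

/-! ### Growth of theta series and decay along short lattice vectors -/

/-- Growth of the theta series in the complex argument. -/
theorem norm_thetaSeries_le {g : ℕ} (τ : SiegelUpperHalfSpace g) (a : Fin g → ℝ)
    (z : Fin g → ℂ) : ‖thetaSeries τ.1 a z‖ ≤ thetaSup τ *
      Real.exp (Real.pi * ((fun i => (z i).im) ⬝ᵥ (τ.1.map Complex.im)⁻¹ *ᵥ fun i => (z i).im)) := by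
  -- Write z = b + τc with c = Y⁻¹ Im z. Up to an exponential of modulus exp(π cᵗYc), the value at z
  -- is a value at a real characteristic, which the supremum controls.
  obtain ⟨c, b, hz, hc⟩ := τ.exists_real_coordinates z
  have h := thetaSeries_shift τ.2.1 a c (cv b)
  rw [← hz] at h
  have h1 := norm_thetaSeries_le_thetaSup τ (a + c) b
  have h2 : (Real.pi * Complex.I * (cv c ⬝ᵥ τ.1 *ᵥ cv c + 2 * (cv c ⬝ᵥ cv b)) : ℂ).re =
      -(Real.pi * ((fun i => (z i).im) ⬝ᵥ (τ.1.map Complex.im)⁻¹ *ᵥ fun i => (z i).im)) := by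
    have h3 : (cv c ⬝ᵥ τ.1 *ᵥ cv c).im =
        (fun i => (z i).im) ⬝ᵥ (τ.1.map Complex.im)⁻¹ *ᵥ fun i => (z i).im := by
      rw [im_quadratic, hc, τ.im_mulVec_im_inv, dotProduct_comm]
    rw [← h3, cv_dotProduct_cv]
    simp [Complex.mul_re, Complex.mul_im]
  rw [h, norm_mul, Complex.norm_exp, h2] at h1
  rw [Real.exp_neg, inv_mul_le_iff₀ (Real.exp_pos _)] at h1
  rwa [mul_comm]

/-- Theta series with a character that changes sign along a short lattice vector are small. -/
theorem norm_thetaSeries_le_of_short {g : ℕ} (τ : SiegelUpperHalfSpace g) (p q : Fin g → ℤ)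
    (a b : Fin g → ℝ) {ρ : ℝ} (hρ : 0 < ρ) (hρ1 : ρ ≤ 1)
    (hQ : siegelForm τ.1 (iv p) (iv q) ≤ ρ ^ 2)
    (hsign : Complex.exp (Real.pi * Complex.I * ((iv p ⬝ᵥ iv q : ℝ) : ℂ) +
      2 * Real.pi * Complex.I * ((a ⬝ᵥ iv q - iv p ⬝ᵥ b : ℝ) : ℂ)) = -1) :
    ‖thetaSeries τ.1 a (cv b)‖ ≤ Real.exp (2 * Real.pi) * ρ * thetaSup τ := by
  set M := thetaSup τ with hM
  have hM0 : 0 ≤ M := (norm_nonneg _).trans (norm_thetaSeries_le_thetaSup τ 0 0)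
  set Y' := (τ.1.map Complex.im)⁻¹ with hY'
  set u := τ.1.map Complex.re *ᵥ iv p + iv q with hu
  set v := τ.1.map Complex.im *ᵥ iv p with hv
  set Q := siegelForm τ.1 (iv p) (iv q) with hQdef
  have hYv : Y' *ᵥ v = iv p := τ.im_inv_mulVec_im _
  have hsymm : ∀ x y : Fin g → ℝ, x ⬝ᵥ Y' *ᵥ y = y ⬝ᵥ Y' *ᵥ x :=
    dotProduct_mulVec_symm τ.isSymm_im_inv
  have hvv : v ⬝ᵥ Y' *ᵥ v = iv p ⬝ᵥ v := by rw [hYv, dotProduct_comm]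
  have huv : u ⬝ᵥ Y' *ᵥ v = iv p ⬝ᵥ u := by rw [hYv, dotProduct_comm]
  have hQ' : Q = iv p ⬝ᵥ v + u ⬝ᵥ Y' *ᵥ u := rfl
  set w := τ.1 *ᵥ cv (iv p) + cv (iv q) with hw
  have hw' : w = cv u + Complex.I • cv v := by
    rw [hw, τ.mulVec_cv_eq, hu, cv_add]
    abel
  -- W = wᵗY⁻¹w is bilinear, without conjugation. Multiplying by exp(πζ²W/2) replaces the growth
  -- exponent π Im(ζw)ᵗY⁻¹Im(ζw) by the rotation-invariant (π/2)|ζ|²Q.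
  set W : ℂ := ((u ⬝ᵥ Y' *ᵥ u - iv p ⬝ᵥ v : ℝ) : ℂ) + 2 * Complex.I * ((iv p ⬝ᵥ u : ℝ) : ℂ) with hW
  let f : ℂ → ℂ := fun ζ =>
    thetaSeries τ.1 a (cv b + ζ • w) * Complex.exp (Real.pi / 2 * ζ ^ 2 * W)
  have hf : Differentiable ℂ f :=
    (differentiable_thetaSeries_line τ a (cv b) w).mul (by fun_prop)
  have hfn : ∀ ζ : ℂ, ‖f ζ‖ ≤ M * Real.exp (Real.pi / 2 * ‖ζ‖ ^ 2 * Q) := by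
    intro ζ
    have h1 := norm_thetaSeries_le τ a (cv b + ζ • w)
    have him : (fun i => ((cv b + ζ • w) i).im) = ζ.re • v + ζ.im • u := by
      ext i
      rw [hw']
      simp [cv]
      try ring
    rw [him, ← hY'] at h1
    have h2 : ‖f ζ‖ = ‖thetaSeries τ.1 a (cv b + ζ • w)‖ *
        Real.exp (Real.pi / 2 * ((ζ.re ^ 2 - ζ.im ^ 2) * (u ⬝ᵥ Y' *ᵥ u - iv p ⬝ᵥ v) -
          2 * (ζ.re * ζ.im) * (2 * (iv p ⬝ᵥ u)))) := by
      rw [norm_mul, Complex.norm_exp]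
      congr 2
      rw [hW]
      have : (Real.pi / 2 * ζ ^ 2 * (((u ⬝ᵥ Y' *ᵥ u - iv p ⬝ᵥ v : ℝ) : ℂ) +
          2 * Complex.I * ((iv p ⬝ᵥ u : ℝ) : ℂ)) : ℂ) = ((Real.pi / 2 : ℝ) : ℂ) * (ζ ^ 2 *
          (((u ⬝ᵥ Y' *ᵥ u - iv p ⬝ᵥ v : ℝ) : ℂ) +
          Complex.I * ((2 * (iv p ⬝ᵥ u) : ℝ) : ℂ))) := by
        push_cast; ring
      rw [this, Complex.re_ofReal_mul, pow_two ζ]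
      simp only [Complex.mul_re, Complex.mul_im, Complex.add_re, Complex.add_im, Complex.ofReal_re,
        Complex.ofReal_im, Complex.I_re, Complex.I_im]
      ring
    rw [h2]
    refine (mul_le_mul_of_nonneg_right h1 (Real.exp_pos _).le).trans (le_of_eq ?_)
    rw [mul_assoc, ← Real.exp_add]
    congr 2
    have hnorm : ‖ζ‖ ^ 2 = ζ.re ^ 2 + ζ.im ^ 2 := by
      rw [← Complex.normSq_eq_norm_sq, Complex.normSq_apply]; ring
    rw [hnorm, hQ']
    simp only [Matrix.mulVec_add, Matrix.mulVec_smul, dotProduct_add, add_dotProduct,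
      smul_dotProduct, dotProduct_smul, smul_eq_mul]
    rw [hvv, huv, hsymm v u, huv]
    ring
  have hQ0 : 0 ≤ Q := τ.siegelForm_nonneg _ _
  -- Cauchy's estimate on a circle of radius 1/ρ: there |ξ|²Q ≤ (1 + 1/ρ)²ρ² ≤ 4, so |f| ≤ M
  -- exp(2π).
  have hderiv : ∀ ζ ∈ Metric.closedBall (0 : ℂ) 1, ‖deriv f ζ‖ ≤
      Real.exp (2 * Real.pi) * ρ * M := by
    intro ζ hζ
    have h1 := Complex.norm_deriv_le_of_forall_mem_sphere_norm_le (c := ζ) (R := ρ⁻¹)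
      (C := M * Real.exp (2 * Real.pi)) (inv_pos.2 hρ) hf.diffContOnCl fun ξ hξ => ?_
    · rw [div_inv_eq_mul] at h1
      linarith
    · refine (hfn ξ).trans ?_
      refine mul_le_mul_of_nonneg_left (Real.exp_le_exp.2 ?_) hM0
      have h2 : ‖ξ‖ ≤ 1 + ρ⁻¹ := by
        have h3 : ‖ξ - ζ‖ = ρ⁻¹ := by simpa [dist_eq_norm] using hξ
        have h4 : ‖ζ‖ ≤ 1 := by simpa using hζ
        calc ‖ξ‖ = ‖ζ + (ξ - ζ)‖ := by simp
          _ ≤ _ := (norm_add_le _ _).trans (by rw [h3]; gcongr)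
      have h5 : ‖ξ‖ ^ 2 * Q ≤ 4 := by
        calc ‖ξ‖ ^ 2 * Q ≤ (1 + ρ⁻¹) ^ 2 * ρ ^ 2 := by gcongr
          _ = (ρ + 1) ^ 2 := by field_simp
          _ ≤ (1 + 1) ^ 2 := by gcongr
          _ = 4 := by norm_num
      have := Real.pi_pos
      calc Real.pi / 2 * ‖ξ‖ ^ 2 * Q = Real.pi / 2 * (‖ξ‖ ^ 2 * Q) := by ring
        _ ≤ Real.pi / 2 * 4 := by gcongr
        _ = 2 * Real.pi := by ring
  have hdiff := (convex_closedBall (0 : ℂ) 1).norm_image_sub_le_of_norm_deriv_le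
    (fun ζ _ => hf ζ) hderiv (Metric.mem_closedBall_self zero_le_one)
    (show (1 : ℂ) ∈ Metric.closedBall 0 1 by simp)
  have hf0 : f 0 = thetaSeries τ.1 a (cv b) := by simp [f]
  -- Translation by w multiplies f by a negative real number, thanks to `hsign`. Hence |f 1 − f 0| ≥
  -- |f 0|, and the derivative bound applies to f 0 itself.
  have hf1 : f 1 = -(Real.exp (Real.pi / 2 * Q) : ℂ) * f 0 := by
    have h1 := thetaSeries_shift τ.2.1 a (iv p) (cv b)
    rw [thetaSeries_add_left] at h1
    have hE : Complex.exp (-(Real.pi * Complex.I * (cv (iv p) ⬝ᵥ τ.1 *ᵥ cv (iv p) +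
        2 * (cv (iv p) ⬝ᵥ cv b)))) * thetaSeries τ.1 a (cv b) =
        thetaSeries τ.1 a (cv b + τ.1 *ᵥ cv (iv p)) := by
      rw [h1, ← mul_assoc, ← Complex.exp_add]
      simp
    rw [hf0]
    simp only [f, one_smul, one_pow, mul_one]
    rw [hw, ← add_assoc, thetaSeries_add_right, ← hE, Complex.ofReal_exp]
    conv_rhs => rw [neg_eq_neg_one_mul, ← hsign]
    have hpp : cv (iv p) ⬝ᵥ τ.1 *ᵥ cv (iv p) =
        ((iv p ⬝ᵥ u - iv p ⬝ᵥ iv q : ℝ) : ℂ) + Complex.I * ((iv p ⬝ᵥ v : ℝ) : ℂ) := by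
      rw [τ.mulVec_cv_eq, dotProduct_add, dotProduct_smul, cv_dotProduct_cv, cv_dotProduct_cv, hu,
        dotProduct_add, smul_eq_mul]
      simp [hv]
    rw [hpp, cv_dotProduct_cv, hW, hQ']
    have : ∀ x y z t e : ℂ, x * (y * t) * z = x * y * z * t := fun x y z t e => by ring
    rw [this _ _ _ _ 0]
    simp only [← Complex.exp_add]
    congr 2
    push_cast
    ring_nf
    rw [Complex.I_sq]
    ring
  have h3 : ‖f 1 - f 0‖ = (Real.exp (Real.pi / 2 * Q) + 1) * ‖f 0‖ := by
    rw [hf1, show -(Real.exp (Real.pi / 2 * Q) : ℂ) * f 0 - f 0 =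
      -(((Real.exp (Real.pi / 2 * Q) + 1 : ℝ) : ℂ) * f 0) by push_cast; ring, norm_neg, norm_mul,
      Complex.norm_real, Real.norm_of_nonneg (by positivity)]
  rw [h3, hf0] at hdiff
  simp only [sub_zero, norm_one, mul_one] at hdiff
  refine le_trans ?_ hdiff
  have := Real.exp_pos (Real.pi / 2 * Q)
  nlinarith [norm_nonneg (thetaSeries τ.1 a (cv b))]

/-! ### Fourth powers and translation by half periods -/

/-- Entire functions of one variable form an integral domain and f⁴ − h⁴ splits into linear factors,
so one factor vanishes identically. -/
theorem exists_const_mul_of_pow_four_eq {f h : ℂ → ℂ} (hf : Differentiable ℂ f)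
    (hh : Differentiable ℂ h) (heq : ∀ ζ, f ζ ^ 4 = h ζ ^ 4) :
    ∃ ω : ℂ, ω ≠ 0 ∧ ∀ ζ, f ζ = ω * h ζ := by
  have hana : ∀ {k : ℂ → ℂ}, Differentiable ℂ k → AnalyticOnNhd ℂ k Set.univ :=
    fun hk ζ _ => hk.analyticAt ζ
  have key : ∀ {k l : ℂ → ℂ}, Differentiable ℂ k → Differentiable ℂ l → (∀ ζ, k ζ * l ζ = 0) →
      (∀ ζ, k ζ = 0) ∨ ∀ ζ, l ζ = 0 := by
    intro k l hk hl hkl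
    have := AnalyticOnNhd.eq_zero_or_eq_zero_of_mul_eq_zero (hana hk) (hana hl)
      (fun ζ _ => hkl ζ) isPreconnected_univ
    simpa using this
  have h1 := key (k := fun ζ => f ζ ^ 2 - h ζ ^ 2) (l := fun ζ => f ζ ^ 2 + h ζ ^ 2)
    (by fun_prop) (by fun_prop) fun ζ => by linear_combination heq ζ
  rcases h1 with h1 | h1
  · rcases key (k := fun ζ => f ζ - h ζ) (l := fun ζ => f ζ + h ζ) (by fun_prop) (by fun_prop)
      (fun ζ => by linear_combination h1 ζ) with h2 | h2
    · exact ⟨1, one_ne_zero, fun ζ => by linear_combination h2 ζ⟩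
    · exact ⟨-1, by norm_num, fun ζ => by linear_combination h2 ζ⟩
  · rcases key (k := fun ζ => f ζ - Complex.I * h ζ) (l := fun ζ => f ζ + Complex.I * h ζ)
      (by fun_prop) (by fun_prop)
      (fun ζ => by linear_combination h1 ζ - h ζ ^ 2 * Complex.I_sq) with h2 | h2
    · exact ⟨Complex.I, Complex.I_ne_zero, fun ζ => by linear_combination h2 ζ⟩
    · exact ⟨-Complex.I, neg_ne_zero.2 Complex.I_ne_zero, fun ζ => by linear_combination h2 ζ⟩

theorem exp_pi_mul_int (k : ℤ) : Complex.exp (Real.pi * Complex.I * (k : ℂ)) = (-1) ^ k := by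
  rw [mul_comm, Complex.exp_int_mul, Complex.exp_pi_mul_I]

theorem exp_pi_mul_odd {k : ℤ} (hk : Odd k) : Complex.exp (Real.pi * Complex.I * (k : ℂ)) = -1 := by
  rw [exp_pi_mul_int, hk.neg_one_zpow]

/-- The fourth power of the theta series under translation by half a lattice vector, when the
half-integral values of one sign vanish. -/
theorem thetaSeries_half_translate_pow_four {g : ℕ} (τ : SiegelUpperHalfSpace g)
    (p q : Fin g → ℤ)
    (hvan : ∀ s t : Fin g → Fin 2, Odd (p ⬝ᵥ q + bit s ⬝ᵥ q - p ⬝ᵥ bit t) →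
      thetaSeries τ.1 (hv s) (cv (hv t)) = 0) (a b : Fin g → ℝ) :
    thetaSeries τ.1 (a + (2⁻¹ : ℝ) • iv p) (cv (b + (2⁻¹ : ℝ) • iv q)) ^ 4 =
      Complex.exp (Real.pi * Complex.I * ((iv p ⬝ᵥ iv q : ℝ) : ℂ) +
        4 * Real.pi * Complex.I * ((a ⬝ᵥ iv q : ℝ) : ℂ)) * thetaSeries τ.1 a (cv b) ^ 4 := by
  rw [riemann_quartic, riemann_quartic, mul_left_comm]
  congr 1
  rw [Finset.mul_sum]
  refine Finset.sum_congr rfl fun s _ => ?_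
  rw [Finset.mul_sum]
  refine Finset.sum_congr rfl fun t _ => ?_
  -- Doubling makes the half-vector an integral shift, so the (s, t)-term changes only by a phase.
  -- Its ratio to the claimed phase is −1 raised to the integer tested here; the odd terms vanish by
  -- hypothesis.
  by_cases hodd : Odd (p ⬝ᵥ q + bit s ⬝ᵥ q - p ⬝ᵥ bit t)
  · rw [hvan s t hodd]; ring
  · have h1 : (2 : ℝ) • (a + (2⁻¹ : ℝ) • iv p) + hv s = ((2 : ℝ) • a + hv s) + iv p := by
      rw [smul_add, smul_smul]; norm_num; abel
    have h2 : cv ((2 : ℝ) • (b + (2⁻¹ : ℝ) • iv q) + hv t) =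
        cv ((2 : ℝ) • b + hv t) + cv (iv q) := by
      rw [← cv_add]
      congr 1
      rw [smul_add, smul_smul]; norm_num; abel
    rw [h1, h2, thetaSeries_add_left, thetaSeries_add_right, ← mul_assoc, ← mul_assoc, ← mul_assoc,
      ← mul_assoc, ← Complex.exp_add]
    congr 2
    rw [← Complex.exp_add, Complex.exp_eq_exp_iff_exists_int]
    obtain ⟨k, hk⟩ := Int.not_odd_iff_even.1 hodd
    refine ⟨k - p ⬝ᵥ q, ?_⟩
    have hk' : ((p ⬝ᵥ q : ℤ) : ℂ) + ((bit s ⬝ᵥ q : ℤ) : ℂ) - ((p ⬝ᵥ bit t : ℤ) : ℂ) = k + k := by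
      exact_mod_cast congrArg (Int.cast : ℤ → ℂ) hk
    simp only [add_dotProduct, smul_dotProduct, hv, iv_dotProduct_iv, smul_eq_mul]
    push_cast
    linear_combination (Real.pi * Complex.I : ℂ) * hk'

/-- If all these constants vanished, the translate of θ by (τp + q)/2, times a suitable exponential,
would have the same fourth power as θ and so be proportional to θ along a line. Translation by a
lattice vector that pairs oddly with (p, q) gives the two functions opposite factors, a
contradiction. -/
theorem exists_half_char_ne_zero {g : ℕ} (τ : SiegelUpperHalfSpace g) (p q : Fin g → ℤ)
    (hpq : ∃ i, Odd (p i) ∨ Odd (q i)) :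
    ∃ s t : Fin g → Fin 2, Odd (p ⬝ᵥ q + bit s ⬝ᵥ q - p ⬝ᵥ bit t) ∧
      thetaSeries τ.1 (hv s) (cv (hv t)) ≠ 0 := by
  by_contra! hcon
  have hpow := thetaSeries_half_translate_pow_four τ p q hcon
  obtain ⟨m, n, hmn⟩ : ∃ m n : Fin g → ℤ, Odd (p ⬝ᵥ n - m ⬝ᵥ q) := by
    obtain ⟨i, hi | hi⟩ := hpq
    · exact ⟨0, Pi.single i 1, by simpa using hi⟩
    · exact ⟨Pi.single i 1, 0, by simpa using hi⟩
  set w := τ.1 *ᵥ cv (iv p) + cv (iv q) with hw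
  set μ := τ.1 *ᵥ cv (iv m) + cv (iv n) with hμ
  have hsymm := dotProduct_mulVec_symm τ.2.1
  obtain ⟨κ, hκ⟩ : ∃ κ : ℂ, κ = Complex.exp (Real.pi * Complex.I / 4 *
    (cv (iv p) ⬝ᵥ τ.1 *ᵥ cv (iv p) + ((iv p ⬝ᵥ iv q : ℝ) : ℂ))) := ⟨_, rfl⟩
  -- κ and the linear exponential are chosen so that H⁴ = θ⁴ exactly.
  let H : (Fin g → ℂ) → ℂ := fun z =>
    κ * Complex.exp (Real.pi * Complex.I * (cv (iv p) ⬝ᵥ z)) *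
      thetaSeries τ.1 0 (z + (2⁻¹ : ℂ) • w)
  have hH4 : ∀ z, H z ^ 4 = thetaSeries τ.1 0 z ^ 4 := by
    intro z
    obtain ⟨a, b, hz, -⟩ := τ.exists_real_coordinates z
    have h1 := hpow a b
    rw [thetaSeries_eq_zero_char τ.2.1 a, thetaSeries_eq_zero_char τ.2.1 (_ + _), ← hz] at h1
    have h2 : cv (b + (2⁻¹ : ℝ) • iv q) + τ.1 *ᵥ cv (a + (2⁻¹ : ℝ) • iv p) =
        z + (2⁻¹ : ℂ) • w := by
      rw [hz, hw, cv_add, cv_add, cv_smul, cv_smul, Matrix.mulVec_add, Matrix.mulVec_smul, smul_add]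
      push_cast
      abel
    rw [h2] at h1
    simp only [H, hκ]
    rw [mul_pow, mul_pow, ← Complex.exp_nat_mul, ← Complex.exp_nat_mul,
      ← mul_assoc (Complex.exp _) (Complex.exp _), ← Complex.exp_add] at h1
    rw [mul_pow, mul_pow, ← Complex.exp_nat_mul, ← Complex.exp_nat_mul, ← Complex.exp_add]
    have h3 : thetaSeries τ.1 0 (z + (2⁻¹ : ℂ) • w) ^ 4 = Complex.exp (-(((4 : ℕ) : ℂ) *
        (Real.pi * Complex.I * (cv (a + (2⁻¹ : ℝ) • iv p) ⬝ᵥ τ.1 *ᵥ cv (a + (2⁻¹ : ℝ) • iv p) +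
          2 * (cv (a + (2⁻¹ : ℝ) • iv p) ⬝ᵥ cv (b + (2⁻¹ : ℝ) • iv q)))))) *
        (Complex.exp (Real.pi * Complex.I * ((iv p ⬝ᵥ iv q : ℝ) : ℂ) +
          4 * Real.pi * Complex.I * ((a ⬝ᵥ iv q : ℝ) : ℂ) +
          ((4 : ℕ) : ℂ) * (Real.pi * Complex.I * (cv a ⬝ᵥ τ.1 *ᵥ cv a + 2 * (cv a ⬝ᵥ cv b)))) *
          thetaSeries τ.1 0 z ^ 4) := by
      rw [← h1, ← mul_assoc, ← Complex.exp_add]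
      simp
    rw [h3, ← mul_assoc, ← mul_assoc, ← Complex.exp_add, ← Complex.exp_add]
    convert one_mul (thetaSeries τ.1 0 z ^ 4)
    rw [Complex.exp_eq_one_iff]
    refine ⟨0, ?_⟩
    rw [hz]
    simp only [cv_add, cv_smul, Matrix.mulVec_add, Matrix.mulVec_smul, dotProduct_add,
      add_dotProduct, smul_dotProduct, dotProduct_smul, smul_eq_mul, ← cv_dotProduct_cv]
    rw [hsymm (cv (iv p)) (cv a)]
    push_cast
    ring
  have hθμ : ∀ z, thetaSeries τ.1 0 (z + μ) = Complex.exp (-(Real.pi * Complex.I *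
      (cv (iv m) ⬝ᵥ τ.1 *ᵥ cv (iv m) + 2 * (cv (iv m) ⬝ᵥ z)))) * thetaSeries τ.1 0 z := by
    intro z
    rw [hμ, ← add_assoc, thetaSeries_zero_add_int, thetaSeries_zero_add_period τ.2.1]
  have hHμ : ∀ z, H (z + μ) = -(Complex.exp (-(Real.pi * Complex.I *
      (cv (iv m) ⬝ᵥ τ.1 *ᵥ cv (iv m) + 2 * (cv (iv m) ⬝ᵥ z)))) * H z) := by
    intro z
    simp only [H]
    rw [add_right_comm, hθμ]
    conv_rhs => rw [neg_eq_neg_one_mul, ← exp_pi_mul_odd hmn]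
    have hr : ∀ x y z t u : ℂ, x * (y * (z * t * u)) = z * (x * y * t) * u :=
      fun x y z t u => by ring
    rw [hr, ← mul_assoc, mul_assoc κ, ← Complex.exp_add, ← Complex.exp_add, ← Complex.exp_add]
    congr 3
    have hpn : (((p ⬝ᵥ n - m ⬝ᵥ q : ℤ)) : ℂ) = cv (iv p) ⬝ᵥ cv (iv n) - cv (iv m) ⬝ᵥ cv (iv q) := by
      rw [cv_dotProduct_cv, cv_dotProduct_cv, iv_dotProduct_iv, iv_dotProduct_iv]
      push_cast
      ring
    rw [hpn, hμ, hw]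
    simp only [dotProduct_add, dotProduct_smul, smul_eq_mul]
    rw [hsymm (cv (iv p)) (cv (iv m))]
    ring
  obtain ⟨b₀, hb₀⟩ := exists_thetaSeries_ne_zero τ
  obtain ⟨ω, hω, hωH⟩ := exists_const_mul_of_pow_four_eq
    (f := fun ζ => H (cv b₀ + ζ • μ)) (h := fun ζ => thetaSeries τ.1 0 (cv b₀ + ζ • μ))
    (by
      simp only [H]
      refine Differentiable.mul ?_ ?_
      · simp only [dotProduct]; fun_prop
      · have := differentiable_thetaSeries_line τ 0 (cv b₀ + (2⁻¹ : ℂ) • w) μ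
        simpa only [add_right_comm] using this)
    (differentiable_thetaSeries_line τ 0 (cv b₀) μ) (fun ζ => hH4 _)
  have h0 := hωH 0
  have h1 := hωH 1
  simp only [zero_smul, one_smul, add_zero] at h0 h1
  rw [hHμ, hθμ, h0] at h1
  have h2 : Complex.exp (-(Real.pi * Complex.I * (cv (iv m) ⬝ᵥ τ.1 *ᵥ cv (iv m) +
      2 * (cv (iv m) ⬝ᵥ cv b₀)))) * (ω * thetaSeries τ.1 0 (cv b₀)) = 0 := by
    linear_combination (-1 / 2 : ℂ) * h1
  simp [hω, hb₀] at h2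

/-! ### The symplectic action -/

namespace SiegelUpperHalfSpace

variable {g : ℕ} (τ : SiegelUpperHalfSpace g)

/-- The discriminant of t ↦ (x + tY⁻¹y)ᵗ Y (x + tY⁻¹y) is nonpositive. -/
theorem cauchy_schwarz_im (x y : Fin g → ℝ) :
    (x ⬝ᵥ y) ^ 2 ≤ (x ⬝ᵥ τ.1.map Complex.im *ᵥ x) * (y ⬝ᵥ (τ.1.map Complex.im)⁻¹ *ᵥ y) := by
  have h : ∀ t : ℝ, 0 ≤ (y ⬝ᵥ (τ.1.map Complex.im)⁻¹ *ᵥ y) * (t * t) +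
      (2 * (x ⬝ᵥ y)) * t + (x ⬝ᵥ τ.1.map Complex.im *ᵥ x) := by
    intro t
    have h1 := τ.im_quadratic_nonneg (x + t • ((τ.1.map Complex.im)⁻¹ *ᵥ y))
    simp only [Matrix.mulVec_add, Matrix.mulVec_smul, dotProduct_add, add_dotProduct,
      smul_dotProduct, dotProduct_smul, smul_eq_mul, τ.im_mulVec_im_inv] at h1
    rw [dotProduct_mulVec_symm τ.isSymm_im ((τ.1.map Complex.im)⁻¹ *ᵥ y) x, τ.im_mulVec_im_inv,
      dotProduct_comm ((τ.1.map Complex.im)⁻¹ *ᵥ y) y] at h1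
    linarith [dotProduct_comm x y]
  have := discrim_le_zero h
  rw [discrim] at this
  nlinarith

/-- The symplectic form is bounded by the norm form. -/
theorem symplectic_sq_le (a b a' b' : Fin g → ℝ) :
    (a ⬝ᵥ b' - a' ⬝ᵥ b) ^ 2 ≤ siegelForm τ.1 a b * siegelForm τ.1 a' b' := by
  set c := τ.1.map Complex.re *ᵥ a + b with hc
  set c' := τ.1.map Complex.re *ᵥ a' + b' with hc'
  -- The shear b ↦ Xa + b preserves the alternating form because X = Re τ is symmetric.
  have h0 : a ⬝ᵥ b' - a' ⬝ᵥ b = a ⬝ᵥ c' - a' ⬝ᵥ c := by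
    rw [hc, hc', dotProduct_add, dotProduct_add, dotProduct_mulVec_symm τ.isSymm_re a a']
    ring
  have h1 := τ.cauchy_schwarz_im a c'
  have h2 := τ.cauchy_schwarz_im a' c
  rw [h0, siegelForm, siegelForm, ← hc, ← hc']
  set α := a ⬝ᵥ τ.1.map Complex.im *ᵥ a
  set α' := a' ⬝ᵥ τ.1.map Complex.im *ᵥ a'
  set β := c ⬝ᵥ (τ.1.map Complex.im)⁻¹ *ᵥ c
  set β' := c' ⬝ᵥ (τ.1.map Complex.im)⁻¹ *ᵥ c'
  have hα : 0 ≤ α := τ.im_quadratic_nonneg _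
  have hα' : 0 ≤ α' := τ.im_quadratic_nonneg _
  have hβ : 0 ≤ β := τ.im_inv_quadratic_nonneg _
  have hβ' : 0 ≤ β' := τ.im_inv_quadratic_nonneg _
  set x := a ⬝ᵥ c'
  set y := a' ⬝ᵥ c
  have h3 : |x| ≤ √α * √β' := by
    rw [← Real.sqrt_mul hα, ← Real.sqrt_sq_eq_abs]
    exact Real.sqrt_le_sqrt h1
  have h4 : |y| ≤ √α' * √β := by
    rw [← Real.sqrt_mul hα', ← Real.sqrt_sq_eq_abs]
    exact Real.sqrt_le_sqrt h2
  have h5 : |x - y| ≤ √α * √β' + √α' * √β := (abs_sub _ _).trans (add_le_add h3 h4)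
  calc (x - y) ^ 2 = |x - y| ^ 2 := (sq_abs _).symm
    _ ≤ (√α * √β' + √α' * √β) ^ 2 := by gcongr
    _ ≤ (√α ^ 2 + √β ^ 2) * (√α' ^ 2 + √β' ^ 2) := by
        nlinarith [sq_nonneg (√α * √α' - √β * √β')]
    _ = _ := by rw [Real.sq_sqrt hα, Real.sq_sqrt hα', Real.sq_sqrt hβ, Real.sq_sqrt hβ']

end SiegelUpperHalfSpace

/-- Real matrices as complex matrices. -/
def cm {g : ℕ} (A : Matrix (Fin g) (Fin g) ℝ) : Matrix (Fin g) (Fin g) ℂ := A.map Complex.ofReal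

theorem cm_mul {g : ℕ} (A B : Matrix (Fin g) (Fin g) ℝ) : cm (A * B) = cm A * cm B :=
  Matrix.map_mul (f := Complex.ofRealHom)

theorem cm_sub {g : ℕ} (A B : Matrix (Fin g) (Fin g) ℝ) : cm (A - B) = cm A - cm B :=
  Matrix.map_sub _ Complex.ofReal_sub A B

theorem cm_one {g : ℕ} : cm (1 : Matrix (Fin g) (Fin g) ℝ) = 1 :=
  Matrix.map_one _ Complex.ofReal_zero Complex.ofReal_one

theorem cm_transpose {g : ℕ} (A : Matrix (Fin g) (Fin g) ℝ) : cm Aᵀ = (cm A)ᵀ := rfl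

theorem cm_conjTranspose {g : ℕ} (A : Matrix (Fin g) (Fin g) ℝ) : (cm A)ᴴ = (cm A)ᵀ := by
  ext i j; simp [cm]

theorem cm_mulVec {g : ℕ} (A : Matrix (Fin g) (Fin g) ℝ) (x : Fin g → ℝ) :
    cm A *ᵥ cv x = cv (A *ᵥ x) := mulVec_cv A x

theorem star_cv {g : ℕ} (x : Fin g → ℝ) : star (cv x) = cv x := by
  ext i; simp [cv]

theorem sub_conjTranspose_of_isSymm {g : ℕ} {τ : Matrix (Fin g) (Fin g) ℂ} (hτ : τ.IsSymm) :
    τ - τᴴ = (2 * Complex.I) • cm (τ.map Complex.im) := by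
  ext i j
  have : τ j i = τ i j := hτ.apply i j
  simp only [Matrix.sub_apply, Matrix.conjTranspose_apply, this, cm, Matrix.smul_apply,
    Matrix.map_apply, smul_eq_mul]
  apply Complex.ext <;> simp
  ring

theorem hermitian_quadratic {g : ℕ} {S : Matrix (Fin g) (Fin g) ℝ} (hS : S.IsSymm)
    (u v : Fin g → ℝ) : (cv u + Complex.I • cv v) ⬝ᵥ cm S *ᵥ star (cv u + Complex.I • cv v) =
      ((u ⬝ᵥ S *ᵥ u + v ⬝ᵥ S *ᵥ v : ℝ) : ℂ) := by
  rw [star_add, star_smul, star_cv, star_cv]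
  simp only [Matrix.mulVec_add, Matrix.mulVec_smul, dotProduct_add, add_dotProduct,
    smul_dotProduct, dotProduct_smul, smul_eq_mul, cm_mulVec, cv_dotProduct_cv,
    dotProduct_mulVec_symm hS v u]
  simp only [Complex.star_def, Complex.conj_I]
  push_cast
  linear_combination (-(v ⬝ᵥ S *ᵥ v : ℝ) : ℂ) * Complex.I_sq

theorem exists_cv_add_I_smul {g : ℕ} (z : Fin g → ℂ) :
    ∃ u v : Fin g → ℝ, z = cv u + Complex.I • cv v :=
  ⟨fun i => (z i).re, fun i => (z i).im, by ext i; simp [cv, mul_comm Complex.I]⟩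

theorem siegelForm_eq_hermitian {g : ℕ} (τ : SiegelUpperHalfSpace g) (a b : Fin g → ℝ) :
    ((siegelForm τ.1 a b : ℝ) : ℂ) =
      (τ.1 *ᵥ cv a + cv b) ⬝ᵥ cm (τ.1.map Complex.im)⁻¹ *ᵥ star (τ.1 *ᵥ cv a + cv b) := by
  have : τ.1 *ᵥ cv a + cv b = cv (τ.1.map Complex.re *ᵥ a + b) +
      Complex.I • cv (τ.1.map Complex.im *ᵥ a) := by
    rw [τ.mulVec_cv_eq, cv_add]
    abel
  rw [this, hermitian_quadratic τ.isSymm_im_inv, τ.im_inv_mulVec_im, siegelForm,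
    dotProduct_comm _ a, add_comm]

/-- The action of the real symplectic group on the Siegel space, with the cocycle relations. -/
theorem exists_symplectic_transform {g : ℕ} (τ : SiegelUpperHalfSpace g)
    {A B C D : Matrix (Fin g) (Fin g) ℝ}
    (h : Matrix.fromBlocks A B C D ∈ Matrix.symplecticGroup (Fin g) ℝ) :
    ∃ τ' : SiegelUpperHalfSpace g, (τ.1 * cm B + cm D) * τ'.1 = τ.1 * cm A + cm C ∧
      ∀ a b, siegelForm τ'.1 a b = siegelForm τ.1 (A *ᵥ a + B *ᵥ b) (C *ᵥ a + D *ᵥ b) := by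
  -- The relations between rows (ABᵀ = BAᵀ and so on) are needed, and these are the ones for the
  -- transposed matrix.
  have ht := SymplecticGroup.transpose_mem h
  rw [Matrix.fromBlocks_transpose, SymplecticGroup.fromBlocks_mem_iff] at ht
  simp only [Matrix.transpose_transpose] at ht
  obtain ⟨hAB, hCD, hAD⟩ := ht
  have hDA : D * Aᵀ - C * Bᵀ = 1 := by
    have := congrArg Matrix.transpose hAD
    simpa [Matrix.transpose_sub, Matrix.transpose_mul] using this
  have hABc : cm A * (cm B)ᵀ = cm B * (cm A)ᵀ := by
    rw [← cm_transpose, ← cm_transpose, ← cm_mul, ← cm_mul, hAB]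
  have hCDc : cm C * (cm D)ᵀ = cm D * (cm C)ᵀ := by
    rw [← cm_transpose, ← cm_transpose, ← cm_mul, ← cm_mul, hCD]
  have hADc : cm A * (cm D)ᵀ - cm B * (cm C)ᵀ = 1 := by
    rw [← cm_transpose, ← cm_transpose, ← cm_mul, ← cm_mul, ← cm_sub, hAD, cm_one]
  have hDAc : cm D * (cm A)ᵀ - cm C * (cm B)ᵀ = 1 := by
    rw [← cm_transpose, ← cm_transpose, ← cm_mul, ← cm_mul, ← cm_sub, hDA, cm_one]
  set R := τ.1 * cm B + cm D with hR
  set P := τ.1 * cm A + cm C with hP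
  set Y := τ.1.map Complex.im with hY
  have hτ : τ.1ᵀ = τ.1 := τ.2.1
  -- One identity for two purposes: σ = τ gives the symmetry of τ' = R⁻¹P, and σ = τᴴ gives the
  -- positivity of its imaginary part.
  have key : ∀ σ : Matrix (Fin g) (Fin g) ℂ,
      P * ((cm B)ᵀ * σ + (cm D)ᵀ) - R * ((cm A)ᵀ * σ + (cm C)ᵀ) = τ.1 - σ := by
    intro σ
    calc P * ((cm B)ᵀ * σ + (cm D)ᵀ) - R * ((cm A)ᵀ * σ + (cm C)ᵀ)
        = τ.1 * (cm A * (cm B)ᵀ - cm B * (cm A)ᵀ) * σ +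
          τ.1 * (cm A * (cm D)ᵀ - cm B * (cm C)ᵀ) - (cm D * (cm A)ᵀ - cm C * (cm B)ᵀ) * σ +
          (cm C * (cm D)ᵀ - cm D * (cm C)ᵀ) := by rw [hP, hR]; noncomm_ring
      _ = τ.1 - σ := by rw [hABc, hCDc, hADc, hDAc]; simp
  have hRT : Rᵀ = (cm B)ᵀ * τ.1 + (cm D)ᵀ := by
    rw [hR, Matrix.transpose_add, Matrix.transpose_mul, hτ]
  have hPT : Pᵀ = (cm A)ᵀ * τ.1 + (cm C)ᵀ := by
    rw [hP, Matrix.transpose_add, Matrix.transpose_mul, hτ]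
  have hRH : Rᴴ = (cm B)ᵀ * τ.1ᴴ + (cm D)ᵀ := by
    rw [hR, Matrix.conjTranspose_add, Matrix.conjTranspose_mul, cm_conjTranspose, cm_conjTranspose]
  have hPH : Pᴴ = (cm A)ᵀ * τ.1ᴴ + (cm C)ᵀ := by
    rw [hP, Matrix.conjTranspose_add, Matrix.conjTranspose_mul, cm_conjTranspose, cm_conjTranspose]
  have hsym : P * Rᵀ = R * Pᵀ := by
    have := key τ.1
    rw [← hRT, ← hPT, sub_self, sub_eq_zero] at this
    exact this
  have hherm : P * Rᴴ - R * Pᴴ = (2 * Complex.I) • cm Y := by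
    rw [hRH, hPH, key, sub_conjTranspose_of_isSymm τ.2.1]
  have hpos : ∀ x : Fin g → ℂ, x ≠ 0 → ∃ r : ℝ, 0 < r ∧ x ⬝ᵥ cm Y *ᵥ star x = (r : ℂ) := by
    intro x hx
    obtain ⟨u, v, rfl⟩ := exists_cv_add_I_smul x
    refine ⟨_, ?_, hermitian_quadratic τ.isSymm_im u v⟩
    by_contra hcon
    have hu := τ.im_quadratic_nonneg u
    have hv := τ.im_quadratic_nonneg v
    have hu0 : u = 0 := by
      by_contra hne
      have := τ.2.2.dotProduct_mulVec_pos hne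
      rw [star_trivial] at this
      linarith
    have hv0 : v = 0 := by
      by_contra hne
      have := τ.2.2.dotProduct_mulVec_pos hne
      rw [star_trivial] at this
      linarith
    exact hx (by simp [hu0, hv0])
  have hquad : ∀ x : Fin g → ℂ, (x ᵥ* P) ⬝ᵥ star (x ᵥ* R) - (x ᵥ* R) ⬝ᵥ star (x ᵥ* P) =
      (2 * Complex.I) * (x ⬝ᵥ cm Y *ᵥ star x) := by
    intro x
    rw [Matrix.star_vecMul, Matrix.star_vecMul, ← Matrix.dotProduct_mulVec,
      ← Matrix.dotProduct_mulVec, Matrix.mulVec_mulVec, Matrix.mulVec_mulVec, ← dotProduct_sub,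
      ← Matrix.sub_mulVec, hherm, Matrix.smul_mulVec, dotProduct_smul, smul_eq_mul]
  -- A row vector killed by R would make the left side of `hquad` vanish, against the definiteness
  -- of Y.
  have hRu : IsUnit R := by
    rw [← Matrix.vecMul_injective_iff_isUnit]
    intro x y hxy
    by_contra hne
    have h0 : (x - y) ᵥ* R = 0 := by
      rw [Matrix.sub_vecMul]; exact sub_eq_zero.2 hxy
    obtain ⟨r, hr, hr'⟩ := hpos (x - y) (sub_ne_zero.2 hne)
    have := hquad (x - y)
    rw [h0, hr'] at this
    simp [hr.ne'] at this
  have hRd : IsUnit R.det := (Matrix.isUnit_iff_isUnit_det _).1 hRu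
  set T := R⁻¹ * P with hT
  have hRT' : R * T = P := by rw [hT, Matrix.mul_nonsing_inv_cancel_left _ _ hRd]
  have hTsymm : T.IsSymm := by
    have h1 : R * (Tᵀ) * Rᵀ = R * T * Rᵀ := by
      rw [hRT', hsym, Matrix.mul_assoc, ← Matrix.transpose_mul, hRT']
    have hRtu : IsUnit Rᵀ := (Matrix.isUnit_transpose R).2 hRu
    exact hRu.mul_left_cancel (hRtu.mul_right_cancel h1)
  have hTH : R * (cm (T.map Complex.im)) * Rᴴ = cm Y := by
    have h1 : R * (T - Tᴴ) * Rᴴ = (2 * Complex.I) • cm Y := by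
      rw [← hherm, Matrix.mul_sub, Matrix.sub_mul, hRT', Matrix.mul_assoc,
        ← Matrix.conjTranspose_mul, hRT']
    rw [sub_conjTranspose_of_isSymm hTsymm, Matrix.mul_smul, Matrix.smul_mul] at h1
    exact smul_right_injective _ (mul_ne_zero two_ne_zero Complex.I_ne_zero) h1
  have hTpos : (T.map Complex.im).PosDef := by
    refine Matrix.PosDef.of_dotProduct_mulVec_pos ?_ fun x hx => ?_
    · rw [Matrix.IsHermitian, Matrix.conjTranspose_eq_transpose_of_trivial]
      exact hTsymm.map _
    · have hx' : cv x ≠ 0 := by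
        contrapose! hx
        ext i
        simpa [cv] using congrFun hx i
      obtain ⟨y, hy⟩ := ((Matrix.vecMul_surjective_iff_isUnit).2 hRu) (cv x)
      have hy0 : y ≠ 0 := by
        rintro rfl
        exact hx' (by rw [← hy]; simp)
      obtain ⟨r, hr, hr'⟩ := hpos y hy0
      have h1 : cv x ⬝ᵥ cm (T.map Complex.im) *ᵥ cv x = (r : ℂ) := by
        have hxy : cv x = y ᵥ* R := hy.symm
        have hsc : cv x = Rᴴ *ᵥ star y := by rw [← Matrix.star_vecMul, ← hxy, star_cv]
        rw [← hr', ← hTH]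
        calc cv x ⬝ᵥ cm (T.map Complex.im) *ᵥ cv x
            = (y ᵥ* R) ⬝ᵥ cm (T.map Complex.im) *ᵥ (Rᴴ *ᵥ star y) := by rw [← hsc, ← hxy]
          _ = _ := by
            rw [← Matrix.dotProduct_mulVec, Matrix.mulVec_mulVec, Matrix.mulVec_mulVec,
              Matrix.mul_assoc]
      rw [cm_mulVec, cv_dotProduct_cv] at h1
      rw [star_trivial, Complex.ofReal_injective h1]
      exact hr
  refine ⟨⟨T, hTsymm, hTpos⟩, hRT', fun a b => ?_⟩
  apply Complex.ofReal_injective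
  refine (siegelForm_eq_hermitian ⟨T, hTsymm, hTpos⟩ a b).trans
    (Eq.trans ?_ (siegelForm_eq_hermitian τ _ _).symm)
  set τ' : SiegelUpperHalfSpace g := ⟨T, hTsymm, hTpos⟩
  have hz : τ.1 *ᵥ cv (A *ᵥ a + B *ᵥ b) + cv (C *ᵥ a + D *ᵥ b) = R *ᵥ (T *ᵥ cv a + cv b) := by
    rw [Matrix.mulVec_add, Matrix.mulVec_mulVec, hRT', hR, hP]
    simp only [cv_add, ← cm_mulVec, Matrix.mulVec_add, Matrix.add_mulVec, Matrix.mulVec_mulVec]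
    abel
  rw [hz]
  have hinv : ∀ σ : SiegelUpperHalfSpace g, cm (σ.1.map Complex.im)⁻¹ * cm (σ.1.map Complex.im) = 1 :=
    fun σ => by rw [← cm_mul, Matrix.nonsing_inv_mul _ σ.isUnit_det_im, cm_one]
  have hYsymm : (cm Y)ᵀ = cm Y := by rw [← cm_transpose, τ.isSymm_im.eq]
  have hTsymm' : (cm (T.map Complex.im))ᵀ = cm (T.map Complex.im) := by
    rw [← cm_transpose, (hTsymm.map _).eq]
  have hTH' : Rᴴᵀ * cm (T.map Complex.im) * Rᵀ = cm Y := by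
    have := congrArg Matrix.transpose hTH
    rw [Matrix.transpose_mul, Matrix.transpose_mul, hTsymm', hYsymm] at this
    rw [Matrix.mul_assoc, this]
  -- Together with `hz`, which says that the point of τ is R times the point of τ', this identifies
  -- the two norm forms.
  have hmain : Rᵀ * cm Y⁻¹ * Rᴴᵀ = cm (T.map Complex.im)⁻¹ := by
    have h1 : (Rᵀ * cm Y⁻¹ * Rᴴᵀ) * cm (T.map Complex.im) * Rᵀ = 1 * Rᵀ := by
      rw [Matrix.mul_assoc, Matrix.mul_assoc, ← Matrix.mul_assoc (Rᴴᵀ), hTH', Matrix.mul_assoc,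
        hinv τ]
      simp
    have h2 := ((Matrix.isUnit_transpose R).2 hRu).mul_right_cancel h1
    have h3 := hinv τ'
    rw [← mul_one (Rᵀ * cm Y⁻¹ * Rᴴᵀ), ← mul_eq_one_comm.1 h3, ← Matrix.mul_assoc, h2, one_mul]
  change (T *ᵥ cv a + cv b) ⬝ᵥ cm (T.map Complex.im)⁻¹ *ᵥ star (T *ᵥ cv a + cv b) = _
  rw [← hmain]
  generalize T *ᵥ cv a + cv b = z
  rw [Matrix.star_mulVec, ← Matrix.mulVec_transpose, ← Matrix.mulVec_mulVec, ← Matrix.mulVec_mulVec,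
    Matrix.dotProduct_mulVec, Matrix.vecMul_transpose]

/-! ### The transformation formula -/

/-- The theta series normalized so that it depends on the symplectic structure only. -/
def symTheta {g : ℕ} (τ : Matrix (Fin g) (Fin g) ℂ) (a b : Fin g → ℝ) : ℂ :=
  Complex.exp (-(Real.pi * Complex.I * ((a ⬝ᵥ b : ℝ) : ℂ))) * thetaSeries τ a (cv b)

theorem symTheta_eq {g : ℕ} (τ : SiegelUpperHalfSpace g) (a b : Fin g → ℝ) :
    symTheta τ.1 a b = Complex.exp (Real.pi * Complex.I * (cv a ⬝ᵥ (τ.1 *ᵥ cv a + cv b))) *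
      thetaSeries τ.1 0 (τ.1 *ᵥ cv a + cv b) := by
  rw [symTheta, thetaSeries_eq_zero_char τ.2.1, ← mul_assoc, ← Complex.exp_add,
    add_comm (cv b) (τ.1 *ᵥ cv a), ← cv_dotProduct_cv, dotProduct_add]
  congr 2
  ring

theorem symTheta_add {g : ℕ} (τ : SiegelUpperHalfSpace g) (a b : Fin g → ℝ) (p q : Fin g → ℤ) :
    symTheta τ.1 (a + iv p) (b + iv q) = Complex.exp (Real.pi * Complex.I *
      ((a ⬝ᵥ iv q - iv p ⬝ᵥ b - iv p ⬝ᵥ iv q : ℝ) : ℂ)) * symTheta τ.1 a b := by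
  rw [symTheta, symTheta, cv_add, thetaSeries_add_left, thetaSeries_add_right, ← mul_assoc,
    ← mul_assoc, ← Complex.exp_add, ← Complex.exp_add]
  congr 2
  simp only [add_dotProduct, dotProduct_add]
  push_cast
  ring

theorem mulVec_dotProduct_mulVec {g : ℕ} {R : Type*} [CommRing R] (M N : Matrix (Fin g) (Fin g) R)
    (x y : Fin g → R) : (M *ᵥ x) ⬝ᵥ (N *ᵥ y) = x ⬝ᵥ (Mᵀ * N) *ᵥ y := by
  rw [← Matrix.mulVec_mulVec, Matrix.dotProduct_mulVec x, Matrix.vecMul_transpose]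

theorem dotProduct_mulVec_comm {g : ℕ} {R : Type*} [CommRing R] (M : Matrix (Fin g) (Fin g) R)
    (x y : Fin g → R) : x ⬝ᵥ M *ᵥ y = y ⬝ᵥ Mᵀ *ᵥ x := by
  rw [Matrix.dotProduct_mulVec, ← Matrix.mulVec_transpose, dotProduct_comm]

theorem symplectic_form_invariant {g : ℕ} {A B C D : Matrix (Fin g) (Fin g) ℝ}
    (h : Matrix.fromBlocks A B C D ∈ Matrix.symplecticGroup (Fin g) ℝ) (a b a' b' : Fin g → ℝ) :
    (A *ᵥ a + B *ᵥ b) ⬝ᵥ (C *ᵥ a' + D *ᵥ b') - (A *ᵥ a' + B *ᵥ b') ⬝ᵥ (C *ᵥ a + D *ᵥ b) =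
      a ⬝ᵥ b' - a' ⬝ᵥ b := by
  obtain ⟨h1, h2, h3⟩ := SymplecticGroup.fromBlocks_mem_iff.1 h
  have e1 : a' ⬝ᵥ (Aᵀ * C) *ᵥ a = a ⬝ᵥ (Aᵀ * C) *ᵥ a' := by
    rw [dotProduct_mulVec_comm, Matrix.transpose_mul, Matrix.transpose_transpose, h1]
  have e2 : b' ⬝ᵥ (Bᵀ * D) *ᵥ b = b ⬝ᵥ (Bᵀ * D) *ᵥ b' := by
    rw [dotProduct_mulVec_comm, Matrix.transpose_mul, Matrix.transpose_transpose, h2]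
  have e3 : ∀ x y : Fin g → ℝ, y ⬝ᵥ (Bᵀ * C) *ᵥ x = x ⬝ᵥ (Aᵀ * D) *ᵥ y - x ⬝ᵥ y := by
    intro x y
    rw [dotProduct_mulVec_comm, Matrix.transpose_mul, Matrix.transpose_transpose,
      show Cᵀ * B = Aᵀ * D - 1 by rw [← h3]; abel, Matrix.sub_mulVec, Matrix.one_mulVec,
      dotProduct_sub]
  simp only [add_dotProduct, dotProduct_add, mulVec_dotProduct_mulVec, e1, e2, e3]
  ring

/-- Integral matrices as real matrices. -/
def castMat {g : ℕ} (A : Matrix (Fin g) (Fin g) ℤ) : Matrix (Fin g) (Fin g) ℝ := A.map Int.cast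

theorem castMat_mulVec_iv {g : ℕ} (A : Matrix (Fin g) (Fin g) ℤ) (p : Fin g → ℤ) :
    castMat A *ᵥ iv p = iv (A *ᵥ p) := by
  ext i; simp [castMat, iv, Matrix.mulVec, dotProduct]

/-- Integral symplectic transformations that preserve the parity of the standard quadratic form
transform the normalized theta series by a constant factor. -/
theorem exists_symTheta_transform {g : ℕ} (τ : SiegelUpperHalfSpace g)
    {A B C D : Matrix (Fin g) (Fin g) ℤ}
    (h : Matrix.fromBlocks A B C D ∈ Matrix.symplecticGroup (Fin g) ℤ)
    (hpar : ∀ p q : Fin g → ℤ, Even ((A *ᵥ p + B *ᵥ q) ⬝ᵥ (C *ᵥ p + D *ᵥ q) - p ⬝ᵥ q)) :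
    ∃ (τ' : SiegelUpperHalfSpace g) (c : ℂ),
      (∀ a b, symTheta τ.1 (castMat A *ᵥ a + castMat B *ᵥ b) (castMat C *ᵥ a + castMat D *ᵥ b) =
        c * symTheta τ'.1 a b) ∧
      ∀ a b, siegelForm τ'.1 a b =
        siegelForm τ.1 (castMat A *ᵥ a + castMat B *ᵥ b) (castMat C *ᵥ a + castMat D *ᵥ b) := by
  have hr : Matrix.fromBlocks (castMat A) (castMat B) (castMat C) (castMat D) ∈ Matrix.symplecticGroup (Fin g) ℝ := by
    have := SymplecticGroup.map_mem h (Int.castRingHom ℝ)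
    rwa [Matrix.fromBlocks_map] at this
  obtain ⟨τ', hτ', hform⟩ := exists_symplectic_transform τ hr
  obtain ⟨-, h2, h3⟩ := SymplecticGroup.fromBlocks_mem_iff.1 hr
  have h2c : (cm (castMat B))ᵀ * cm (castMat D) = (cm (castMat D))ᵀ * cm (castMat B) := by
    rw [← cm_transpose, ← cm_transpose, ← cm_mul, ← cm_mul, h2]
  have h3c : (cm (castMat D))ᵀ * cm (castMat A) - (cm (castMat B))ᵀ * cm (castMat C) = 1 := by
    have := congrArg Matrix.transpose h3
    simp only [Matrix.transpose_sub, Matrix.transpose_mul, Matrix.transpose_transpose,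
      Matrix.transpose_one] at this
    rw [← cm_transpose, ← cm_transpose, ← cm_mul, ← cm_mul, ← cm_sub, this, cm_one]
  set R := τ.1 * cm (castMat B) + cm (castMat D) with hR
  set P := τ.1 * cm (castMat A) + cm (castMat C) with hP
  have hτ : τ.1ᵀ = τ.1 := τ.2.1
  have hRT : Rᵀ = (cm (castMat B))ᵀ * τ.1 + (cm (castMat D))ᵀ := by
    rw [hR, Matrix.transpose_add, Matrix.transpose_mul, hτ]
  have hRB : Rᵀ * cm (castMat B) = (cm (castMat B))ᵀ * R := by
    rw [hRT, hR, Matrix.add_mul, Matrix.mul_add, h2c, Matrix.mul_assoc]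
  have hE : Rᵀ * cm (castMat A) = 1 + Rᵀ * cm (castMat B) * τ'.1 := by
    rw [hRB, Matrix.mul_assoc, hτ', hRT, hP, ← h3c]
    noncomm_ring
  refine ⟨τ', ?_⟩
  -- The quadratic exponential absorbs the automorphy factor, so that f has the quasi-periods of the
  -- theta function of τ' and uniqueness applies.
  obtain ⟨f, hf⟩ : ∃ f : (Fin g → ℂ) → ℂ, f = fun z =>
      Complex.exp (Real.pi * Complex.I * (z ⬝ᵥ (Rᵀ * cm (castMat B)) *ᵥ z)) *
        thetaSeries τ.1 0 (R *ᵥ z) := ⟨_, rfl⟩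
  have hkey : ∀ a b, symTheta τ.1 (castMat A *ᵥ a + castMat B *ᵥ b) (castMat C *ᵥ a + castMat D *ᵥ b) =
      Complex.exp (Real.pi * Complex.I * (cv a ⬝ᵥ (τ'.1 *ᵥ cv a + cv b))) *
        f (τ'.1 *ᵥ cv a + cv b) := by
    intro a b
    set z := τ'.1 *ᵥ cv a + cv b with hz
    have hz2 : τ.1 *ᵥ cv (castMat A *ᵥ a + castMat B *ᵥ b) + cv (castMat C *ᵥ a + castMat D *ᵥ b) = R *ᵥ z := by
      rw [hz, Matrix.mulVec_add, Matrix.mulVec_mulVec, hτ', hR, hP]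
      simp only [cv_add, ← cm_mulVec, Matrix.mulVec_add, Matrix.add_mulVec, Matrix.mulVec_mulVec]
      abel
    have hv : Rᵀ *ᵥ cv (castMat A *ᵥ a + castMat B *ᵥ b) = cv a + (Rᵀ * cm (castMat B)) *ᵥ z := by
      rw [hz, cv_add, ← cm_mulVec, ← cm_mulVec, Matrix.mulVec_add, Matrix.mulVec_mulVec,
        Matrix.mulVec_mulVec, hE, Matrix.mulVec_add, Matrix.add_mulVec, Matrix.one_mulVec,
        Matrix.mulVec_mulVec, add_assoc]
    rw [symTheta_eq, hz2]
    simp only [hf]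
    rw [← mul_assoc, ← Complex.exp_add, dotProduct_mulVec_comm R, hv, dotProduct_comm z,
      dotProduct_comm z, add_dotProduct, dotProduct_comm (cv a) z]
    congr 2
    ring
  -- The alternating part of the phase is invariant under symplectic matrices; the remaining sign
  -- exp(πi p·q) is preserved by `hpar`.
  have hlattice : ∀ a b p q, Complex.exp (Real.pi * Complex.I * (cv (a + iv p) ⬝ᵥ
      (τ'.1 *ᵥ cv (a + iv p) + cv (b + iv q)))) * f (τ'.1 *ᵥ cv (a + iv p) + cv (b + iv q)) =
      Complex.exp (Real.pi * Complex.I * ((a ⬝ᵥ iv q - iv p ⬝ᵥ b - iv p ⬝ᵥ iv q : ℝ) : ℂ)) *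
      (Complex.exp (Real.pi * Complex.I * (cv a ⬝ᵥ (τ'.1 *ᵥ cv a + cv b))) *
        f (τ'.1 *ᵥ cv a + cv b)) := by
    intro a b p q
    rw [← hkey, ← hkey]
    simp only [Matrix.mulVec_add, castMat_mulVec_iv]
    rw [add_add_add_comm, add_add_add_comm (castMat C *ᵥ a), ← iv_add, ← iv_add, symTheta_add]
    have hinv := symplectic_form_invariant hr a b (iv p) (iv q)
    simp only [castMat_mulVec_iv, ← iv_add] at hinv
    congr 1
    rw [Complex.exp_eq_exp_iff_exists_int]
    obtain ⟨k, hk⟩ := hpar p q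
    refine ⟨-k, ?_⟩
    have hk' : iv (A *ᵥ p + B *ᵥ q) ⬝ᵥ iv (C *ᵥ p + D *ᵥ q) - iv p ⬝ᵥ iv q = k + k := by
      rw [iv_dotProduct_iv, iv_dotProduct_iv]
      exact_mod_cast congrArg (Int.cast : ℤ → ℝ) hk
    rw [hinv]
    have hk'' : iv (A *ᵥ p + B *ᵥ q) ⬝ᵥ iv (C *ᵥ p + D *ᵥ q) = iv p ⬝ᵥ iv q + (k + k) := by
      linarith
    rw [hk'']
    push_cast
    ring
  have hcoord : ∀ z : Fin g → ℂ, ∃ a b : Fin g → ℝ, z = τ'.1 *ᵥ cv a + cv b := by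
    intro z
    obtain ⟨a, b, hz, -⟩ := τ'.exists_real_coordinates z
    exact ⟨a, b, by rw [hz, add_comm]⟩
  have hf1 : Continuous f := by
    rw [hf]
    refine Continuous.mul ?_ ((continuous_thetaSeries τ 0).comp ?_)
    · simp only [dotProduct, Matrix.mulVec]; fun_prop
    · exact Continuous.matrix_mulVec continuous_const continuous_id
  have hf2 : ∀ z w : Fin g → ℂ, Differentiable ℂ fun ζ : ℂ => f (z + ζ • w) := by
    intro z w
    simp only [hf]
    refine Differentiable.mul ?_ ?_
    · simp only [dotProduct, Matrix.mulVec]; fun_prop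
    · have := differentiable_thetaSeries_line τ 0 (R *ᵥ z) (R *ᵥ w)
      simpa only [Matrix.mulVec_add, Matrix.mulVec_smul] using this
  have hf3 : ∀ z m, f (z + cv (iv m)) = f z := by
    intro z m
    obtain ⟨a, b, rfl⟩ := hcoord z
    have h4 := hlattice a b 0 m
    simp only [iv_zero, add_zero, zero_dotProduct, sub_zero] at h4
    rw [← mul_assoc, ← Complex.exp_add, cv_add, ← add_assoc] at h4
    have h5 : Complex.exp (Real.pi * Complex.I * (cv a ⬝ᵥ (τ'.1 *ᵥ cv a + cv b + cv (iv m)))) =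
        Complex.exp (Real.pi * Complex.I * ((a ⬝ᵥ iv m : ℝ) : ℂ) +
          Real.pi * Complex.I * (cv a ⬝ᵥ (τ'.1 *ᵥ cv a + cv b))) := by
      rw [dotProduct_add _ _ (cv (iv m)), cv_dotProduct_cv]
      congr 1
      ring
    rw [h5] at h4
    exact mul_left_cancel₀ (Complex.exp_ne_zero _) h4
  have hf4 : ∀ z p, f (z + τ'.1 *ᵥ cv (iv p)) = Complex.exp (-(Real.pi * Complex.I *
      (cv (iv p) ⬝ᵥ τ'.1 *ᵥ cv (iv p) + 2 * (cv (iv p) ⬝ᵥ z)))) * f z := by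
    intro z p
    obtain ⟨a, b, hz⟩ := hcoord z
    have h4 := hlattice a b p 0
    simp only [iv_zero, add_zero, dotProduct_zero, zero_sub, sub_zero] at h4
    have h5 : τ'.1 *ᵥ cv (a + iv p) + cv b = z + τ'.1 *ᵥ cv (iv p) := by
      rw [cv_add, Matrix.mulVec_add, hz]; abel
    rw [h5, ← hz, ← mul_assoc, ← Complex.exp_add] at h4
    refine mul_left_cancel₀ (Complex.exp_ne_zero (Real.pi * Complex.I *
      (cv (a + iv p) ⬝ᵥ (z + τ'.1 *ᵥ cv (iv p))))) ?_
    rw [h4, ← mul_assoc, ← Complex.exp_add]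
    congr 2
    have h6 : cv (iv p) ⬝ᵥ z = cv a ⬝ᵥ τ'.1 *ᵥ cv (iv p) + ((iv p ⬝ᵥ b : ℝ) : ℂ) := by
      rw [hz, dotProduct_add, cv_dotProduct_cv, dotProduct_mulVec_symm τ'.2.1]
    simp only [cv_add, add_dotProduct, dotProduct_add]
    push_cast
    linear_combination (Real.pi * Complex.I : ℂ) * h6
  obtain ⟨c, hc⟩ := eq_const_mul_thetaSeries τ' hf1 hf2 hf3 hf4
  refine ⟨c, fun a b => ?_, hform⟩
  rw [hkey, symTheta_eq, hc]
  ring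

/-! ### Congruence subgroups fix the theta constants -/

theorem exp_pi_mul_real_even {x : ℝ} (k : ℤ) (hx : x = 2 * k) :
    Complex.exp (Real.pi * Complex.I * (x : ℂ)) = 1 := by
  rw [hx, Complex.exp_eq_one_iff]
  exact ⟨k, by push_cast; ring⟩

theorem one_add_smul_mulVec_add {g : ℕ} (N : ℤ) (A B : Matrix (Fin g) (Fin g) ℤ)
    (p q : Fin g → ℤ) :
    (1 + N • A) *ᵥ p + (N • B) *ᵥ q = p + N • (A *ᵥ p + B *ᵥ q) := by
  rw [Matrix.add_mulVec, Matrix.one_mulVec, Matrix.smul_mulVec, Matrix.smul_mulVec, smul_add,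
    add_assoc]

theorem castMat_one_add_smul_mulVec_add {g : ℕ} (N : ℤ) (A B : Matrix (Fin g) (Fin g) ℤ)
    (a b : Fin g → ℝ) :
    castMat (1 + N • A) *ᵥ a + castMat (N • B) *ᵥ b =
      a + (N : ℝ) • (castMat A *ᵥ a + castMat B *ᵥ b) := by
  have h1 : castMat (1 + N • A) = 1 + (N : ℝ) • castMat A := by
    ext i j
    by_cases hij : i = j <;> simp [castMat, hij, -zsmul_eq_mul]
  have h2 : castMat (N • B) = (N : ℝ) • castMat B := by
    ext i j; simp [castMat, -zsmul_eq_mul]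
  rw [h1, h2, Matrix.add_mulVec, Matrix.one_mulVec, Matrix.smul_mulVec, Matrix.smul_mulVec,
    smul_add, add_assoc]

/-- Symplectic matrices congruent to `1` modulo `2 ^ (2 n + 2)` transform all theta constants whose
characteristics lie in `2 ^ (-n) ℤ` by a common factor. -/
theorem exists_thetaSeries_proportional {g : ℕ} (n : ℕ) (τ : SiegelUpperHalfSpace g)
    {A B C D : Matrix (Fin g) (Fin g) ℤ}
    (h : Matrix.fromBlocks (1 + (2 ^ (2 * n + 2) : ℤ) • A) ((2 ^ (2 * n + 2) : ℤ) • B)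
      ((2 ^ (2 * n + 2) : ℤ) • C) (1 + (2 ^ (2 * n + 2) : ℤ) • D) ∈
        Matrix.symplecticGroup (Fin g) ℤ) :
    ∃ (τ' : SiegelUpperHalfSpace g) (c : ℂ),
      (∀ a₀ b₀ : Fin g → ℤ, thetaSeries τ.1 (((2 ^ n : ℝ)⁻¹) • iv a₀) (cv (((2 ^ n : ℝ)⁻¹) • iv b₀))
        = c * thetaSeries τ'.1 (((2 ^ n : ℝ)⁻¹) • iv a₀) (cv (((2 ^ n : ℝ)⁻¹) • iv b₀))) ∧
      ∀ a b, siegelForm τ'.1 a b =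
        siegelForm τ.1 (castMat (1 + (2 ^ (2 * n + 2) : ℤ) • A) *ᵥ a +
            castMat ((2 ^ (2 * n + 2) : ℤ) • B) *ᵥ b)
          (castMat ((2 ^ (2 * n + 2) : ℤ) • C) *ᵥ a +
            castMat (1 + (2 ^ (2 * n + 2) : ℤ) • D) *ᵥ b) := by
  have hpar : ∀ p q : Fin g → ℤ, Even (((1 + (2 ^ (2 * n + 2) : ℤ) • A) *ᵥ p +
      ((2 ^ (2 * n + 2) : ℤ) • B) *ᵥ q) ⬝ᵥ (((2 ^ (2 * n + 2) : ℤ) • C) *ᵥ p +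
      (1 + (2 ^ (2 * n + 2) : ℤ) • D) *ᵥ q) - p ⬝ᵥ q) := by
    intro p q
    rw [one_add_smul_mulVec_add, add_comm (((2 ^ (2 * n + 2) : ℤ) • C) *ᵥ p),
      one_add_smul_mulVec_add]
    generalize A *ᵥ p + B *ᵥ q = x
    generalize D *ᵥ q + C *ᵥ p = y
    simp only [add_dotProduct, dotProduct_add, smul_dotProduct, dotProduct_smul, smul_eq_mul]
    refine ⟨2 ^ (2 * n + 1) * (x ⬝ᵥ q + p ⬝ᵥ y + 2 ^ (2 * n + 2) * (x ⬝ᵥ y)), ?_⟩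
    rw [pow_succ]
    ring
  obtain ⟨τ', c, h1, h2⟩ := exists_symTheta_transform τ h hpar
  refine ⟨τ', c, fun a₀ b₀ => ?_, h2⟩
  set a := ((2 ^ n : ℝ)⁻¹) • iv a₀ with ha
  set b := ((2 ^ n : ℝ)⁻¹) • iv b₀ with hb
  -- Multiplying a vector in 2^(-n)ℤ by 2^(2n+2) leaves a factor 2^(n+2), so the characteristic
  -- moves by an integral vector.
  have hshift : ∀ (M M' : Matrix (Fin g) (Fin g) ℤ) (x y : Fin g → ℤ),
      ((2 ^ (2 * n + 2) : ℤ) : ℝ) • (castMat M *ᵥ ((2 ^ n : ℝ)⁻¹ • iv x) +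
        castMat M' *ᵥ ((2 ^ n : ℝ)⁻¹ • iv y)) =
      iv ((2 ^ (n + 2) : ℤ) • (M *ᵥ x + M' *ᵥ y)) := by
    intro M M' x y
    have h0 : (2 : ℝ) ^ n ≠ 0 := by positivity
    rw [Matrix.mulVec_smul, Matrix.mulVec_smul, castMat_mulVec_iv, castMat_mulVec_iv, ← smul_add,
      smul_smul, ← iv_add, iv_smul]
    congr 1
    push_cast
    field_simp
    ring
  have h3 := h1 a b
  rw [castMat_one_add_smul_mulVec_add, add_comm (castMat ((2 ^ (2 * n + 2) : ℤ) • C) *ᵥ a),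
    castMat_one_add_smul_mulVec_add, ha, hb, hshift, hshift, symTheta_add] at h3
  generalize A *ᵥ a₀ + B *ᵥ b₀ = p at h3
  generalize D *ᵥ b₀ + C *ᵥ a₀ = q at h3
  have h0 : (2 : ℝ) ^ n ≠ 0 := by positivity
  -- Paired with the denominator 2^n, the remaining factor 2^(n+2) still gives multiples of 4, so
  -- the phase is 1.
  rw [exp_pi_mul_real_even (2 * (a₀ ⬝ᵥ q) - 2 * (p ⬝ᵥ b₀) - 2 ^ (2 * n + 3) * (p ⬝ᵥ q)) (by
      simp only [iv_smul, smul_dotProduct, dotProduct_smul, iv_dotProduct_iv, smul_eq_mul]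
      push_cast
      field_simp
      ring), one_mul, symTheta, symTheta, mul_left_comm] at h3
  exact mul_left_cancel₀ (Complex.exp_ne_zero _) h3

/-! ### Short vectors of unimodular lattices without very short vectors -/

theorem exists_orthogonal_matrix_row {ι : Type*} [Fintype ι] [DecidableEq ι] (i₀ : ι)
    {u : ι → ℝ} (hu : u ⬝ᵥ u = 1) : ∃ O : Matrix ι ι ℝ, O * Oᵀ = 1 ∧ O i₀ = u := by
  have hnorm : ‖WithLp.toLp 2 u‖ = 1 := by
    rw [EuclideanSpace.norm_eq, Real.sqrt_eq_one, ← hu]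
    simp [dotProduct, sq]
  obtain ⟨b, hb⟩ := Orthonormal.exists_orthonormalBasis_extension_of_card_eq
    (𝕜 := ℝ) (E := EuclideanSpace ℝ ι) (ι := ι) (by simp)
    (v := fun _ => WithLp.toLp 2 u) (s := {i₀}) (by
      rw [orthonormal_iff_ite]
      rintro ⟨i, rfl⟩ ⟨j, rfl⟩
      simp [Set.domRestrict, hnorm])
  refine ⟨Matrix.of fun i j => b i j, ?_, ?_⟩
  · ext i j
    have := orthonormal_iff_ite.1 b.orthonormal j i
    rw [Matrix.mul_apply, Matrix.one_apply]
    simp only [PiLp.inner_apply, RCLike.inner_apply, conj_trivial] at this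
    simp only [Matrix.of_apply, Matrix.transpose_apply, eq_comm (a := i), ← this]
  · have := hb i₀ rfl
    ext j
    simp [this]

/-- Minkowski's theorem for the box defined by a unimodular system of linear forms. -/
theorem exists_int_vector_in_box {ι : Type*} [Fintype ι] [DecidableEq ι] (T : Matrix ι ι ℝ)
    (hT : |T.det| = 1) (r : ι → ℝ) (hr : ∀ i, 0 ≤ r i) (hprod : 1 < ∏ i, r i) :
    ∃ x : ι → ℤ, x ≠ 0 ∧ ∀ i, |(T *ᵥ fun j => (x j : ℝ)) i| ≤ r i := by
  let s : Set (ι → ℝ) := Matrix.toLin' T ⁻¹' Set.pi Set.univ fun i => Set.Icc (-r i) (r i)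
  have hdet : LinearMap.det (Matrix.toLin' T) = T.det := LinearMap.det_toLin' T
  have hT0 : T.det ≠ 0 := by
    intro h; rw [h, abs_zero] at hT; exact zero_ne_one hT
  have hvol : MeasureTheory.volume s = ENNReal.ofReal (∏ i, (2 * r i)) := by
    rw [MeasureTheory.Measure.addHaar_preimage_linearMap _ (by rwa [hdet]), hdet, abs_inv, hT,
      inv_one, ENNReal.ofReal_one, one_mul, MeasureTheory.volume_pi, MeasureTheory.Measure.pi_pi,
      ENNReal.ofReal_prod_of_nonneg fun i _ => by linarith [hr i]]
    refine Finset.prod_congr rfl fun i _ => ?_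
    rw [Real.volume_Icc]
    congr 1; ring
  have hsymm : ∀ x ∈ s, -x ∈ s := by
    intro x hx i hi
    have := hx i hi
    simp only [map_neg, Pi.neg_apply, Set.mem_Icc] at this ⊢
    constructor <;> linarith [this.1, this.2]
  have hconv : Convex ℝ s :=
    (convex_pi fun i _ => convex_Icc _ _).linear_preimage _
  have hfund := ZSpan.isAddFundamentalDomain' (Pi.basisFun ℝ ι) MeasureTheory.volume
  have : Countable (Submodule.span ℤ (Set.range (Pi.basisFun ℝ ι))).toAddSubgroup :=
    inferInstanceAs (Countable (Submodule.span ℤ (Set.range (Pi.basisFun ℝ ι))))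
  obtain ⟨⟨x, hxL⟩, hx0, hxs⟩ :=
    MeasureTheory.exists_ne_zero_mem_lattice_of_measure_mul_two_pow_lt_measure hfund hsymm hconv (by
      rw [hvol, ZSpan.fundamentalDomain_pi_basisFun, MeasureTheory.volume_pi,
        MeasureTheory.Measure.pi_pi]
      simp only [Real.volume_Ico, sub_zero, ENNReal.ofReal_one, Finset.prod_const_one, one_mul,
        Module.finrank_fintype_fun_eq_card, Finset.prod_mul_distrib, Finset.prod_const,
        Finset.card_univ]
      rw [show (2 : ENNReal) ^ Fintype.card ι = ENNReal.ofReal (2 ^ Fintype.card ι) by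
        rw [ENNReal.ofReal_pow (by norm_num), ENNReal.ofReal_ofNat]]
      refine (ENNReal.ofReal_lt_ofReal_iff (by positivity)).2 ?_
      exact lt_mul_of_one_lt_right (by positivity) hprod)
  have hint : ∀ i, ∃ k : ℤ, (k : ℝ) = x i := by
    have := ((Pi.basisFun ℝ ι).mem_span_iff_repr_mem ℤ x).1 hxL
    simpa using this
  choose k hk using hint
  have hkx : (fun j => (k j : ℝ)) = x := funext hk
  refine ⟨k, ?_, fun i => ?_⟩
  · rintro rfl
    apply hx0
    ext i
    simp [← hkx]
  · rw [hkx]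
    exact abs_le.2 (hxs i trivial)

/-- If a unimodular lattice has no very short vectors, then it is spanned by vectors of bounded
length. -/
theorem exists_bound_span_short_vectors (ι : Type*) [Fintype ι] [DecidableEq ι] {c : ℝ}
    (hc : 0 < c) : ∃ K : ℝ, ∀ R : Matrix ι ι ℝ, |R.det| = 1 →
      (∀ x : ι → ℤ, x ≠ 0 →
        c ≤ (R *ᵥ fun i => (x i : ℝ)) ⬝ᵥ (R *ᵥ fun i => (x i : ℝ))) →
      Submodule.span ℝ {v : ι → ℝ | ∃ x : ι → ℤ, v = (fun i => (x i : ℝ)) ∧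
        (R *ᵥ v) ⬝ᵥ (R *ᵥ v) ≤ K} = ⊤ := by
  set m := Fintype.card ι with hm
  -- r is small enough that a box with all half-sides r contains only vectors of square length below
  -- c.
  set r := Real.sqrt (c / (m + 1)) with hr
  have hr2 : r ^ 2 = c / (m + 1) := Real.sq_sqrt (by positivity)
  have hr0 : 0 < r := Real.sqrt_pos.2 (by positivity)
  have hmr : m * r ^ 2 < c := by
    rw [hr2, ← mul_div_assoc, div_lt_iff₀ (by positivity)]
    nlinarith
  -- One side is stretched by t so that the product of the half-sides is r^m t = 2 > 1, as
  -- Minkowski's theorem requires.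
  set t := 2 / r ^ m with ht
  have ht0 : 0 < t := by positivity
  refine ⟨m * (r ^ 2 + (r * t) ^ 2), fun R hR hmin => ?_⟩
  by_contra hV
  set V := Submodule.span ℝ {v : ι → ℝ | ∃ x : ι → ℤ, v = (fun i => (x i : ℝ)) ∧
        (R *ᵥ v) ⬝ᵥ (R *ᵥ v) ≤ m * (r ^ 2 + (r * t) ^ 2)} with hVdef
  have hR0 : IsUnit R.det := by
    rw [isUnit_iff_ne_zero]
    intro h; rw [h, abs_zero] at hR; exact zero_ne_one hR
  obtain ⟨f, hf0, hfV⟩ := Submodule.exists_le_ker_of_lt_top V (lt_top_iff_ne_top.2 hV)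
  obtain ⟨w, hw⟩ : ∃ w : ι → ℝ, ∀ x, f x = w ⬝ᵥ (R *ᵥ x) := by
    refine ⟨fun i => f (R⁻¹ *ᵥ Pi.single i 1), fun x => ?_⟩
    have h1 : x = R⁻¹ *ᵥ (R *ᵥ x) := by
      rw [Matrix.mulVec_mulVec, Matrix.nonsing_inv_mul _ hR0, Matrix.one_mulVec]
    conv_lhs => rw [h1]
    generalize R *ᵥ x = y
    have h2 := LinearMap.pi_apply_eq_sum_univ (f ∘ₗ Matrix.mulVecLin R⁻¹) y
    rw [LinearMap.comp_apply, Matrix.mulVecLin_apply] at h2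
    rw [h2, dotProduct]
    refine Finset.sum_congr rfl fun i _ => ?_
    rw [smul_eq_mul, mul_comm]
    simp only [LinearMap.comp_apply, Matrix.mulVecLin_apply]
    congr 3
    ext j
    simp [Pi.single_apply, eq_comm]
  have hw0 : w ≠ 0 := by
    rintro rfl
    exact hf0 (LinearMap.ext fun x => by simp [hw])
  obtain ⟨i₀⟩ : Nonempty ι := by
    by_contra h
    rw [not_nonempty_iff] at h
    exact hw0 (Subsingleton.elim _ _)
  have hww : 0 < w ⬝ᵥ w := by
    refine lt_of_le_of_ne (Finset.sum_nonneg fun i _ => mul_self_nonneg (w i)) fun h => hw0 ?_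
    exact dotProduct_self_eq_zero.1 h.symm
  set u := (Real.sqrt (w ⬝ᵥ w))⁻¹ • w with hu
  have huu : u ⬝ᵥ u = 1 := by
    rw [hu, smul_dotProduct, dotProduct_smul, smul_eq_mul, smul_eq_mul, ← mul_assoc, ← mul_inv,
      Real.mul_self_sqrt hww.le, inv_mul_cancel₀ hww.ne']
  obtain ⟨O, hO, hOu⟩ := exists_orthogonal_matrix_row i₀ huu
  have hO' : Oᵀ * O = 1 := mul_eq_one_comm.1 hO
  have hOdet : |O.det| = 1 := by
    have := congrArg Matrix.det hO
    rw [Matrix.det_mul, Matrix.det_transpose, Matrix.det_one] at this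
    exact (mul_self_eq_one_iff.1 this).elim (fun h => by rw [h, abs_one])
      (fun h => by rw [h, abs_neg, abs_one])
  -- The long side points along the normal u of a hyperplane containing the span. The vector found
  -- is short enough to lie in the span, so its u-coordinate is 0, and the other coordinates force
  -- its square length below c.
  obtain ⟨x, hx0, hx⟩ := exists_int_vector_in_box (O * R) (by rw [Matrix.det_mul, abs_mul, hOdet, hR,
    one_mul]) (fun i => r * if i = i₀ then t else 1)
    (fun i => mul_nonneg hr0.le (by split_ifs <;> positivity)) (by
      rw [Finset.prod_mul_distrib, Finset.prod_const, Finset.prod_ite_eq' , if_pos (Finset.mem_univ _),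
        Finset.card_univ, ← hm, ht, show r ^ m * (2 / r ^ m) = 2 by field_simp]
      norm_num)
  have hnorm : (R *ᵥ fun i => (x i : ℝ)) ⬝ᵥ (R *ᵥ fun i => (x i : ℝ)) =
      ∑ i, ((O * R) *ᵥ fun j => (x j : ℝ)) i ^ 2 := by
    rw [← Matrix.mulVec_mulVec]
    generalize (R *ᵥ fun i => (x i : ℝ)) = y
    have : y ⬝ᵥ y = (O *ᵥ y) ⬝ᵥ (O *ᵥ y) := by
      rw [Matrix.dotProduct_mulVec, ← Matrix.mulVec_transpose, Matrix.mulVec_mulVec, hO',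
        Matrix.one_mulVec]
    rw [this, dotProduct]
    simp only [sq]
  have hxV : (fun i => (x i : ℝ)) ∈ V := by
    refine Submodule.subset_span ⟨x, rfl, ?_⟩
    rw [hnorm]
    refine (Finset.sum_le_card_nsmul _ _ (r ^ 2 + (r * t) ^ 2) fun i _ => ?_).trans_eq (by
      rw [Finset.card_univ, ← hm, nsmul_eq_mul])
    have := sq_le_sq' (abs_le.1 (hx i)).1 (abs_le.1 (hx i)).2
    refine this.trans ?_
    split_ifs
    · nlinarith [sq_nonneg r]
    · nlinarith [sq_nonneg (r * t)]
  have hzero : ((O * R) *ᵥ fun j => (x j : ℝ)) i₀ = 0 := by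
    have h1 := hfV hxV
    rw [LinearMap.mem_ker, hw] at h1
    rw [← Matrix.mulVec_mulVec, Matrix.mulVec, hOu, hu, smul_dotProduct, h1, smul_zero]
  refine absurd (hmin x hx0) (not_le.2 (lt_of_le_of_lt ?_ hmr))
  rw [hnorm]
  refine (Finset.sum_le_card_nsmul _ _ (r ^ 2) fun i _ => ?_).trans_eq (by
      rw [Finset.card_univ, ← hm, nsmul_eq_mul])
  by_cases hi : i = i₀
  · rw [hi, hzero]; nlinarith [sq_nonneg r]
  · have := sq_le_sq' (abs_le.1 (hx i)).1 (abs_le.1 (hx i)).2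
    simpa [hi] using this

/-! ### Bounded representatives modulo congruence subgroups -/

open scoped MatrixOrder Matrix.Norms.L2Operator in
theorem exists_eq_transpose_mul_self {ι : Type*} [Fintype ι] [DecidableEq ι] {S : Matrix ι ι ℝ}
    (hS : S.PosDef) : ∃ W : Matrix ι ι ℝ, S = Wᵀ * W := by
  obtain ⟨W, hW⟩ := CStarAlgebra.nonneg_iff_eq_star_mul_self.1 hS.posSemidef.nonneg
  exact ⟨W, by rw [hW, Matrix.star_eq_conjTranspose, Matrix.conjTranspose_eq_transpose_of_trivial]⟩

/-- `siegelForm` on the whole space `ℝ^{2g}`. -/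
def siegelQuad {g : ℕ} (τ : SiegelUpperHalfSpace g) (x : Fin g ⊕ Fin g → ℝ) : ℝ :=
  siegelForm τ.1 (x ∘ Sum.inl) (x ∘ Sum.inr)

/-- Integral vectors as real vectors, for an arbitrary index type. -/
def castVec {ι : Type*} (x : ι → ℤ) : ι → ℝ := fun i => (x i : ℝ)

/-- Factoring Y = WᵀW makes the form the square length for a block triangular matrix with diagonal
blocks W and (W⁻¹)ᵀ; the integral lattice thus becomes unimodular. -/
theorem exists_siegelQuad_eq_dotProduct {g : ℕ} (τ : SiegelUpperHalfSpace g) :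
    ∃ R : Matrix (Fin g ⊕ Fin g) (Fin g ⊕ Fin g) ℝ, |R.det| = 1 ∧
      ∀ x, siegelQuad τ x = (R *ᵥ x) ⬝ᵥ (R *ᵥ x) := by
  obtain ⟨W, hW⟩ := exists_eq_transpose_mul_self τ.2.2
  have hdetY : IsUnit (τ.1.map Complex.im).det := τ.isUnit_det_im
  have hWu : IsUnit W.det := by
    rw [hW, Matrix.det_mul] at hdetY
    exact isUnit_of_mul_isUnit_right hdetY
  refine ⟨Matrix.fromBlocks W 0 ((W⁻¹)ᵀ * τ.1.map Complex.re) (W⁻¹)ᵀ, ?_, fun x => ?_⟩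
  · rw [Matrix.det_fromBlocks_zero₁₂, Matrix.det_transpose, ← Matrix.det_mul,
      Matrix.mul_nonsing_inv _ hWu, Matrix.det_one, abs_one]
  · have hx : x = Sum.elim (x ∘ Sum.inl) (x ∘ Sum.inr) := (Sum.elim_comp_inl_inr x).symm
    have hinv : (τ.1.map Complex.im)⁻¹ = W⁻¹ * (W⁻¹)ᵀ := by
      rw [hW, Matrix.mul_inv_rev, Matrix.transpose_nonsing_inv]
    rw [siegelQuad, siegelForm, hinv, hW]
    conv_rhs => rw [hx, Matrix.fromBlocks_mulVec]
    rw [sumElim_dotProduct_sumElim]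
    simp only [Sum.elim_comp_inl, Sum.elim_comp_inr, Matrix.zero_mulVec, add_zero]
    rw [← Matrix.mulVec_mulVec (x ∘ Sum.inl) (W⁻¹)ᵀ, ← Matrix.mulVec_add,
      mulVec_dotProduct_mulVec, mulVec_dotProduct_mulVec, Matrix.transpose_transpose]

theorem siegelQuad_mulVec_le {g : ℕ} (τ : SiegelUpperHalfSpace g)
    (U : Matrix (Fin g ⊕ Fin g) (Fin g ⊕ Fin g) ℝ) {K : ℝ}
    (hU : ∀ j, siegelQuad τ (fun i => U i j) ≤ K) (t : Fin g ⊕ Fin g → ℝ) :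
    siegelQuad τ (U *ᵥ t) ≤ Fintype.card (Fin g ⊕ Fin g) * (K * (t ⬝ᵥ t)) := by
  obtain ⟨R, -, hR⟩ := exists_siegelQuad_eq_dotProduct τ
  have h1 : ∀ i, (R *ᵥ (U *ᵥ t)) i = ∑ k, t k * (R *ᵥ fun i => U i k) i := by
    intro i
    rw [Matrix.mulVec_mulVec]
    simp only [Matrix.mulVec, dotProduct, Matrix.mul_apply]
    exact Finset.sum_congr rfl fun k _ => mul_comm _ _
  calc siegelQuad τ (U *ᵥ t) = ∑ i, (∑ k, t k * (R *ᵥ fun i => U i k) i) ^ 2 := by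
        rw [hR, dotProduct]
        exact Finset.sum_congr rfl fun i _ => by rw [h1, sq]
    _ ≤ ∑ i, Fintype.card (Fin g ⊕ Fin g) * ∑ k, (t k * (R *ᵥ fun i => U i k) i) ^ 2 :=
        Finset.sum_le_sum fun i _ => sq_sum_le_card_mul_sum_sq
    _ = Fintype.card (Fin g ⊕ Fin g) * ∑ k, t k ^ 2 * siegelQuad τ fun i => U i k := by
        rw [← Finset.mul_sum, Finset.sum_comm]
        congr 1
        refine Finset.sum_congr rfl fun k _ => ?_
        rw [hR, dotProduct, Finset.mul_sum]
        exact Finset.sum_congr rfl fun i _ => by ring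
    _ ≤ Fintype.card (Fin g ⊕ Fin g) * ∑ k, t k ^ 2 * K := by
        gcongr with k
        exact hU k
    _ = _ := by
        rw [← Finset.sum_mul, mul_comm K, dotProduct]
        simp only [sq]

/-- If the form of `τ` takes no small values on nonzero integral vectors, there are linearly
independent integral vectors on which it is bounded. -/
theorem exists_int_matrix_siegelQuad_le (g : ℕ) {c : ℝ} (hc : 0 < c) :
    ∃ K : ℝ, ∀ τ : SiegelUpperHalfSpace g,
      (∀ x : Fin g ⊕ Fin g → ℤ, x ≠ 0 → c ≤ siegelQuad τ (castVec x)) →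
      ∃ U : Matrix (Fin g ⊕ Fin g) (Fin g ⊕ Fin g) ℤ, U.det ≠ 0 ∧
        ∀ j, siegelQuad τ (castVec fun i => U i j) ≤ K := by
  obtain ⟨K, hK⟩ := exists_bound_span_short_vectors (Fin g ⊕ Fin g) hc
  refine ⟨K, fun τ hτ => ?_⟩
  obtain ⟨R, hdet, hR⟩ := exists_siegelQuad_eq_dotProduct τ
  have hspan := hK R hdet fun x hx => (hτ x hx).trans_eq (hR _)
  obtain ⟨b, hbs, hbspan, hbli⟩ := exists_linearIndependent ℝ
    {v : Fin g ⊕ Fin g → ℝ | ∃ x : Fin g ⊕ Fin g → ℤ, v = (fun i => (x i : ℝ)) ∧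
        (R *ᵥ v) ⬝ᵥ (R *ᵥ v) ≤ K}
  let B : Module.Basis b ℝ (Fin g ⊕ Fin g → ℝ) := Module.Basis.mk hbli (by
    rw [Subtype.range_coe, hbspan, hspan])
  let e := B.indexEquiv (Pi.basisFun ℝ (Fin g ⊕ Fin g))
  have hmem : ∀ j, ∃ x : Fin g ⊕ Fin g → ℤ, ((e.symm j : b) : Fin g ⊕ Fin g → ℝ) = castVec x ∧
      siegelQuad τ (castVec x) ≤ K := by
    intro j
    obtain ⟨x, hx, hxK⟩ := hbs (e.symm j).2
    refine ⟨x, hx, ?_⟩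
    rw [hx] at hxK
    exact (hR _).trans_le hxK
  choose u hu huK using hmem
  refine ⟨Matrix.of fun i j => u j i, ?_, huK⟩
  have hli : LinearIndependent ℝ (Matrix.of fun i j => (u i j : ℝ)).row := by
    have hrow : (Matrix.of fun i j => (u i j : ℝ)).row = Subtype.val ∘ e.symm :=
      funext fun i => (hu i).symm
    rw [hrow]
    exact hbli.comp e.symm e.symm.injective
  have hunit := (Matrix.linearIndependent_rows_iff_isUnit.1 hli)
  rw [Matrix.isUnit_iff_isUnit_det, isUnit_iff_ne_zero, ← Matrix.det_transpose] at hunit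
  intro h0
  apply hunit
  have := congrArg (Int.cast : ℤ → ℝ) h0
  rw [Int.cast_det, Int.cast_zero] at this
  rw [← this]
  rfl

theorem exists_finite_representatives {α β : Type*} {P : Set α} {key : α → β}
    (h : (key '' P).Finite) :
    ∃ F : Set α, F.Finite ∧ F ⊆ P ∧ ∀ u ∈ P, ∃ v ∈ F, key v = key u := by
  obtain ⟨F, hFP, hF⟩ := Set.exists_subset_bijOn P key
  exact ⟨F, hF.finite_iff_finite.2 h, hFP, fun u hu => hF.surjOn ⟨u, hu, rfl⟩⟩

theorem finite_matrix_abs_le {ι : Type*} [Fintype ι] (B : ℤ) :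
    {M : Matrix ι ι ℤ | ∀ i j, |M i j| ≤ B}.Finite := by
  have := Set.Finite.pi' fun _ : ι => Set.Finite.pi' fun _ : ι => Set.finite_Icc (-B) B
  refine this.subset fun M hM i j => ?_
  exact abs_le.1 (hM i j)

/-! ### Alternating Gram matrices and symplectic changes of basis -/

/-- The Gram matrix of the alternating form. -/
def alternatingGram {g : ℕ} (U : Matrix (Fin g ⊕ Fin g) (Fin g ⊕ Fin g) ℤ) :
    Matrix (Fin g ⊕ Fin g) (Fin g ⊕ Fin g) ℤ := Uᵀ * Matrix.J (Fin g) ℤ * U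

theorem alternatingGram_apply {g : ℕ} (U : Matrix (Fin g ⊕ Fin g) (Fin g ⊕ Fin g) ℤ)
    (j k : Fin g ⊕ Fin g) : alternatingGram U j k =
      (fun i => U (Sum.inl i) k) ⬝ᵥ (fun i => U (Sum.inr i) j) -
        (fun i => U (Sum.inl i) j) ⬝ᵥ (fun i => U (Sum.inr i) k) := by
  have h1 : alternatingGram U j k = (fun i => U i j) ⬝ᵥ Matrix.J (Fin g) ℤ *ᵥ fun i => U i k := by
    rw [alternatingGram, Matrix.mul_assoc]
    rfl
  rw [h1, ← Sum.elim_comp_inl_inr fun i => U i j, Matrix.J, Matrix.fromBlocks_mulVec,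
    sumElim_dotProduct_sumElim]
  simp only [Matrix.zero_mulVec, Matrix.one_mulVec, Matrix.neg_mulVec, zero_add, add_zero,
    dotProduct_neg]
  rw [dotProduct_comm ((fun i => U i j) ∘ Sum.inr)]
  simp only [Function.comp_def]
  ring

/-- The norm form bounds the alternating form; hence only finitely many Gram matrices occur for
bounded systems, whatever τ is. -/
theorem abs_alternatingGram_le {g : ℕ} (τ : SiegelUpperHalfSpace g)
    (U : Matrix (Fin g ⊕ Fin g) (Fin g ⊕ Fin g) ℤ) {K : ℝ}
    (hU : ∀ j, siegelQuad τ (castVec fun i => U i j) ≤ K) (j k : Fin g ⊕ Fin g) :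
    |(alternatingGram U j k : ℝ)| ≤ K := by
  have h := τ.symplectic_sq_le (iv fun i => U (Sum.inl i) k) (iv fun i => U (Sum.inr i) k)
    (iv fun i => U (Sum.inl i) j) (iv fun i => U (Sum.inr i) j)
  have h0 : ∀ j, siegelForm τ.1 (iv fun i => U (Sum.inl i) j) (iv fun i => U (Sum.inr i) j) ≤ K := hU
  have hK : 0 ≤ K := (τ.siegelForm_nonneg _ _).trans (h0 j)
  rw [alternatingGram_apply]
  refine abs_le_of_sq_le_sq ?_ hK
  rw [iv_dotProduct_iv, iv_dotProduct_iv] at h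
  push_cast
  refine h.trans ?_
  rw [sq]
  exact mul_le_mul (h0 k) (h0 j) (τ.siegelForm_nonneg _ _) hK

theorem det_dvd_det_alternatingGram {g : ℕ} (U : Matrix (Fin g ⊕ Fin g) (Fin g ⊕ Fin g) ℤ) :
    U.det ∣ (alternatingGram U).det := by
  rw [alternatingGram, Matrix.det_mul]
  exact dvd_mul_left _ _

theorem det_alternatingGram_ne_zero {g : ℕ} {U : Matrix (Fin g ⊕ Fin g) (Fin g ⊕ Fin g) ℤ}
    (hU : U.det ≠ 0) : (alternatingGram U).det ≠ 0 := by
  rw [alternatingGram, Matrix.det_mul, Matrix.det_mul, Matrix.det_transpose]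
  exact mul_ne_zero (mul_ne_zero hU (Matrix.isUnit_det_J (Fin g) ℤ).ne_zero) hU

/-- Two bases with the same alternating Gram matrix that are congruent modulo a multiple of its
determinant differ by a symplectic matrix in a congruence subgroup. -/
theorem exists_symplectic_of_alternatingGram_eq {g : ℕ} (N : ℤ)
    {U V : Matrix (Fin g ⊕ Fin g) (Fin g ⊕ Fin g) ℤ} (hV : V.det ≠ 0)
    (hE : alternatingGram V = alternatingGram U)
    (hmod : ∀ i j, V i j ≡ U i j [ZMOD N * (alternatingGram U).det]) :
    ∃ M : Matrix (Fin g ⊕ Fin g) (Fin g ⊕ Fin g) ℤ,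
      1 + N • M ∈ Matrix.symplecticGroup (Fin g) ℤ ∧ (1 + N • M) * V = U := by
  -- Rationally the matrix is UV⁻¹ = 1 + (U − V) adj(V) / det V. As det V divides the Gram
  -- determinant, the congruence makes it integral and congruent to 1 modulo N.
  obtain ⟨e, he⟩ := det_dvd_det_alternatingGram V
  rw [hE] at he
  choose M hM using fun i j => (hmod i j).dvd
  have hUV : U = V + (N * (alternatingGram U).det) • Matrix.of M := by
    ext i j
    rw [Matrix.add_apply, Matrix.smul_apply, Matrix.of_apply, smul_eq_mul, ← hM]
    ring
  have hmul : (1 + N • (e • (Matrix.of M * V.adjugate))) * V = U := by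
    rw [Matrix.add_mul, Matrix.one_mul, Matrix.smul_mul, Matrix.smul_mul, Matrix.mul_assoc,
      Matrix.adjugate_mul, Matrix.mul_smul, Matrix.mul_one, smul_smul, smul_smul, hUV, he]
    congr 2
    ring
  refine ⟨e • (Matrix.of M * V.adjugate), ?_, hmul⟩
  set H := 1 + N • (e • (Matrix.of M * V.adjugate))
  rw [SymplecticGroup.mem_iff']
  -- V is removed by multiplying with adjugates on both sides and cancelling (det V)².
  have h1 : Vᵀ * (Hᵀ * Matrix.J (Fin g) ℤ * H) * V = Vᵀ * Matrix.J (Fin g) ℤ * V := by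
    have h2 : alternatingGram (H * V) = alternatingGram V := by rw [hmul, hE]
    rw [alternatingGram, alternatingGram, Matrix.transpose_mul] at h2
    rw [← h2]
    simp only [Matrix.mul_assoc]
  have h3 := congrArg (fun X => V.adjugateᵀ * X * V.adjugate) h1
  have h4 : ∀ X : Matrix (Fin g ⊕ Fin g) (Fin g ⊕ Fin g) ℤ,
      V.adjugateᵀ * (Vᵀ * X * V) * V.adjugate = (V.det * V.det) • X := by
    intro X
    calc V.adjugateᵀ * (Vᵀ * X * V) * V.adjugate
        = (V * V.adjugate)ᵀ * X * (V * V.adjugate) := by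
          rw [Matrix.transpose_mul]; simp only [Matrix.mul_assoc]
      _ = _ := by
          rw [Matrix.mul_adjugate, Matrix.transpose_smul, Matrix.transpose_one, Matrix.smul_mul,
            Matrix.one_mul, Matrix.mul_smul, Matrix.mul_one, smul_smul]
  rw [h4, h4] at h3
  exact smul_right_injective _ (mul_ne_zero hV hV) h3

theorem siegelQuad_nonneg {g : ℕ} (τ : SiegelUpperHalfSpace g) (x : Fin g ⊕ Fin g → ℝ) :
    0 ≤ siegelQuad τ x := τ.siegelForm_nonneg _ _

theorem siegelQuad_smul {g : ℕ} (τ : SiegelUpperHalfSpace g) (r : ℝ) (x : Fin g ⊕ Fin g → ℝ) :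
    siegelQuad τ (r • x) = r ^ 2 * siegelQuad τ x := by
  obtain ⟨R, -, hR⟩ := exists_siegelQuad_eq_dotProduct τ
  rw [hR, hR, Matrix.mulVec_smul, smul_dotProduct, dotProduct_smul, smul_eq_mul, smul_eq_mul]
  ring

theorem map_intCast_mulVec_castVec {ι : Type*} [Fintype ι] (M : Matrix ι ι ℤ) (x : ι → ℤ) :
    M.map (Int.cast : ℤ → ℝ) *ᵥ castVec x = castVec (M *ᵥ x) := by
  ext i; simp [castVec, Matrix.mulVec, dotProduct]

/-- `exists_thetaSeries_proportional` in terms of a single matrix. -/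
theorem exists_thetaSeries_proportional_of_mem {g : ℕ} (n : ℕ) (τ : SiegelUpperHalfSpace g)
    {M : Matrix (Fin g ⊕ Fin g) (Fin g ⊕ Fin g) ℤ}
    (h : 1 + (2 ^ (2 * n + 2) : ℤ) • M ∈ Matrix.symplecticGroup (Fin g) ℤ) :
    ∃ (τ' : SiegelUpperHalfSpace g) (c : ℂ),
      (∀ a₀ b₀ : Fin g → ℤ, thetaSeries τ.1 (((2 ^ n : ℝ)⁻¹) • iv a₀) (cv (((2 ^ n : ℝ)⁻¹) • iv b₀))
        = c * thetaSeries τ'.1 (((2 ^ n : ℝ)⁻¹) • iv a₀) (cv (((2 ^ n : ℝ)⁻¹) • iv b₀))) ∧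
      ∀ x, siegelQuad τ' x =
        siegelQuad τ ((1 + (2 ^ (2 * n + 2) : ℤ) • M).map (Int.cast : ℤ → ℝ) *ᵥ x) := by
  have hblocks : 1 + (2 ^ (2 * n + 2) : ℤ) • M =
      Matrix.fromBlocks (1 + (2 ^ (2 * n + 2) : ℤ) • M.toBlocks₁₁)
        ((2 ^ (2 * n + 2) : ℤ) • M.toBlocks₁₂) ((2 ^ (2 * n + 2) : ℤ) • M.toBlocks₂₁)
        (1 + (2 ^ (2 * n + 2) : ℤ) • M.toBlocks₂₂) := by
    conv_lhs => rw [← Matrix.fromBlocks_toBlocks M, Matrix.fromBlocks_smul, ← Matrix.fromBlocks_one,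
      Matrix.fromBlocks_add, zero_add, zero_add]
  rw [hblocks] at h
  obtain ⟨τ', c, h1, h2⟩ := exists_thetaSeries_proportional n τ h
  refine ⟨τ', c, h1, fun x => ?_⟩
  rw [hblocks, Matrix.fromBlocks_map, Matrix.fromBlocks_mulVec]
  exact h2 _ _

/-- If the form of `τ` takes no small values on nonzero integral vectors, then `τ` can be replaced
by a point with bounded form without changing the vector of theta constants up to a factor. -/
theorem exists_bounded_representative (g n : ℕ) {c : ℝ} (hc : 0 < c) :
    ∃ K : ℝ, ∀ τ : SiegelUpperHalfSpace g,
      (∀ x : Fin g ⊕ Fin g → ℤ, x ≠ 0 → c ≤ siegelQuad τ (castVec x)) →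
      ∃ (τ' : SiegelUpperHalfSpace g) (s : ℂ),
        (∀ a₀ b₀ : Fin g → ℤ,
          thetaSeries τ.1 (((2 ^ n : ℝ)⁻¹) • iv a₀) (cv (((2 ^ n : ℝ)⁻¹) • iv b₀)) =
          s * thetaSeries τ'.1 (((2 ^ n : ℝ)⁻¹) • iv a₀) (cv (((2 ^ n : ℝ)⁻¹) • iv b₀))) ∧
        ∀ j, siegelQuad τ' (Pi.single j 1) ≤ K := by
  obtain ⟨K₀, hK₀⟩ := exists_int_matrix_siegelQuad_le g hc
  -- P collects the bounded systems for all τ at once. Its finitely many classes under `key` are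
  -- what make the final bound uniform in τ.
  let P : Set (Matrix (Fin g ⊕ Fin g) (Fin g ⊕ Fin g) ℤ) :=
    {U | U.det ≠ 0 ∧ ∃ τ : SiegelUpperHalfSpace g, ∀ j, siegelQuad τ (castVec fun i => U i j) ≤ K₀}
  let N : ℤ := 2 ^ (2 * n + 2)
  let key : Matrix (Fin g ⊕ Fin g) (Fin g ⊕ Fin g) ℤ →
      Matrix (Fin g ⊕ Fin g) (Fin g ⊕ Fin g) ℤ × Matrix (Fin g ⊕ Fin g) (Fin g ⊕ Fin g) ℤ :=
    fun U => (alternatingGram U, Matrix.of fun i j => U i j % (N * (alternatingGram U).det))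
  have hfin : (key '' P).Finite := by
    have h1 := finite_matrix_abs_le (ι := Fin g ⊕ Fin g) ⌈K₀⌉
    have h2 := h1.biUnion fun E _ => (Set.finite_singleton E).prod
      (finite_matrix_abs_le (ι := Fin g ⊕ Fin g) |N * E.det|)
    refine h2.subset ?_
    rintro _ ⟨U, ⟨hU0, τ, hU⟩, rfl⟩
    refine Set.mem_biUnion (x := alternatingGram U) (fun i j => ?_) ⟨rfl, fun i j => ?_⟩
    · exact_mod_cast (abs_alternatingGram_le τ U hU i j).trans (Int.le_ceil K₀)
    · have hne : N * (alternatingGram U).det ≠ 0 :=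
        mul_ne_zero (by positivity) (det_alternatingGram_ne_zero hU0)
      simp only [key, Matrix.of_apply]
      rw [abs_of_nonneg (Int.emod_nonneg _ hne)]
      exact (Int.emod_lt_abs _ hne).le
  obtain ⟨F, hF, hFP, hkey⟩ := exists_finite_representatives hfin
  have hbdd : BddAbove ((fun z : Matrix (Fin g ⊕ Fin g) (Fin g ⊕ Fin g) ℤ × (Fin g ⊕ Fin g) =>
      (Fintype.card (Fin g ⊕ Fin g) : ℝ) *
        (K₀ * (castVec (z.1.adjugate *ᵥ Pi.single z.2 1) ⬝ᵥ
          castVec (z.1.adjugate *ᵥ Pi.single z.2 1)))) '' (F ×ˢ Set.univ)) :=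
    ((hF.prod Set.finite_univ).image _).bddAbove
  obtain ⟨K, hK⟩ := hbdd
  refine ⟨K, fun τ hτ => ?_⟩
  obtain ⟨U, hU0, hU⟩ := hK₀ τ hτ
  obtain ⟨V, hVF, hV⟩ := hkey U ⟨hU0, τ, hU⟩
  have hV0 : V.det ≠ 0 := (hFP hVF).1
  have hE : alternatingGram V = alternatingGram U := congrArg Prod.fst hV
  have hmod : ∀ i j, V i j ≡ U i j [ZMOD N * (alternatingGram U).det] := by
    intro i j
    have := congrFun (congrFun (congrArg Prod.snd hV) i) j
    simp only [key, Matrix.of_apply, hE] at this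
    exact this
  obtain ⟨M, hM, hMV⟩ := exists_symplectic_of_alternatingGram_eq N hV0 hE hmod
  obtain ⟨τ', s, h1, h2⟩ := exists_thetaSeries_proportional_of_mem n τ hM
  refine ⟨τ', s, h1, fun j => ?_⟩
  refine le_trans ?_ (hK ⟨(V, j), ⟨hVF, trivial⟩, rfl⟩)
  simp only
  set t := V.adjugate *ᵥ Pi.single j 1 with ht
  -- The symplectic matrix takes V to U, hence (det V)eⱼ = V adj(V)eⱼ to U adj(V)eⱼ. The columns of
  -- U are short for τ, and adj(V) ranges over a finite set.
  have h3 : siegelQuad τ' ((V.det : ℝ) • Pi.single j 1) =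
      siegelQuad τ (U.map (Int.cast : ℤ → ℝ) *ᵥ castVec t) := by
    have h4 : (V.det : ℝ) • (Pi.single j 1 : Fin g ⊕ Fin g → ℝ) = castVec (V *ᵥ t) := by
      rw [ht, Matrix.mulVec_mulVec, Matrix.mul_adjugate, Matrix.smul_mulVec, Matrix.one_mulVec]
      ext i
      simp [castVec, Pi.single_apply]
    rw [h2, h4, map_intCast_mulVec_castVec, map_intCast_mulVec_castVec, Matrix.mulVec_mulVec, hMV]
  refine le_trans ?_ (siegelQuad_mulVec_le τ (U.map (Int.cast : ℤ → ℝ)) hU _)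
  rw [← h3, siegelQuad_smul]
  refine le_mul_of_one_le_left (siegelQuad_nonneg _ _) ?_
  have : (1 : ℤ) ≤ V.det ^ 2 := by
    have := sq_pos_of_ne_zero hV0
    omega
  exact_mod_cast this

/-! ### Theta constants with half-integral characteristics -/

/-- The theta constants with half-integral characteristics. -/
def halfTheta {g : ℕ} (τ : SiegelUpperHalfSpace g) (s t : Fin g → Fin 2) : ℂ :=
  thetaSeries τ.1 (hv s) (cv (hv t))

theorem thetaSup_pos {g : ℕ} (τ : SiegelUpperHalfSpace g) : 0 < thetaSup τ := by
  obtain ⟨b, hb⟩ := exists_thetaSeries_ne_zero τ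
  exact (norm_pos_iff.2 hb).trans_le (norm_thetaSeries_le_thetaSup τ 0 b)

theorem exists_halfTheta_ne_zero {g : ℕ} (τ : SiegelUpperHalfSpace g) :
    ∃ s t, halfTheta τ s t ≠ 0 := by
  by_contra! h
  have := thetaSup_le τ (m := 0) fun s t => (norm_eq_zero.2 (h s t)).le
  rw [mul_zero] at this
  exact absurd this (not_le.2 (thetaSup_pos τ))

theorem exp_half_char_eq_neg_one {g : ℕ} (p q : Fin g → ℤ) (s t : Fin g → Fin 2)
    (h : Odd (p ⬝ᵥ q + bit s ⬝ᵥ q - p ⬝ᵥ bit t)) :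
    Complex.exp (Real.pi * Complex.I * ((iv p ⬝ᵥ iv q : ℝ) : ℂ) +
      2 * Real.pi * Complex.I * ((hv s ⬝ᵥ iv q - iv p ⬝ᵥ hv t : ℝ) : ℂ)) = -1 := by
  obtain ⟨k, hk⟩ := h
  have hk' : ((p ⬝ᵥ q + bit s ⬝ᵥ q - p ⬝ᵥ bit t : ℤ) : ℂ) = 2 * k + 1 := by rw [hk]; push_cast; ring
  rw [hv, hv, smul_dotProduct, dotProduct_smul, iv_dotProduct_iv, iv_dotProduct_iv,
    iv_dotProduct_iv, smul_eq_mul, smul_eq_mul]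
  have : Real.pi * Complex.I * (((p ⬝ᵥ q : ℤ) : ℝ) : ℂ) + 2 * Real.pi * Complex.I *
      ((2⁻¹ * ((bit s ⬝ᵥ q : ℤ) : ℝ) - 2⁻¹ * ((p ⬝ᵥ bit t : ℤ) : ℝ) : ℝ) : ℂ) =
      (k : ℂ) * (2 * Real.pi * Complex.I) + Real.pi * Complex.I := by
    push_cast at hk' ⊢
    linear_combination (Real.pi * Complex.I : ℂ) * hk'
  rw [this, Complex.exp_add, Complex.exp_pi_mul_I, Complex.exp_int_mul_two_pi_mul_I, one_mul]

/-- If the theta constants of `τ` that do not vanish at `τ₀` dominate all theta constants of `τ`,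
then the form of `τ` takes no small values on nonzero integral vectors. -/
theorem exists_siegelQuad_lower_bound {g : ℕ} (τ₀ : SiegelUpperHalfSpace g) {δ : ℝ} (hδ : 0 < δ) :
    ∃ c : ℝ, 0 < c ∧ ∀ τ : SiegelUpperHalfSpace g,
      (∀ s t, halfTheta τ₀ s t ≠ 0 → ∀ s' t', δ * ‖halfTheta τ s' t'‖ ≤ ‖halfTheta τ s t‖) →
      ∀ x : Fin g ⊕ Fin g → ℤ, x ≠ 0 → c ≤ siegelQuad τ (castVec x) := by
  -- Chosen so that exp(2π) ρ 2^g ≤ δ/2; the extra factor 2 makes the final contradiction strict.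
  set ρ := min 1 (δ / (2 ^ (g + 1) * Real.exp (2 * Real.pi))) with hρ
  have hρ0 : 0 < ρ := lt_min one_pos (by positivity)
  refine ⟨ρ ^ 2, by positivity, fun τ hτ => ?_⟩
  have hodd : ∀ x : Fin g ⊕ Fin g → ℤ, (∃ i, Odd (x i)) → ρ ^ 2 ≤ siegelQuad τ (castVec x) := by
    rintro x ⟨i, hi⟩
    by_contra! hlt
    have hpq : ∃ i, Odd ((x ∘ Sum.inl) i) ∨ Odd ((x ∘ Sum.inr) i) := by
      rcases i with i | i
      · exact ⟨i, Or.inl hi⟩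
      · exact ⟨i, Or.inr hi⟩
    obtain ⟨s, t, hst, hne⟩ := exists_half_char_ne_zero τ₀ _ _ hpq
    have h1 := norm_thetaSeries_le_of_short τ _ _ (hv s) (hv t) hρ0 (min_le_left _ _)
      (show siegelForm τ.1 (iv (x ∘ Sum.inl)) (iv (x ∘ Sum.inr)) ≤ ρ ^ 2 from hlt.le)
      (exp_half_char_eq_neg_one _ _ _ _ hst)
    have h2 := thetaSup_le τ (m := ‖halfTheta τ s t‖ / δ) fun s' t' => by
      rw [le_div_iff₀ hδ, mul_comm]
      exact hτ s t hne s' t'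
    have h3 : Real.exp (2 * Real.pi) * ρ * 2 ^ (g + 1) ≤ δ := by
      have := min_le_right 1 (δ / (2 ^ (g + 1) * Real.exp (2 * Real.pi)))
      rw [← hρ, le_div_iff₀ (by positivity)] at this
      linarith
    have h4 := thetaSup_pos τ
    have h5 : thetaSup τ * δ ≤ 2 ^ g * (Real.exp (2 * Real.pi) * ρ * thetaSup τ) := by
      rw [← mul_div_assoc, le_div_iff₀ hδ] at h2
      exact h2.trans (mul_le_mul_of_nonneg_left h1 (by positivity))
    have h6 : thetaSup τ * (Real.exp (2 * Real.pi) * ρ * 2 ^ (g + 1)) ≤ thetaSup τ * δ :=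
      mul_le_mul_of_nonneg_left h3 h4.le
    have h7 : 0 < thetaSup τ * δ := mul_pos h4 hδ
    rw [pow_succ] at h6
    linarith
  intro x hx
  obtain ⟨i, hi⟩ := Function.ne_iff.1 hx
  -- Descent on |xᵢ|: a vector with all entries even is twice another one, on which the form is four
  -- times smaller.
  obtain ⟨m, hm⟩ : ∃ m, (x i).natAbs = m := ⟨_, rfl⟩
  induction m using Nat.strong_induction_on generalizing x with
  | _ m ih =>
    by_cases ho : ∃ j, Odd (x j)
    · exact hodd x ho
    · simp only [not_exists, Int.not_odd_iff_even] at ho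
      choose y hy using ho
      have hi' : x i ≠ 0 := hi
      have hyi : y i ≠ 0 := fun h => hi' (by rw [hy, h, add_zero])
      have hxy : castVec x = (2 : ℝ) • castVec y := by
        ext j; simp [castVec, hy j]; ring
      have := ih (y i).natAbs (by have := hy i; omega) y (fun h => hyi (congrFun h i)) hyi rfl
      rw [hxy, siegelQuad_smul]
      nlinarith [siegelQuad_nonneg τ (castVec y)]

/-! ### Compactness of the set of points with bounded form -/

/-- A compact set of symmetric matrices with imaginary part bounded below. -/
def compactRegion (g : ℕ) (B δ : ℝ) : Set (Matrix (Fin g) (Fin g) ℂ) :=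
  {τ | τ.IsSymm ∧ (∀ i j, ‖τ i j‖ ≤ B) ∧
    ∀ x : Fin g → ℝ, δ * (x ⬝ᵥ x) ≤ x ⬝ᵥ τ.map Complex.im *ᵥ x}

theorem isCompact_compactRegion (g : ℕ) (B δ : ℝ) : IsCompact (compactRegion g B δ) := by
  have h1 : IsCompact (X := Matrix (Fin g) (Fin g) ℂ)
      (Set.univ.pi fun _ => Set.univ.pi fun _ => Metric.closedBall (0 : ℂ) B) :=
    isCompact_univ_pi fun _ => isCompact_univ_pi fun _ => isCompact_closedBall (0 : ℂ) B
  refine h1.of_isClosed_subset ?_ fun τ hτ i _ j _ => mem_closedBall_zero_iff.2 (hτ.2.1 i j)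
  have h2 : IsClosed {τ : Matrix (Fin g) (Fin g) ℂ | τ.IsSymm} :=
    isClosed_eq (continuous_id.matrix_transpose) continuous_id
  have h3 : IsClosed {τ : Matrix (Fin g) (Fin g) ℂ | ∀ i j, ‖τ i j‖ ≤ B} := by
    simp only [Set.ofPred_forall]
    exact isClosed_iInter fun i => isClosed_iInter fun j =>
      isClosed_le (continuous_id.matrix_elem i j).norm continuous_const
  have h4 : IsClosed {τ : Matrix (Fin g) (Fin g) ℂ |
      ∀ x : Fin g → ℝ, δ * (x ⬝ᵥ x) ≤ x ⬝ᵥ τ.map Complex.im *ᵥ x} := by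
    simp only [Set.ofPred_forall]
    refine isClosed_iInter fun x => isClosed_le continuous_const ?_
    exact Continuous.dotProduct continuous_const
      (Continuous.matrix_mulVec (continuous_id.matrix_map Complex.continuous_im) continuous_const)
  exact h2.inter (h3.inter h4)

theorem mem_siegel_of_mem_compactRegion {g : ℕ} {B δ : ℝ} (hδ : 0 < δ)
    {τ : Matrix (Fin g) (Fin g) ℂ} (h : τ ∈ compactRegion g B δ) :
    τ.IsSymm ∧ (τ.map Complex.im).PosDef := by
  refine ⟨h.1, Matrix.PosDef.of_dotProduct_mulVec_pos ?_ fun x hx => ?_⟩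
  · ext i j
    simp [Matrix.conjTranspose_apply, h.1.apply j i]
  · rw [star_trivial]
    exact (mul_pos hδ (dotProduct_self_pos hx)).trans_le (h.2.2 x)

/-- The bound on basis vectors bounds the whole form, hence Y and XY⁻¹X from above, and
Cauchy–Schwarz then bounds the entries of X and Y. -/
theorem exists_mem_compactRegion (g : ℕ) (K : ℝ) : ∃ B δ : ℝ, 0 < δ ∧
    ∀ τ : SiegelUpperHalfSpace g, (∀ j, siegelQuad τ (Pi.single j 1) ≤ K) →
      τ.1 ∈ compactRegion g B δ := by
  set L : ℝ := Fintype.card (Fin g ⊕ Fin g) * |K| + 1 with hL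
  have hL0 : 0 < L := by positivity
  refine ⟨2 * L, L⁻¹, by positivity, fun τ hτ => ?_⟩
  have hquad : ∀ a b : Fin g → ℝ, siegelForm τ.1 a b ≤ L * (a ⬝ᵥ a + b ⬝ᵥ b) := by
    intro a b
    have h1 := siegelQuad_mulVec_le τ (1 : Matrix (Fin g ⊕ Fin g) (Fin g ⊕ Fin g) ℝ)
      (K := |K|) (fun j => by
        have : (fun i => (1 : Matrix (Fin g ⊕ Fin g) (Fin g ⊕ Fin g) ℝ) i j) = Pi.single j 1 := by
          ext i; simp [Matrix.one_apply, Pi.single_apply]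
        rw [this]
        exact (hτ j).trans (le_abs_self K)) (Sum.elim a b)
    rw [Matrix.one_mulVec, sumElim_dotProduct_sumElim] at h1
    refine h1.trans ?_
    have h2 : 0 ≤ a ⬝ᵥ a + b ⬝ᵥ b :=
      add_nonneg (Finset.sum_nonneg fun i _ => mul_self_nonneg _)
        (Finset.sum_nonneg fun i _ => mul_self_nonneg _)
    rw [hL, add_mul, mul_assoc]
    linarith
  have hY : ∀ x : Fin g → ℝ, x ⬝ᵥ τ.1.map Complex.im *ᵥ x ≤ L * (x ⬝ᵥ x) := by
    intro x
    have h1 := hquad x 0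
    have h2 := τ.im_inv_quadratic_nonneg (τ.1.map Complex.re *ᵥ x)
    rw [siegelForm, zero_dotProduct, add_zero, add_zero] at h1
    linarith
  have hX : ∀ x : Fin g → ℝ, (τ.1.map Complex.re *ᵥ x) ⬝ᵥ (τ.1.map Complex.im)⁻¹ *ᵥ
      (τ.1.map Complex.re *ᵥ x) ≤ L * (x ⬝ᵥ x) := by
    intro x
    have h1 := hquad x 0
    have h2 := τ.im_quadratic_nonneg x
    rw [siegelForm, zero_dotProduct, add_zero, add_zero] at h1
    linarith
  have hsingle : ∀ i : Fin g, (Pi.single i 1 : Fin g → ℝ) ⬝ᵥ Pi.single i 1 = 1 := by simp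
  have hentry : ∀ (M : Matrix (Fin g) (Fin g) ℝ) (i j : Fin g),
      (Pi.single i 1 : Fin g → ℝ) ⬝ᵥ M *ᵥ Pi.single j 1 = M i j := by simp
  have hre : ∀ i j, |(τ.1 i j).re| ≤ L := by
    intro i j
    have h1 := τ.cauchy_schwarz_im (Pi.single i 1) (τ.1.map Complex.re *ᵥ Pi.single j 1)
    have h2 := hY (Pi.single i 1)
    have h3 := hX (Pi.single j 1)
    rw [hsingle, mul_one] at h2 h3
    refine abs_le_of_sq_le_sq ?_ hL0.le
    calc (τ.1 i j).re ^ 2 = ((Pi.single i 1 : Fin g → ℝ) ⬝ᵥ τ.1.map Complex.re *ᵥ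
          Pi.single j 1) ^ 2 := by rw [hentry]; rfl
      _ ≤ _ := h1
      _ ≤ L * L := mul_le_mul h2 h3 (τ.im_inv_quadratic_nonneg _) hL0.le
      _ = L ^ 2 := (sq L).symm
  have him : ∀ i j, |(τ.1 i j).im| ≤ L := by
    intro i j
    have h1 := τ.cauchy_schwarz_im (Pi.single i 1) (τ.1.map Complex.im *ᵥ Pi.single j 1)
    rw [τ.im_inv_mulVec_im, dotProduct_comm (τ.1.map Complex.im *ᵥ _)] at h1
    have h2 := hY (Pi.single i 1)
    have h3 := hY (Pi.single j 1)
    rw [hsingle, mul_one] at h2 h3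
    refine abs_le_of_sq_le_sq ?_ hL0.le
    calc (τ.1 i j).im ^ 2 = ((Pi.single i 1 : Fin g → ℝ) ⬝ᵥ τ.1.map Complex.im *ᵥ
          Pi.single j 1) ^ 2 := by rw [hentry]; rfl
      _ ≤ _ := h1
      _ ≤ L * L := mul_le_mul h2 h3 (τ.im_quadratic_nonneg _) hL0.le
      _ = L ^ 2 := (sq L).symm
  refine ⟨τ.2.1, fun i j => ?_, fun x => ?_⟩
  · have := Complex.norm_le_abs_re_add_abs_im (τ.1 i j)
    linarith [hre i j, him i j]
  -- For the vectors (0, x) and (x, −Xx) the inequality reads (x·x)² ≤ (xᵗY⁻¹x)(xᵗYx), so the upper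
  -- bound on Y⁻¹ becomes a lower bound on Y.
  · have h1 := τ.symplectic_sq_le 0 x x (-(τ.1.map Complex.re *ᵥ x))
    have h2 : siegelForm τ.1 x (-(τ.1.map Complex.re *ᵥ x)) = x ⬝ᵥ τ.1.map Complex.im *ᵥ x := by
      rw [siegelForm, add_neg_cancel, zero_dotProduct, add_zero]
    have h3 := hquad 0 x
    rw [zero_dotProduct, zero_add] at h3
    rw [h2, zero_dotProduct, zero_sub, neg_sq] at h1
    have h4 := τ.im_quadratic_nonneg x
    rw [inv_mul_le_iff₀ hL0]
    rcases eq_or_ne x 0 with rfl | hx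
    · simp
    · have h5 := dotProduct_self_pos hx
      have h6 : (x ⬝ᵥ x) * (x ⬝ᵥ x) ≤ (x ⬝ᵥ x) * (L * (x ⬝ᵥ τ.1.map Complex.im *ᵥ x)) := by
        calc (x ⬝ᵥ x) * (x ⬝ᵥ x) = (x ⬝ᵥ x) ^ 2 := (sq _).symm
          _ ≤ _ := h1
          _ ≤ L * (x ⬝ᵥ x) * (x ⬝ᵥ τ.1.map Complex.im *ᵥ x) := mul_le_mul_of_nonneg_right h3 h4
          _ = _ := by ring
      exact le_of_mul_le_mul_left h6 h5

/-! ### The coordinates of the theta maps -/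

theorem finite_D (g n : ℕ) : (D g n).Finite := by
  have h1 : ({0, 1} : Set ℚ).Finite := Set.toFinite _
  have h2 : ((fun l : ℕ => (l : ℚ) / 2 ^ (n - 1)) '' Set.Iio (2 ^ n)).Finite :=
    (Set.finite_Iio _).image _
  refine ((Set.Finite.pi' fun _ : Fin g => h1).prod (Set.Finite.pi' fun _ : Fin g => h2)).subset ?_
  rintro c ⟨hc1, hc2⟩
  refine ⟨hc1, fun i => ?_⟩
  obtain ⟨l, hl, h⟩ := hc2 i
  exact ⟨l, hl, h.symm⟩

instance (g n : ℕ) : Finite (D g n) := finite_D g n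

theorem alpha_apply {g n : ℕ} (τ : SiegelUpperHalfSpace g) (c : D g n) : alpha g n τ c =
    thetaSeries τ.1 ((2⁻¹ : ℝ) • fun i => (c.1.1 i : ℝ))
      (cv ((2⁻¹ : ℝ) • fun i => (c.1.2 i : ℝ))) := by
  rw [alpha, theta_eq_thetaSeries, zero_add]

/-- The characteristics of level `n`, halved, lie in `2 ^ (-n) ℤ`. -/
theorem exists_int_characteristic {g n : ℕ} (hn : 1 ≤ n) (c : D g n) :
    ∃ a₀ b₀ : Fin g → ℤ, ((2⁻¹ : ℝ) • fun i => (c.1.1 i : ℝ)) = ((2 ^ n : ℝ)⁻¹) • iv a₀ ∧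
      ((2⁻¹ : ℝ) • fun i => (c.1.2 i : ℝ)) = ((2 ^ n : ℝ)⁻¹) • iv b₀ := by
  obtain ⟨m, rfl⟩ : ∃ m, n = m + 1 := ⟨n - 1, by omega⟩
  have h1 : ∀ i, ∃ k : ℤ, (c.1.1 i : ℝ) = k := by
    intro i
    rcases c.2.1 i with h | h
    · exact ⟨0, by rw [h]; simp⟩
    · exact ⟨1, by rw [h]; simp⟩
  choose k hk using h1
  choose l _ hl using c.2.2
  refine ⟨fun i => 2 ^ m * k i, fun i => l i, ?_, ?_⟩
  · ext i
    simp only [Pi.smul_apply, smul_eq_mul, iv, hk]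
    push_cast
    rw [pow_succ]
    field_simp
  · ext i
    simp only [Pi.smul_apply, smul_eq_mul, iv, hl]
    push_cast
    rw [pow_succ]
    field_simp

/-- The characteristic of `halfTheta τ s t`. -/
def halfChar {g : ℕ} (s t : Fin g → Fin 2) : D g 1 :=
  ⟨(fun i => ((s i : ℕ) : ℚ), fun i => ((t i : ℕ) : ℚ)), by
    refine ⟨fun i => ?_, fun i => ⟨t i, (t i).2, by simp⟩⟩
    have h : (s i : ℕ) = 0 ∨ (s i : ℕ) = 1 := by have := (s i).2; omega
    exact h.imp (fun h => by simp only [h, Nat.cast_zero]) fun h => by simp only [h, Nat.cast_one]⟩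

theorem alpha_halfChar {g : ℕ} (τ : SiegelUpperHalfSpace g) (s t : Fin g → Fin 2) :
    alpha g 1 τ (halfChar s t) = halfTheta τ s t := by
  rw [alpha_apply, halfTheta]
  congr 2

theorem forget_alpha {g n : ℕ} (hn : 1 ≤ n) (τ : SiegelUpperHalfSpace g) :
    forget hn (alpha g n τ) = alpha g 1 τ := rfl

theorem alpha_one_ne_zero {g : ℕ} (τ : SiegelUpperHalfSpace g) : alpha g 1 τ ≠ 0 := by
  obtain ⟨s, t, h⟩ := exists_halfTheta_ne_zero τ
  exact fun h0 => h (by rw [← alpha_halfChar, h0, Pi.zero_apply])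

theorem alpha_ne_zero {g n : ℕ} (hn : 1 ≤ n) (τ : SiegelUpperHalfSpace g) : alpha g n τ ≠ 0 :=
  fun h => alpha_one_ne_zero τ (by rw [← forget_alpha hn, h]; rfl)

/-- Take half the ratio of a lower bound for the nonzero constants to the supremum. The half makes
the inequality strict, hence an open condition on the coordinates. -/
theorem exists_dominance {g : ℕ} (τ : SiegelUpperHalfSpace g) : ∃ δ : ℝ, 0 < δ ∧
    ∀ s t, halfTheta τ s t ≠ 0 → ∀ s' t', δ * ‖halfTheta τ s' t'‖ < ‖halfTheta τ s t‖ := by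
  have h : ∀ s t, ∃ ε : ℝ, 0 < ε ∧ (halfTheta τ s t ≠ 0 → ε ≤ ‖halfTheta τ s t‖) := by
    intro s t
    by_cases h0 : halfTheta τ s t = 0
    · exact ⟨1, one_pos, fun h => absurd h0 h⟩
    · exact ⟨_, norm_pos_iff.2 h0, fun _ => le_rfl⟩
  choose ε hε0 hε using h
  obtain ⟨p, hp⟩ := Finite.exists_min fun x : (Fin g → Fin 2) × (Fin g → Fin 2) => ε x.1 x.2
  have hS := thetaSup_pos τ
  refine ⟨ε p.1 p.2 / (2 * thetaSup τ), div_pos (hε0 _ _) (by positivity), fun s t hst s' t' => ?_⟩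
  have h1 : ‖halfTheta τ s' t'‖ ≤ thetaSup τ := norm_thetaSeries_le_thetaSup τ _ _
  have h2 : ε p.1 p.2 ≤ ‖halfTheta τ s t‖ := (hp (s, t)).trans (hε s t hst)
  have h3 := hε0 p.1 p.2
  calc ε p.1 p.2 / (2 * thetaSup τ) * ‖halfTheta τ s' t'‖
      ≤ ε p.1 p.2 / (2 * thetaSup τ) * thetaSup τ := by gcongr
    _ = ε p.1 p.2 / 2 := by field_simp
    _ < _ := by linarith

/-- Near the image of `τ₀` in `X_1`, all points of `X_n` are images of points of a compact set. -/
theorem exists_compactRegion_representative {g n : ℕ} (hn : 1 ≤ n) (τ₀ : SiegelUpperHalfSpace g)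
    {δ : ℝ} (hδ : 0 < δ) : ∃ B ε : ℝ, 0 < ε ∧ ∀ τ : SiegelUpperHalfSpace g,
      (∀ s t, halfTheta τ₀ s t ≠ 0 → ∀ s' t', δ * ‖halfTheta τ s' t'‖ ≤ ‖halfTheta τ s t‖) →
      ∃ (τ' : SiegelUpperHalfSpace g) (s : ℂ),
        τ'.1 ∈ compactRegion g B ε ∧ alpha g n τ = s • alpha g n τ' := by
  obtain ⟨c, hc, hlow⟩ := exists_siegelQuad_lower_bound τ₀ hδ
  obtain ⟨K, hK⟩ := exists_bounded_representative g n hc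
  obtain ⟨B, ε, hε, hB⟩ := exists_mem_compactRegion g K
  refine ⟨B, ε, hε, fun τ hτ => ?_⟩
  obtain ⟨τ', s, h1, h2⟩ := hK τ (hlow τ hτ)
  refine ⟨τ', s, hB τ' h2, ?_⟩
  ext d
  obtain ⟨a₀, b₀, ha, hb⟩ := exists_int_characteristic hn d
  rw [Pi.smul_apply, alpha_apply, alpha_apply, ha, hb, h1, smul_eq_mul]

/-! ### The topology of projective space -/

/-- The saturation of an open set is the union of its multiples by nonzero scalars. -/
theorem isOpenQuotientMap_mk' (ι : Type*) :
    IsOpenQuotientMap (Projectivization.mk' ℂ : {v : ι → ℂ // v ≠ 0} → ℙ ℂ (ι → ℂ)) := by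
  refine ⟨Quotient.mk''_surjective, continuous_coinduced_rng, fun U hU => ?_⟩
  rw [isOpen_coinduced]
  have h : Projectivization.mk' ℂ ⁻¹' (Projectivization.mk' ℂ '' U) =
      ⋃ a : ℂˣ, (fun v : {v : ι → ℂ // v ≠ 0} =>
        (⟨a • v.1, (smul_ne_zero_iff_ne a).2 v.2⟩ : {v : ι → ℂ // v ≠ 0})) ⁻¹' U := by
    ext v
    simp only [Set.mem_preimage, Set.mem_image, Set.mem_iUnion]
    constructor
    · rintro ⟨w, hw, hwv⟩
      obtain ⟨a, ha⟩ := (Projectivization.mk_eq_mk_iff ℂ w.1 v.1 w.2 v.2).1 hwv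
      exact ⟨a, by simpa only [ha] using hw⟩
    · rintro ⟨a, ha⟩
      exact ⟨_, ha, (Projectivization.mk_eq_mk_iff ℂ _ _ _ _).2 ⟨a, rfl⟩⟩
  rw [h]
  refine isOpen_iUnion fun a => hU.preimage ?_
  exact (continuous_subtype_val.const_smul a).subtype_mk _

/-- Proportionality by 2 × 2 minors: these are closed conditions, whence the Hausdorff property. -/
theorem mk_eq_mk_iff_forall_mul_eq {ι : Type*} {v w : ι → ℂ} (hv : v ≠ 0) (hw : w ≠ 0) :
    Projectivization.mk ℂ v hv = Projectivization.mk ℂ w hw ↔ ∀ i j, v i * w j = w i * v j := by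
  rw [Projectivization.mk_eq_mk_iff']
  constructor
  · rintro ⟨a, rfl⟩ i j
    simp only [Pi.smul_apply, smul_eq_mul]
    ring
  · intro h
    obtain ⟨j, hj⟩ := Function.ne_iff.1 hw
    have hj' : w j ≠ 0 := hj
    refine ⟨v j / w j, funext fun i => ?_⟩
    rw [Pi.smul_apply, smul_eq_mul, div_mul_eq_mul_div, div_eq_iff hj', h i j, mul_comm]

theorem continuous_coordinate {ι : Type*} (i : ι) :
    Continuous fun v : {v : ι → ℂ // v ≠ 0} => v.1 i :=
  (continuous_apply i).comp continuous_subtype_val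

instance (ι : Type*) : T2Space (ℙ ℂ (ι → ℂ)) := by
  rw [t2Space_iff_of_isOpenQuotientMap (isOpenQuotientMap_mk' ι)]
  have h : {q : {v : ι → ℂ // v ≠ 0} × {v : ι → ℂ // v ≠ 0} |
      Projectivization.mk' ℂ q.1 = Projectivization.mk' ℂ q.2} =
      ⋂ (i : ι) (j : ι), {q | q.1.1 i * q.2.1 j = q.2.1 i * q.1.1 j} := by
    ext q
    simp only [Set.mem_iInter]
    exact mk_eq_mk_iff_forall_mul_eq q.1.2 q.2.2
  rw [h]
  have hc := continuous_coordinate (ι := ι)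
  exact isClosed_iInter fun i => isClosed_iInter fun j => isClosed_eq
    (((hc i).comp continuous_fst).mul ((hc j).comp continuous_snd))
    (((hc i).comp continuous_snd).mul ((hc j).comp continuous_fst))

theorem mk_eq_of_eq_smul {ι : Type*} {v w : ι → ℂ} (hv : v ≠ 0) (hw : w ≠ 0) {s : ℂ}
    (h : v = s • w) : Projectivization.mk ℂ v hv = Projectivization.mk ℂ w hw :=
  (Projectivization.mk_eq_mk_iff' ℂ v w hv hw).2 ⟨s, h.symm⟩

/-! ### The map between the images -/

/-- The map `ψ_n` from the Siegel space to `X_n`. -/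
def psi {g n : ℕ} (hn : 1 ≤ n) (τ : SiegelUpperHalfSpace g) : X g n :=
  ⟨Projectivization.mk ℂ (alpha g n τ) (alpha_ne_zero hn τ), τ, alpha_ne_zero hn τ, rfl⟩

theorem exists_eq_psi {g n : ℕ} (hn : 1 ≤ n) (P : X g n) : ∃ τ, P = psi hn τ := by
  obtain ⟨_, τ, h, rfl⟩ := P
  exact ⟨τ, rfl⟩

/-- The map `φ_n` that omits the coordinates of the non-integral characteristics. -/
def phi {g n : ℕ} (hn : 1 ≤ n) (P : X g n) : X g 1 := psi le_rfl (exists_eq_psi hn P).choose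

/-- The choice of τ in `phi` is harmless: every representative is a multiple of `alpha` at the
chosen τ, and `forget` commutes with scalars. -/
theorem phi_mk {g n : ℕ} (hn : 1 ≤ n) (v : D g n → ℂ) (hv : v ≠ 0)
    (hP : Projectivization.mk ℂ v hv ∈ X g n) : ∃ hw : forget hn v ≠ 0,
      (phi hn ⟨Projectivization.mk ℂ v hv, hP⟩ : ℙ ℂ (D g 1 → ℂ)) =
        Projectivization.mk ℂ (forget hn v) hw := by
  have hspec := (exists_eq_psi hn ⟨Projectivization.mk ℂ v hv, hP⟩).choose_spec
  obtain ⟨a, ha⟩ := (Projectivization.mk_eq_mk_iff ℂ _ _ _ _).1 (congrArg Subtype.val hspec)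
  have hw : forget hn v = (a : ℂ) • alpha g 1 (exists_eq_psi hn ⟨_, hP⟩).choose :=
    (congrArg (forget hn) ha).symm
  have hw0 : forget hn v ≠ 0 := by
    rw [hw]
    exact smul_ne_zero a.ne_zero (alpha_one_ne_zero _)
  exact ⟨hw0, (mk_eq_of_eq_smul hw0 (alpha_one_ne_zero _) hw).symm⟩

theorem phi_psi {g n : ℕ} (hn : 1 ≤ n) (τ : SiegelUpperHalfSpace g) :
    phi hn (psi hn τ) = psi le_rfl τ := by
  obtain ⟨_, h⟩ := phi_mk hn (alpha g n τ) (alpha_ne_zero hn τ) (psi hn τ).2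
  exact Subtype.ext h

theorem continuous_forget {g n : ℕ} (hn : 1 ≤ n) :
    Continuous (forget hn : (D g n → ℂ) → D g 1 → ℂ) :=
  continuous_pi fun _ => continuous_apply _

/-- X_n carries a subspace topology, not a quotient one, so the preimage of an open set is exhibited
as the trace of an open subset of projective space: the classes of vectors whose remaining
coordinates are nonzero and define a point of the given open set. -/
theorem continuous_phi {g n : ℕ} (hn : 1 ≤ n) : Continuous (phi hn : X g n → X g 1) := by
  refine continuous_def.2 fun O hO => ?_
  obtain ⟨O₁, hO₁, rfl⟩ := isOpen_induced_iff.1 hO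
  have h1 : IsOpen (Subtype.val '' (Projectivization.mk' ℂ ⁻¹' O₁) : Set (D g 1 → ℂ)) :=
    (isOpen_ne (x := (0 : D g 1 → ℂ))).isOpenMap_subtype_val _
      (hO₁.preimage (isOpenQuotientMap_mk' _).continuous)
  have h2 := (isOpenQuotientMap_mk' (D g n)).isOpenMap _
    (h1.preimage ((continuous_forget hn).comp continuous_subtype_val))
  convert h2.preimage (continuous_subtype_val (p := (· ∈ X g n))) using 1
  ext P
  simp only [Set.mem_preimage, Set.mem_image, Function.comp_apply]
  constructor
  · intro hP
    obtain ⟨τ, rfl⟩ := exists_eq_psi hn P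
    rw [phi_psi] at hP
    exact ⟨⟨alpha g n τ, alpha_ne_zero hn τ⟩, ⟨⟨alpha g 1 τ, alpha_one_ne_zero τ⟩, hP, rfl⟩, rfl⟩
  · rintro ⟨v, ⟨w, hw, hwv⟩, hvP⟩
    obtain ⟨hw0, h⟩ := phi_mk hn v.1 v.2 (by rw [← Projectivization.mk'_eq_mk, hvP]; exact P.2)
    have hP : P = ⟨Projectivization.mk ℂ v.1 v.2, by
        rw [← Projectivization.mk'_eq_mk, hvP]; exact P.2⟩ := Subtype.ext hvP.symm
    rw [hP, h]
    have : w = ⟨forget hn v.1, hw0⟩ := Subtype.ext hwv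
    rw [this] at hw
    exact hw

/-- The points of `compactRegion` as points of the Siegel space. -/
def compactRegionPoint {g : ℕ} {B δ : ℝ} (hδ : 0 < δ) (τ : compactRegion g B δ) :
    SiegelUpperHalfSpace g := ⟨τ.1, mem_siegel_of_mem_compactRegion hδ τ.2⟩

theorem continuous_psi_compactRegion {g n : ℕ} (hn : 1 ≤ n) (B : ℝ) {δ : ℝ} (hδ : 0 < δ) :
    Continuous fun τ : compactRegion g B δ => psi hn (compactRegionPoint hδ τ) := by
  refine Continuous.subtype_mk ?_ _
  refine (isOpenQuotientMap_mk' (D g n)).continuous.comp (f := fun τ : compactRegion g B δ =>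
    (⟨alpha g n (compactRegionPoint hδ τ), alpha_ne_zero hn _⟩ :
      {v : D g n → ℂ // v ≠ 0})) ?_
  refine Continuous.subtype_mk (continuous_pi fun c => ?_) _
  simp only [alpha_apply]
  exact continuousOn_iff_continuous_domRestrict.1
    ((continuousOn_thetaSeries_matrix hδ _ _).mono fun τ hτ => hτ.2.2)

/-- The points of projective space at which the theta constants that do not vanish at `τ₀`
dominate. -/
def dominanceSet {g : ℕ} (τ₀ : SiegelUpperHalfSpace g) (δ : ℝ) :
    Set {w : D g 1 → ℂ // w ≠ 0} :=
  {w | ∀ s t, halfTheta τ₀ s t ≠ 0 → ∀ s' t',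
    δ * ‖w.1 (halfChar s' t')‖ < ‖w.1 (halfChar s t)‖}

theorem isOpen_dominanceSet {g : ℕ} (τ₀ : SiegelUpperHalfSpace g) (δ : ℝ) :
    IsOpen (dominanceSet τ₀ δ) := by
  simp only [dominanceSet, Set.ofPred_forall]
  refine isOpen_iInter_of_finite fun s => isOpen_iInter_of_finite fun t =>
    isOpen_iInter_of_finite fun _ => isOpen_iInter_of_finite fun s' =>
    isOpen_iInter_of_finite fun t' => 
    isOpen_lt (continuous_const.mul (continuous_coordinate _).norm) (continuous_coordinate _).norm

/-- Around a point y of the closure of the image, every nearby image point comes from the part of Z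
over one compact region of τ. That part has compact, hence closed, image, so y belongs to it. -/
theorem isClosedMap_phi {g n : ℕ} (hn : 1 ≤ n) : IsClosedMap (phi hn : X g n → X g 1) := by
  intro Z hZ
  refine isClosed_of_closure_subset fun y hy => ?_
  obtain ⟨τ₀, rfl⟩ := exists_eq_psi le_rfl y
  obtain ⟨δ, hδ, hdom⟩ := exists_dominance τ₀
  obtain ⟨B, ε, hε, hrep⟩ := exists_compactRegion_representative hn τ₀ hδ
  set O : Set (X g 1) := Subtype.val ⁻¹' (Projectivization.mk' ℂ '' dominanceSet τ₀ δ) with hO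
  have hOopen : IsOpen O := ((isOpenQuotientMap_mk' _).isOpenMap _
    (isOpen_dominanceSet τ₀ δ)).preimage continuous_subtype_val
  have hyO : psi le_rfl τ₀ ∈ O := by
    refine ⟨⟨alpha g 1 τ₀, alpha_one_ne_zero τ₀⟩, fun s t hst s' t' => ?_, rfl⟩
    simp only [alpha_halfChar]
    exact hdom s t hst s' t'
  set A : Set (compactRegion g B ε) :=
    (fun τ => psi hn (compactRegionPoint hε τ)) ⁻¹' Z with hA
  have : CompactSpace (compactRegion g B ε) :=
    isCompact_iff_compactSpace.1 (isCompact_compactRegion g B ε)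
  have hAc : IsCompact A := (hZ.preimage (continuous_psi_compactRegion hn B hε)).isCompact
  have hK := (hAc.image (continuous_psi_compactRegion le_rfl B hε)).isClosed
  have hsub : O ∩ phi hn '' Z ⊆ (fun τ : compactRegion g B ε =>
      psi le_rfl (compactRegionPoint hε τ)) '' A := by
    rintro _ ⟨hPO, P, hPZ, rfl⟩
    obtain ⟨τ, rfl⟩ := exists_eq_psi hn P
    rw [phi_psi] at hPO ⊢
    obtain ⟨w, hw, hwτ⟩ := hPO
    -- Dominance is homogeneous, so it passes from the representative w to the vector of theta
    -- constants of τ.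
    obtain ⟨a, ha⟩ := (Projectivization.mk_eq_mk_iff' ℂ _ _ w.2 (alpha_one_ne_zero τ)).1 hwτ
    have ha0 : a ≠ 0 := by
      rintro rfl
      exact w.2 (by rw [← ha, zero_smul])
    obtain ⟨τ', s, hτ', hs⟩ := hrep τ fun s t hst s' t' => by
      have h := hw s t hst s' t'
      rw [← ha] at h
      simp only [Pi.smul_apply, alpha_halfChar, norm_smul] at h
      refine le_of_mul_le_mul_left ?_ (norm_pos_iff.2 ha0)
      linarith
    refine ⟨⟨τ'.1, hτ'⟩, ?_, ?_⟩
    · have h : psi hn τ' = psi hn τ := (Subtype.ext (mk_eq_of_eq_smul _ _ hs)).symm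
      rw [← h] at hPZ
      exact hPZ
    · exact (Subtype.ext (mk_eq_of_eq_smul _ _ (congrArg (forget hn) hs))).symm
  have h1 := hOopen.inter_closure ⟨hyO, hy⟩
  obtain ⟨τ, hτA, hτ⟩ := hK.closure_subset_iff.2 hsub h1
  refine ⟨_, hτA, ?_⟩
  exact (phi_psi hn _).trans hτ

/-! ### Finiteness of the fibres -/

/-- The values that the theta constant with characteristic `(a, b)` can take after rescaling such
that the theta constants with half-integral characteristics take the prescribed values `w`. -/
def normalizedValues {g : ℕ} (w : (Fin g → Fin 2) → (Fin g → Fin 2) → ℂ) (a b : Fin g → ℝ) :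
    Set ℂ :=
  {z | ∃ (τ : SiegelUpperHalfSpace g) (c : ℂ), c ≠ 0 ∧ (∀ s t, halfTheta τ s t = c * w s t) ∧
    thetaSeries τ.1 a (cv b) = c * z}

theorem exists_bit_add_two_mul {g : ℕ} (a₀ : Fin g → ℤ) :
    ∃ (s : Fin g → Fin 2) (m : Fin g → ℤ), (2⁻¹ : ℝ) • iv a₀ = hv s + iv m := by
  refine ⟨fun i => ⟨(a₀ i % 2).toNat, by omega⟩, fun i => a₀ i / 2, ?_⟩
  ext i
  have h : (a₀ i : ℝ) = ((a₀ i % 2).toNat : ℝ) + 2 * (a₀ i / 2 : ℤ) := by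
    have : a₀ i = ((a₀ i % 2).toNat : ℤ) + 2 * (a₀ i / 2) := by omega
    exact_mod_cast this
  simp only [Pi.smul_apply, Pi.add_apply, smul_eq_mul, iv, hv, bit, Int.cast_natCast]
  rw [h]
  ring

theorem finite_setOf_pow_four_mem {T : Set ℂ} (hT : T.Finite) : {z : ℂ | z ^ 4 ∈ T}.Finite := by
  have h := hT.biUnion fun t _ => (Polynomial.nthRoots 4 t).toFinset.finite_toSet
  refine h.subset fun z hz => Set.mem_biUnion hz ?_
  simp [Polynomial.mem_nthRoots]

/-- By the quartic relation, homogeneous of degree 4, the fourth power of a normalized value is a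
fixed expression in w and in normalized values with half the denominator, of which there are
finitely many by induction. At denominator 2, integral shifts only contribute a fixed phase, leaving
a single value. -/
theorem finite_normalizedValues {g : ℕ} (w : (Fin g → Fin 2) → (Fin g → Fin 2) → ℂ) (k : ℕ)
    (a₀ b₀ : Fin g → ℤ) :
    (normalizedValues w ((2 ^ (k + 1) : ℝ)⁻¹ • iv a₀) ((2 ^ (k + 1) : ℝ)⁻¹ • iv b₀)).Finite := by
  induction k generalizing a₀ b₀ with
  | zero =>
    rw [zero_add, pow_one]
    obtain ⟨s, m, ha⟩ := exists_bit_add_two_mul a₀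
    obtain ⟨t, l, hb⟩ := exists_bit_add_two_mul b₀
    rw [ha, hb]
    refine (Set.finite_singleton
      (Complex.exp (2 * Real.pi * Complex.I * (hv s ⬝ᵥ iv l : ℝ)) * w s t)).subset ?_
    rintro z ⟨τ, c, hc, hw, hz⟩
    rw [thetaSeries_add_left, cv_add, thetaSeries_add_right] at hz
    have h := hw s t
    rw [halfTheta] at h
    rw [h, mul_left_comm] at hz
    exact (mul_left_cancel₀ hc hz).symm
  | succ k ih =>
    set a := (2 ^ (k + 1 + 1) : ℝ)⁻¹ • iv a₀ with ha
    set b := (2 ^ (k + 1 + 1) : ℝ)⁻¹ • iv b₀ with hb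
    have hdouble : ∀ (x : Fin g → ℤ) (s : Fin g → Fin 2),
        (2 : ℝ) • ((2 ^ (k + 1 + 1) : ℝ)⁻¹ • iv x) + hv s =
          (2 ^ (k + 1) : ℝ)⁻¹ • iv (x + (2 ^ k : ℤ) • bit s) := by
      intro x s
      rw [iv_add, iv_smul, hv, smul_add, smul_smul, smul_smul]
      congr 2
      · rw [pow_succ _ (k + 1)]; field_simp
      · push_cast; rw [pow_succ]; field_simp
    have hfin : ∀ s t, (normalizedValues w ((2 : ℝ) • a + hv s) ((2 : ℝ) • b + hv t)).Finite := by
      intro s t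
      rw [ha, hb, hdouble, hdouble]
      exact ih _ _
    have hpi := Set.Finite.pi' fun s => Set.Finite.pi' fun t => hfin s t
    refine (finite_setOf_pow_four_mem (hpi.image fun ζ => ((2 : ℂ) ^ g)⁻¹ *
      ∑ s : Fin g → Fin 2, ∑ t : Fin g → Fin 2,
        Complex.exp (-(2 * Real.pi * Complex.I * ((a ⬝ᵥ iv (bit t) : ℝ) : ℂ))) *
          (ζ s t * w s t ^ 3))).subset ?_
    rintro z ⟨τ, c, hc, hw, hz⟩
    refine ⟨fun s t => c⁻¹ * thetaSeries τ.1 ((2 : ℝ) • a + hv s) (cv ((2 : ℝ) • b + hv t)),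
      fun s t => ⟨τ, c, hc, hw, by rw [mul_inv_cancel_left₀ hc]⟩, ?_⟩
    have h := riemann_quartic τ a b
    rw [hz] at h
    refine mul_left_cancel₀ (pow_ne_zero 4 hc) ?_
    rw [← mul_pow, h, mul_left_comm]
    congr 1
    rw [Finset.mul_sum]
    refine Finset.sum_congr rfl fun s _ => ?_
    rw [Finset.mul_sum]
    refine Finset.sum_congr rfl fun t _ => ?_
    have hst := hw s t
    rw [halfTheta] at hst
    rw [hst]
    field_simp

/-- Every point of the fibre over the image of τ₀ has a representative whose half-integral
coordinates equal those of τ₀; each of its finitely many coordinates then lies in a finite set. -/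
theorem finite_phi_fiber {g n : ℕ} (hn : 1 ≤ n) (y : X g 1) :
    (phi hn ⁻¹' {y} : Set (X g n)).Finite := by
  obtain ⟨τ₀, rfl⟩ := exists_eq_psi le_rfl y
  have hfin : ∀ c : D g n, (normalizedValues (halfTheta τ₀) ((2⁻¹ : ℝ) • fun i => (c.1.1 i : ℝ))
      ((2⁻¹ : ℝ) • fun i => (c.1.2 i : ℝ))).Finite := by
    intro c
    obtain ⟨a₀, b₀, ha, hb⟩ := exists_int_characteristic hn c
    obtain ⟨m, rfl⟩ : ∃ m, n = m + 1 := ⟨n - 1, by omega⟩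
    rw [ha, hb]
    exact finite_normalizedValues _ m a₀ b₀
  have h1 := ((Set.Finite.pi' hfin).preimage
    (Subtype.val_injective (p := fun v : D g n → ℂ => v ≠ 0)).injOn).image (Projectivization.mk' ℂ)
  refine (h1.preimage (Subtype.val_injective (p := (· ∈ X g n))).injOn).subset ?_
  intro P hP
  obtain ⟨τ, rfl⟩ := exists_eq_psi hn P
  have hτ : psi le_rfl τ = psi le_rfl τ₀ := (phi_psi hn τ).symm.trans hP
  obtain ⟨c, hc⟩ := (Projectivization.mk_eq_mk_iff ℂ _ _ _ _).1 (congrArg Subtype.val hτ)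
  have hne : (c : ℂ)⁻¹ • alpha g n τ ≠ 0 :=
    smul_ne_zero (inv_ne_zero c.ne_zero) (alpha_ne_zero hn τ)
  refine ⟨⟨(c : ℂ)⁻¹ • alpha g n τ, hne⟩, fun d => ⟨τ, c, c.ne_zero, fun s t => ?_, ?_⟩,
    mk_eq_of_eq_smul hne _ rfl⟩
  · rw [← alpha_halfChar, ← alpha_halfChar, ← hc]
    rfl
  · exact (alpha_apply τ d).symm.trans (mul_inv_cancel_left₀ c.ne_zero _).symm

end

end ThetaConst

theorem lemma2p8 (g n : ℕ) (hn : 1 ≤ n) :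
    (∀ τ : ThetaConst.SiegelUpperHalfSpace g, ThetaConst.alpha g n τ ≠ 0) ∧
    ∃ φ : ThetaConst.X g n → ThetaConst.X g 1,
      (∀ (v : ThetaConst.D g n → ℂ) (hv : v ≠ 0)
          (hP : Projectivization.mk ℂ v hv ∈ ThetaConst.X g n),
        ∃ hw : ThetaConst.forget hn v ≠ 0,
          (φ ⟨Projectivization.mk ℂ v hv, hP⟩ : Projectivization ℂ (ThetaConst.D g 1 → ℂ)) =
            Projectivization.mk ℂ (ThetaConst.forget hn v) hw) ∧
      ThetaConst.IsFiniteMap φ :=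
  ⟨ThetaConst.alpha_ne_zero hn, ThetaConst.phi hn, ThetaConst.phi_mk hn,
    ThetaConst.continuous_phi hn, ThetaConst.isClosedMap_phi hn, ThetaConst.finite_phi_fiber hn⟩
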